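/- **Conventions.** For a real square matrix $W$ with real spectrum, $\lambda_{\max}(W)$ is its largest eigenvalue. $\mathrm{GOE}(1/n)$ is the law of a symmetric $n\times n$ matrix with independent centred Gaussian entries on and above the diagonal, of variance $1/n$ off the diagonal and $2/n$ on it (equivalently, the law of $(G+G^\top)/\sqrt{2n}$ with $G$ having i.i.d. $\mathcal N(0,1)$ entries). **Theorem 3.2 and its Wigner and Wishart analogues.** (1) *Canonical correlation (CCA).* Let $\tau_m,\tau_k>0$ with $\kappa:=(\tau_m\tau_k)^{-1/4}<1$. There are constants $c,C>0$ depending only on $\tau_m,\tau_k$ such that the following holds. Let $n,m,k\to\infty$ along any sequence with $n/m\to\tau_m$ and $n/k\to\tau_k$, and let $U\in\mathbb R^{n\times m}$, $V\in\mathbb R^{n\times k}$ be independent with i.i.d. $\mathcal N(0,1/m)$, respectively $\mathcal N(0,1/k)$, entries. Put $$W=\begin{pmatrix}-\kappa U^\top U & U^\top V\\ V^\top U & -\kappa V^\top V\end{pmatrix}.$$ Then, from some point of the sequence on, for all $\varepsilon\in(0,1)$ with $n\varepsilon^2\ge C$, $$\mathbb P\Big(\lambda_{\max}(W)\ge \tfrac{1-\kappa^2}{\kappa}+\varepsilon\Big)\le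 e^{-c n\varepsilon^2}.$$ (2) *Correlated spiked Wigner.* Let $\alpha,\beta\in(0,1)$ with $\kappa:=\Big(\frac{(1-\alpha^2)(1-\beta^2)}{\alpha^2\beta^2}\Big)^{1/4}<1$. There are constants $c,C>0$ depending only on $\alpha,\beta$ such that, for independent $U,V\sim\mathrm{GOE}(1/n)$ and $$W=\begin{pmatrix}\widetilde U&\kappa\widetilde V\\ \kappa\widetilde U&\widetilde V\end{pmatrix},\qquad \widetilde U=\alpha U-\alpha^2I_n,\quad \widetilde V=\beta V-\beta^2I_n,$$ one has $\mathbb P(\lambda_{\max}(W)\ge 1+\varepsilon)\le e^{-cn\varepsilon^2}$ for all $n$ and all $\varepsilon\in(0,1)$ with $n\varepsilon^2\ge C$. (3) *Correlated spiked Wishart.* Let $\alpha,\beta,\tau>0$ with $\alpha\sqrt\tau<1$, $\beta\sqrt\tau<1$ and $\kappa:=\Big(\frac{(1-\tau\alpha^2)(1-\tau\beta^2)}{\tau^2\alpha^2\beta^2}\Big)^{1/4}<1$. There is a constant $c>0$ depending only on $\alpha,\beta,\tau$ such that the following holds. Let $n,m\to\infty$ along any sequence with $n/m\to\tau$, let $U,V\in\mathbb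 R^{n\times m}$ be independent with i.i.d. $\mathcal N(0,1/m)$ entries, and put $$W=\begin{pmatrix}\widetilde U&\kappa\widetilde V\\ \kappa\widetilde U&\widetilde V\end{pmatrix},\qquad \widetilde U=\tfrac{\alpha}{1+\alpha}U^\top U-\alpha\tau I_m,\quad \widetilde V=\tfrac{\beta}{1+\beta}V^\top V-\beta\tau I_m.$$ Then for every fixed $\varepsilon\in(0,1)$, from some point of the sequence on (depending on $\varepsilon$), $\mathbb P(\lambda_{\max}(W)\ge 1+\varepsilon)\le e^{-cn\varepsilon^2}$. -/

import Mathlib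

open MeasureTheory ProbabilityTheory Filter Topology Set
open scoped NNReal ENNReal Matrix

noncomputable section

/-- The largest (real) eigenvalue of a square real matrix. Every matrix it is applied to below is
symmetric or similar to a symmetric matrix, so that all its eigenvalues are real. -/
def lambdaMax {ι : Type*} [Fintype ι] [DecidableEq ι] (W : Matrix ι ι ℝ) : ℝ :=
  sSup (spectrum ℝ W)

/-- As soon as there is a real eigenvalue, `lambdaMax W` is the greatest one. -/
theorem isGreatest_lambdaMax {ι : Type*} [Fintype ι] [DecidableEq ι] (W : Matrix ι ι ℝ)
    (h : (spectrum ℝ W).Nonempty) : IsGreatest (spectrum ℝ W) (lambdaMax W) := by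
  have hf : (spectrum ℝ W).Finite := Matrix.finite_real_spectrum
  exact ⟨h.csSup_mem hf, fun _ hx => le_csSup hf.bddAbove hx⟩

/-- The law of an `n × m` matrix whose entries are independent `N(0, v)` random variables. -/
def gaussianMatrixLaw (n m : ℕ) (v : ℝ≥0) : Measure (Fin n → Fin m → ℝ) :=
  Measure.pi fun _ => Measure.pi fun _ => gaussianReal 0 v

instance (n m : ℕ) (v : ℝ≥0) : IsProbabilityMeasure (gaussianMatrixLaw n m v) := by
  unfold gaussianMatrixLaw; infer_instance

/-- The map `G ↦ (G + Gᵀ) / √(2n)` on `n × n` matrices. -/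
def goeMap (n : ℕ) (G : Fin n → Fin n → ℝ) : Fin n → Fin n → ℝ :=
  fun i j => (G i j + G j i) / √(2 * n)

theorem measurable_goeMap (n : ℕ) : Measurable (goeMap n) := by
  unfold goeMap; fun_prop

/-- The law `GOE(1/n)`: symmetric `n × n` matrices whose entries on and above the diagonal are
independent centred Gaussians, of variance `1/n` off the diagonal and `2/n` on the diagonal;
it is the law of `(G + Gᵀ) / √(2n)` where `G` has independent `N(0, 1)` entries. -/
def goeLaw (n : ℕ) : Measure (Fin n → Fin n → ℝ) :=
  (gaussianMatrixLaw n n 1).map (goeMap n)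

instance (n : ℕ) : IsProbabilityMeasure (goeLaw n) :=
  Measure.isProbabilityMeasure_map (measurable_goeMap n).aemeasurable

/-! ### Canonical correlation model -/

/-- The null model: `U` (`n × m`) and `V` (`n × k`) are independent Gaussian matrices with
independent entries of variance `1/m` and `1/k` respectively. -/
def ccaNull (n m k : ℕ) : Measure ((Fin n → Fin m → ℝ) × (Fin n → Fin k → ℝ)) :=
  (gaussianMatrixLaw n m (1 / m)).prod (gaussianMatrixLaw n k (1 / k))

/-- The threshold `κ = (τ_m τ_k)^{-1/4}`. -/
def ccaKappa (τm τk : ℝ) : ℝ := (τm * τk) ^ (-(1 / 4) : ℝ)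

/-- The matrix `W = [[-κ UᵀU, UᵀV], [VᵀU, -κ VᵀV]]`. -/
def ccaW {n m k : ℕ} (κ : ℝ) (U : Matrix (Fin n) (Fin m) ℝ) (V : Matrix (Fin n) (Fin k) ℝ) :
    Matrix (Fin m ⊕ Fin k) (Fin m ⊕ Fin k) ℝ :=
  Matrix.fromBlocks (-κ • (Uᵀ * U)) (Uᵀ * V) (Vᵀ * U) (-κ • (Vᵀ * V))

/-! ### Correlated spiked Wigner and Wishart models -/

/-- The threshold `κ = ((1 - τα²)(1 - τβ²) / (τ²α²β²))^{1/4}` (with `τ = 1` for the Wigner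
model). -/
def spikedKappa (α β τ : ℝ) : ℝ :=
  ((1 - τ * α ^ 2) * (1 - τ * β ^ 2) / (τ ^ 2 * α ^ 2 * β ^ 2)) ^ (1 / 4 : ℝ)

/-- The matrix `[[A, κ B], [κ A, B]]`. -/
def spikedW {d : ℕ} (κ : ℝ) (A B : Matrix (Fin d) (Fin d) ℝ) :
    Matrix (Fin d ⊕ Fin d) (Fin d ⊕ Fin d) ℝ :=
  Matrix.fromBlocks A (κ • B) (κ • A) B

/-- The Wigner null model: two independent `GOE(1/n)` matrices. -/
def wignerNull (n : ℕ) : Measure ((Fin n → Fin n → ℝ) × (Fin n → Fin n → ℝ)) :=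
  (goeLaw n).prod (goeLaw n)

/-- `α U - α² I`. -/
def wignerBar {n : ℕ} (α : ℝ) (U : Matrix (Fin n) (Fin n) ℝ) : Matrix (Fin n) (Fin n) ℝ :=
  α • U - α ^ 2 • (1 : Matrix (Fin n) (Fin n) ℝ)

/-- The matrix `W` of the Wigner model. -/
def wignerW {n : ℕ} (α β : ℝ) (U V : Matrix (Fin n) (Fin n) ℝ) :
    Matrix (Fin n ⊕ Fin n) (Fin n ⊕ Fin n) ℝ :=
  spikedW (spikedKappa α β 1) (wignerBar α U) (wignerBar β V)

/-- The Wishart null model: two independent `n × m` matrices with independent `N(0, 1/m)`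
entries. -/
def wishartNull (n m : ℕ) : Measure ((Fin n → Fin m → ℝ) × (Fin n → Fin m → ℝ)) :=
  (gaussianMatrixLaw n m (1 / m)).prod (gaussianMatrixLaw n m (1 / m))

/-- `(α / (1 + α)) UᵀU - α τ I`. -/
def wishartBar {n m : ℕ} (α τ : ℝ) (U : Matrix (Fin n) (Fin m) ℝ) : Matrix (Fin m) (Fin m) ℝ :=
  (α / (1 + α)) • (Uᵀ * U) - (α * τ) • (1 : Matrix (Fin m) (Fin m) ℝ)

/-- The matrix `W` of the Wishart model. -/
def wishartW {n m : ℕ} (α β τ : ℝ) (U V : Matrix (Fin n) (Fin m) ℝ) :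
    Matrix (Fin m ⊕ Fin m) (Fin m ⊕ Fin m) ℝ :=
  spikedW (spikedKappa α β τ) (wishartBar α τ U) (wishartBar β τ V)

end

/-! A large eigenvalue forces a quadratic form, built from Gaussian matrices, to be large at an
eigenvector. Gaussian comparison replaces each matrix bilinear form `⟨p, Gx⟩` by `|x|⟨p, g⟩ + |p|⟨x,
h⟩` with independent Gaussian vectors. After that the bound is deterministic algebra on the event,
of probability exponentially close to one, that the vectors have their typical norms and are nearly
orthogonal.

Spiked models. With `K = [[1, κ], [κ, 1]]` one has `W = K diag(A, B)`, so an eigenvector `(x, y)`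
satisfies `(1 - κ²)(⟨x, Ax⟩ + ⟨y, By⟩) = Λ Q(x, y)`, where `Q = |x|² + |y|² - 2κ⟨x, y⟩` comes from
`(1 - κ²)K⁻¹`. For Wigner, Slepian's inequality gives `(2α/√n)|x|⟨x, g⟩`, at most `α²|x|² + ⟨g,
x⟩²/n`; the first term is cancelled exactly by the shift. For Wishart, `|Ux|² = max_p (2⟨p, Ux⟩ -
|p|²)` makes the form bilinear, and the weight `α/(1+α)` makes the shift `ατ|x|²` cancel in the same
way. Both leave a rank-two form `⟨g, x⟩² + ⟨h, y⟩²`; as `g` and `h` are nearly orthogonal and of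
nearly equal norm, `sq_add_sq_le_couplingForm` bounds it by the norm squared times `Q/(1 - κ²)`,
whence the threshold `1`.

Canonical correlation. Put `L = (1 - κ²)/κ`, so that `1/κ = L + κ`. Fix `U` and put `v = Vy`.
Completing two squares (`cca_form_le`) eliminates `x` at the price of an arbitrary vector `r`, and
`L|v|²` is the maximum over `p` of `2⟨p, v⟩ - |p|²/L`. The event becomes "some `(y, p)` beats every
`r`", the setting of Gordon's min-max inequality. Choosing `r` proportional to `g` reduces it to an
excess of `L|h|² + κ²L(|Uᵀg|² - |g|²)` over `kL`, which is improbable because `|h|² ≈ k` and `|Uᵀg|²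
≈ |g|²`.

Gordon's inequality itself follows from integration by parts along a path joining two Gaussian
families, applied to a smoothed indicator whose mixed derivatives between different rows are
nonnegative. -/

/-! ### Gaussian families through integration by parts -/

/-- Bounded continuously differentiable functions with bounded derivative. -/
structure BddC1 {T : Type*} [Fintype T] (f : (T → ℝ) → ℝ) : Prop where
  contDiff : ContDiff ℝ 1 f
  bdd : ∃ M, ∀ z, ‖f z‖ ≤ M
  bdd_fderiv : ∃ M, ∀ z, ‖fderiv ℝ f z‖ ≤ M

theorem BddC1.fderiv_comp_affine {S T : Type*} [Fintype S] [Fintype T] {f : (T → ℝ) → ℝ}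
    (hf : BddC1 f) (L : (S → ℝ) →L[ℝ] (T → ℝ)) (c : T → ℝ) (z : S → ℝ) :
    fderiv ℝ (fun z => f (L z + c)) z = (fderiv ℝ f (L z + c)).comp L := by
  have h1 : HasFDerivAt f (fderiv ℝ f (L z + c)) (L z + c) :=
    ((hf.contDiff.differentiable (by norm_num)) _).hasFDerivAt
  exact (h1.comp z (L.hasFDerivAt.add_const c)).fderiv

theorem BddC1.comp_affine {S T : Type*} [Fintype S] [Fintype T] {f : (T → ℝ) → ℝ}
    (hf : BddC1 f) (L : (S → ℝ) →L[ℝ] (T → ℝ)) (c : T → ℝ) :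
    BddC1 (fun z => f (L z + c)) where
  contDiff := hf.contDiff.comp (L.contDiff.add contDiff_const)
  bdd := by
    obtain ⟨M, hM⟩ := hf.bdd
    exact ⟨M, fun z => hM _⟩
  bdd_fderiv := by
    obtain ⟨M, hM⟩ := hf.bdd_fderiv
    refine ⟨M * ‖L‖, fun z => ?_⟩
    rw [hf.fderiv_comp_affine]
    exact (ContinuousLinearMap.opNorm_comp_le _ _).trans
      (mul_le_mul_of_nonneg_right (hM _) (norm_nonneg _))

/-- A finite family of real random variables satisfying the Gaussian integration by parts formula
with covariance `C`, i.e. a centred Gaussian family with that covariance. -/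
structure GaussianFamily {Ω T : Type*} [MeasurableSpace Ω] [Fintype T] (P : Measure Ω)
    (X : T → Ω → ℝ) (C : T → T → ℝ) : Prop where
  measurable : ∀ t, Measurable (X t)
  integrable : ∀ t, Integrable (X t) P
  ibp : ∀ f : (T → ℝ) → ℝ, BddC1 f → ∀ t,
    ∫ ω, X t ω * f (fun u => X u ω) ∂P = ∫ ω, fderiv ℝ f (fun u => X u ω) (C t) ∂P

theorem integrable_id_gaussianReal_zero (v : ℝ≥0) :
    Integrable (fun x : ℝ => x) (gaussianReal 0 v) :=
  (memLp_one_iff_integrable.1 (memLp_id_gaussianReal (μ := 0) (v := v) 1))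

theorem hasDerivAt_gaussianPDFReal (v : ℝ≥0) (x : ℝ) :
    HasDerivAt (gaussianPDFReal 0 v) (-(x / v) * gaussianPDFReal 0 v x) x := by
  have h : HasDerivAt (fun x : ℝ => (√(2 * Real.pi * v))⁻¹ * Real.exp (-(x - 0) ^ 2 / (2 * v)))
      ((√(2 * Real.pi * v))⁻¹ * (Real.exp (-(x - 0) ^ 2 / (2 * v)) *
        (-(2 * (x - 0) ^ 1 * 1) / (2 * v)))) x := by
    have h1 : HasDerivAt (fun x : ℝ => -(x - 0) ^ 2 / (2 * (v : ℝ)))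
        (-(2 * (x - 0) ^ 1 * 1) / (2 * v)) x := by
      simpa using ((((hasDerivAt_id x).sub_const 0).pow 2).neg).div_const (2 * (v : ℝ))
    exact (h1.exp).const_mul _
  have e : gaussianPDFReal 0 v
      = fun x : ℝ => (√(2 * Real.pi * v))⁻¹ * Real.exp (-(x - 0) ^ 2 / (2 * v)) := rfl
  rw [e]
  convert h using 1
  by_cases hv : (v : ℝ) = 0
  · simp [hv]
  · field_simp
    ring

/-- Gaussian integration by parts in dimension one. -/
theorem integral_id_mul_gaussianReal (v : ℝ≥0) {F F' : ℝ → ℝ}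
    (hF : ∀ x, HasDerivAt F (F' x) x) (hF' : Continuous F') (hb : ∃ M, ∀ x, ‖F x‖ ≤ M)
    (hb' : ∃ M, ∀ x, ‖F' x‖ ≤ M) :
    ∫ x, x * F x ∂gaussianReal 0 v = v * ∫ x, F' x ∂gaussianReal 0 v := by
  by_cases hv : v = 0
  · subst hv
    simp
  obtain ⟨M, hM⟩ := hb
  obtain ⟨M', hM'⟩ := hb'
  have hv' : (v : ℝ) ≠ 0 := by simpa using hv
  have hFc : Continuous F := continuous_iff_continuousAt.2 fun x => (hF x).continuousAt
  have hp := integrable_gaussianPDFReal 0 v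
  have hxp : Integrable (fun x => x * gaussianPDFReal 0 v x) := by
    have h := integrable_id_gaussianReal_zero v
    rw [gaussianReal_of_var_ne_zero 0 hv] at h
    rw [integrable_withDensity_iff_integrable_smul' (measurable_gaussianPDF 0 v)
      (ae_of_all _ fun x => gaussianPDF_lt_top)] at h
    simpa [toReal_gaussianPDF, mul_comm] using h
  have i1 : Integrable (F * fun x => -(x / v) * gaussianPDFReal 0 v x) := by
    have := (hxp.const_mul (-(1 / (v : ℝ)))).bdd_mul hFc.aestronglyMeasurable (ae_of_all _ hM)
    refine this.congr (ae_of_all _ fun x => ?_)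
    simp only [Pi.mul_apply]
    ring
  have i2 : Integrable (F' * gaussianPDFReal 0 v) :=
    hp.bdd_mul hF'.aestronglyMeasurable (ae_of_all _ hM')
  have i3 : Integrable (F * gaussianPDFReal 0 v) :=
    hp.bdd_mul hFc.aestronglyMeasurable (ae_of_all _ hM)
  have key := integral_mul_deriv_eq_deriv_mul_of_integrable (u := F) (u' := F')
    (v := gaussianPDFReal 0 v) (fun x _ => hF x) (fun x _ => hasDerivAt_gaussianPDFReal v x)
    i1 i2 i3
  rw [integral_gaussianReal_eq_integral_smul hv, integral_gaussianReal_eq_integral_smul hv]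
  simp only [smul_eq_mul]
  have e1 : ∫ x, gaussianPDFReal 0 v x * (x * F x)
      = -v * ∫ x, F x * (-(x / v) * gaussianPDFReal 0 v x) := by
    rw [← integral_const_mul]
    congr 1
    ext x
    field_simp
  rw [e1, key]
  simp only [neg_mul, mul_neg, neg_neg]
  congr 2
  ext x
  ring

namespace GaussianFamily

theorem gaussianReal {T : Type*} [Fintype T] (v : ℝ≥0) (c : T → ℝ) :
    GaussianFamily (gaussianReal 0 v) (fun t x => c t * x) (fun t u => v * (c t * c u)) where
  measurable t := by fun_prop
  integrable t := (integrable_id_gaussianReal_zero v).const_mul _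
  ibp f hf t := by
    obtain ⟨M, hM⟩ := hf.bdd
    obtain ⟨M', hM'⟩ := hf.bdd_fderiv
    have hd : ∀ x : ℝ, HasDerivAt (fun x : ℝ => f (fun u => c u * x))
        (fderiv ℝ f (fun u => c u * x) c) x := fun x => by
      have h1 : HasDerivAt (fun x : ℝ => fun u => c u * x) c x := by
        rw [hasDerivAt_pi]
        intro u
        simpa using (hasDerivAt_id x).const_mul (c u)
      exact (((hf.contDiff.differentiable (by norm_num)) _).hasFDerivAt).comp_hasDerivAt x h1
    have hc : Continuous fun x : ℝ => fderiv ℝ f (fun u => c u * x) c :=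
      ((hf.contDiff.continuous_fderiv (by norm_num)).comp (by fun_prop)).clm_apply continuous_const
    have key := integral_id_mul_gaussianReal v hd hc ⟨M, fun x => hM _⟩
      ⟨M' * ‖c‖, fun x => (ContinuousLinearMap.le_opNorm _ _).trans
        (mul_le_mul_of_nonneg_right (hM' _) (norm_nonneg _))⟩
    have e : (fun u => (v : ℝ) * (c t * c u)) = ((v : ℝ) * c t) • c := by
      ext u
      simp [mul_assoc]
    simp only [e, map_smul, smul_eq_mul, mul_assoc]
    rw [integral_const_mul, integral_const_mul, integral_const_mul, key]
    ring

section

variable {Ω Ω' T S : Type*} [MeasurableSpace Ω] [MeasurableSpace Ω'] [Fintype T] [Fintype S]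
  {P : Measure Ω} {P' : Measure Ω'} {X : T → Ω → ℝ} {C : T → T → ℝ}

theorem integrable_bdd_comp [IsFiniteMeasure P] {f : Ω → ℝ} (hf : Measurable f)
    (hb : ∃ M, ∀ z, ‖f z‖ ≤ M) : Integrable f P := by
  obtain ⟨M, hM⟩ := hb
  exact Integrable.of_bound hf.aestronglyMeasurable M (ae_of_all _ hM)

/-- Repetitions in `π` are allowed, so two differently scaled copies of one family can be placed
side by side; the interpolation uses this for position and velocity. -/
theorem smul_reindex (h : GaussianFamily P X C) (c : S → ℝ) (π : S → T) :
    GaussianFamily P (fun s ω => c s * X (π s) ω)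
      (fun s s' => c s * c s' * C (π s) (π s')) where
  measurable s := (h.measurable _).const_mul _
  integrable s := (h.integrable _).const_mul _
  ibp f hf s := by
    let L : (T → ℝ) →L[ℝ] (S → ℝ) :=
      ContinuousLinearMap.pi fun s => c s • ContinuousLinearMap.proj (π s)
    have hL : ∀ z, L z = fun s => c s * z (π s) := fun z => by
      ext s
      simp [L]
    have key := h.ibp (fun z => f (L z + 0)) (hf.comp_affine L 0) (π s)
    simp only [hf.fderiv_comp_affine] at key
    simp only [add_zero, hL, ContinuousLinearMap.comp_apply] at key
    simp only [mul_assoc]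
    rw [integral_const_mul, key, ← integral_const_mul]
    congr 1
    ext ω
    rw [← smul_eq_mul, ← map_smul]
    rfl

theorem of_measurePreserving [IsProbabilityMeasure P'] {X' : T → Ω' → ℝ} {e : Ω → Ω'}
    (he : MeasurePreserving e P P') (hm : ∀ t, Measurable (X' t))
    (h : GaussianFamily P (fun t ω => X' t (e ω)) C) : GaussianFamily P' X' C where
  measurable := hm
  integrable t := by
    rw [← he.map_eq]
    exact (integrable_map_measure (hm t).aestronglyMeasurable he.measurable.aemeasurable).2
      (h.integrable t)
  ibp f hf t := by
    have hv : Measurable fun ω u => X' u ω := measurable_pi_lambda _ hm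
    have key := h.ibp f hf t
    rw [← he.map_eq, integral_map he.measurable.aemeasurable, integral_map
      he.measurable.aemeasurable, key]
    · exact (((hf.contDiff.continuous_fderiv (by norm_num)).clm_apply
        continuous_const).measurable.comp hv).aestronglyMeasurable
    · exact ((hm t).mul (hf.contDiff.continuous.measurable.comp hv)).aestronglyMeasurable

theorem congr {X' : T → Ω → ℝ} {C' : T → T → ℝ} (h : GaussianFamily P X C)
    (hX : ∀ t ω, X' t ω = X t ω) (hC : ∀ t u, C' t u = C t u) : GaussianFamily P X' C' := by
  have e1 : X' = X := by ext; apply hX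
  have e2 : C' = C := by ext; apply hC
  rwa [e1, e2]

/-- By Fubini, each summand is integrated by parts in its own variable while the other is frozen and
acts as a translation of the test function. -/
theorem prod_add [IsProbabilityMeasure P] [IsProbabilityMeasure P'] {X' : T → Ω' → ℝ}
    {C' : T → T → ℝ} (h : GaussianFamily P X C) (h' : GaussianFamily P' X' C') :
    GaussianFamily (P.prod P') (fun t ω => X t ω.1 + X' t ω.2) (fun t u => C t u + C' t u) where
  measurable t := ((h.measurable t).comp measurable_fst).add ((h'.measurable t).comp measurable_snd)
  integrable t := ((h.integrable t).comp_fst P').add ((h'.integrable t).comp_snd P)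
  ibp f hf t := by
    obtain ⟨M, hM⟩ := hf.bdd
    obtain ⟨M', hM'⟩ := hf.bdd_fderiv
    have hv : Measurable fun (ω : Ω × Ω') u => X u ω.1 + X' u ω.2 := measurable_pi_lambda _
      fun t => ((h.measurable t).comp measurable_fst).add ((h'.measurable t).comp measurable_snd)
    have hfm : Measurable fun ω : Ω × Ω' => f (fun u => X u ω.1 + X' u ω.2) :=
      hf.contDiff.continuous.measurable.comp hv
    have hdm : ∀ w, Measurable
        fun ω : Ω × Ω' => fderiv ℝ f (fun u => X u ω.1 + X' u ω.2) w := fun w =>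
      ((hf.contDiff.continuous_fderiv (by norm_num)).clm_apply continuous_const).measurable.comp hv
    have hdi : ∀ w, Integrable
        (fun ω : Ω × Ω' => fderiv ℝ f (fun u => X u ω.1 + X' u ω.2) w) (P.prod P') := fun w =>
      integrable_bdd_comp (hdm w) ⟨M' * ‖w‖, fun z => (ContinuousLinearMap.le_opNorm _ _).trans
        (mul_le_mul_of_nonneg_right (hM' _) (norm_nonneg _))⟩
    have i1 : Integrable (fun ω : Ω × Ω' => X t ω.1 * f (fun u => X u ω.1 + X' u ω.2))
        (P.prod P') :=
      ((h.integrable t).comp_fst P').mul_bdd hfm.aestronglyMeasurable (ae_of_all _ fun z => hM _)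
    have i2 : Integrable (fun ω : Ω × Ω' => X' t ω.2 * f (fun u => X u ω.1 + X' u ω.2))
        (P.prod P') :=
      ((h'.integrable t).comp_snd P).mul_bdd hfm.aestronglyMeasurable (ae_of_all _ fun z => hM _)
    have k1 : ∀ ω', ∫ ω, X t ω * f (fun u => X u ω + X' u ω') ∂P
        = ∫ ω, fderiv ℝ f (fun u => X u ω + X' u ω') (C t) ∂P := fun ω' => by
      have := h.ibp _ (hf.comp_affine (ContinuousLinearMap.id ℝ _) fun u => X' u ω') t
      simp only [hf.fderiv_comp_affine] at this
      exact this
    have k2 : ∀ ω, ∫ ω', X' t ω' * f (fun u => X u ω + X' u ω') ∂P'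
        = ∫ ω', fderiv ℝ f (fun u => X u ω + X' u ω') (C' t) ∂P' := fun ω => by
      have := h'.ibp _ (hf.comp_affine (ContinuousLinearMap.id ℝ _) fun u => X u ω) t
      simp only [hf.fderiv_comp_affine] at this
      have e : ∀ ω', (fun u => X u ω + X' u ω') = (fun u => X' u ω') + fun u => X u ω :=
        fun ω' => by ext u; simp [add_comm]
      simp only [e]
      exact this
    have e : (fun u => C t u + C' t u) = C t + C' t := rfl
    simp only [add_mul, e, map_add]
    rw [integral_add i1 i2, integral_add (hdi _) (hdi _), integral_prod_symm _ i1,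
      integral_prod _ i2, integral_prod_symm _ (hdi _), integral_prod _ (hdi _)]
    simp only [k1, k2]

theorem zero [IsProbabilityMeasure P] :
    GaussianFamily P (fun (_ : T) _ => 0) (fun _ _ => 0) where
  measurable t := measurable_const
  integrable t := integrable_const _
  ibp f hf t := by
    have : (fun _ : T => (0 : ℝ)) = 0 := rfl
    simp [this]

end

theorem pi_sum {E T : Type*} [MeasurableSpace E] [Fintype T] {μ : Measure E}
    [IsProbabilityMeasure μ] : ∀ {n : ℕ} {X : Fin n → T → E → ℝ} {C : Fin n → T → T → ℝ},
    (∀ i, GaussianFamily μ (X i) (C i)) →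
    GaussianFamily (Measure.pi fun _ : Fin n => μ) (fun t ω => ∑ i, X i t (ω i))
      (fun t u => ∑ i, C i t u) := by
  intro n
  induction n with
  | zero =>
    intro X C h
    exact zero.congr (by simp) (by simp)
  | succ n ih =>
    intro X C h
    have h1 := (h 0).prod_add (ih fun i => h i.succ)
    have he := (measurePreserving_piFinSuccAbove (fun _ : Fin (n + 1) => μ) 0).symm
    refine (of_measurePreserving he ?_ (h1.congr ?_ fun _ _ => rfl)).congr (fun _ _ => rfl) ?_
    · intro t
      exact Finset.measurable_sum _ fun i _ => ((h i).measurable t).comp (measurable_pi_apply i)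
    · intro t ω
      rw [Fin.sum_univ_succ]
      simp [MeasurableEquiv.piFinSuccAbove, Fin.insertNthEquiv]
    · intro t u
      rw [Fin.sum_univ_succ]

theorem vector {T : Type*} [Fintype T] (n : ℕ) (v : ℝ≥0) (a : T → Fin n → ℝ) :
    GaussianFamily (Measure.pi fun _ : Fin n => ProbabilityTheory.gaussianReal 0 v)
      (fun t g => ∑ i, a t i * g i) (fun t u => v * ∑ i, a t i * a u i) :=
  (pi_sum fun i => gaussianReal v fun t => a t i).congr (fun _ _ => rfl)
    fun t u => by rw [Finset.mul_sum]

theorem matrix {T : Type*} [Fintype T] (n m : ℕ) (v : ℝ≥0) (a : T → Fin n → Fin m → ℝ) :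
    GaussianFamily (gaussianMatrixLaw n m v)
      (fun t G => ∑ i, ∑ j, a t i j * G i j) (fun t u => v * ∑ i, ∑ j, a t i j * a u i j) :=
  (pi_sum fun i => vector m v fun t => a t i).congr (fun _ _ => rfl)
    fun t u => by rw [Finset.mul_sum]

end GaussianFamily

/-! ### Interpolation between two Gaussian families -/

theorem map_eq_sum_single {T : Type*} [Fintype T] [DecidableEq T] (L : (T → ℝ) →L[ℝ] ℝ)
    (v : T → ℝ) : L v = ∑ t, v t * L (Pi.single t 1) := by
  have h : v = ∑ t, v t • (Pi.single t (1 : ℝ) : T → ℝ) := by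
    ext u
    simp [Finset.sum_apply, Pi.single_apply]
  conv_lhs => rw [h]
  simp [map_sum]

/-- Gaussian interpolation: comparing two Gaussian families through the second derivatives of a
test function. -/
theorem GaussianFamily.integral_le_integral {Ω Ω' T : Type*} [MeasurableSpace Ω]
    [MeasurableSpace Ω'] [Fintype T] [DecidableEq T] {P : Measure Ω} {P' : Measure Ω'}
    [IsProbabilityMeasure P] [IsProbabilityMeasure P'] {X : T → Ω → ℝ} {Y : T → Ω' → ℝ}
    {C C' : T → T → ℝ} (hX : GaussianFamily P X C) (hY : GaussianFamily P' Y C')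
    {f : (T → ℝ) → ℝ} (hf : BddC1 f)
    (hD : ∀ t, BddC1 fun z => fderiv ℝ f z (Pi.single t 1))
    (hpos : ∀ z, 0 ≤ ∑ t, fderiv ℝ (fun w => fderiv ℝ f w (Pi.single t 1)) z
      (fun u => C t u - C' t u)) :
    ∫ ω, f (fun t => Y t ω) ∂P' ≤ ∫ ω, f (fun t => X t ω) ∂P := by
  obtain ⟨M, hM⟩ := hf.bdd
  obtain ⟨M', hM'⟩ := hf.bdd_fderiv
  let Q := P.prod P'
  -- A rotation from `Y` at `θ = 0` to `X` at `θ = π/2`. Its velocity `Z'` stays dominated by `|X| +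
  -- |Y|` up to the endpoints, which a path with square-root coefficients would not allow.
  let Z : ℝ → Ω × Ω' → T → ℝ := fun θ ω t => Real.sin θ * X t ω.1 + Real.cos θ * Y t ω.2
  let Z' : ℝ → Ω × Ω' → T → ℝ := fun θ ω t => Real.cos θ * X t ω.1 + -Real.sin θ * Y t ω.2
  have hXm : ∀ t, Measurable fun ω : Ω × Ω' => X t ω.1 := fun t =>
    (hX.measurable t).comp measurable_fst
  have hYm : ∀ t, Measurable fun ω : Ω × Ω' => Y t ω.2 := fun t =>
    (hY.measurable t).comp measurable_snd
  have hZm : ∀ θ, Measurable (Z θ) := fun θ => measurable_pi_lambda _ fun t =>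
    ((hXm t).const_mul _).add ((hYm t).const_mul _)
  have hZm' : ∀ θ t, Measurable fun ω => Z' θ ω t := fun θ t =>
    ((hXm t).const_mul _).add ((hYm t).const_mul _)
  have hXi : ∀ t, Integrable (fun ω : Ω × Ω' => X t ω.1) Q := fun t => (hX.integrable t).comp_fst P'
  have hYi : ∀ t, Integrable (fun ω : Ω × Ω' => Y t ω.2) Q := fun t => (hY.integrable t).comp_snd P
  have hDm : ∀ θ t, Measurable fun ω => fderiv ℝ f (Z θ ω) (Pi.single t 1) := fun θ t =>
    (hD t).contDiff.continuous.measurable.comp (hZm θ)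
  have hDint : ∀ θ t, Integrable (fun ω => Z' θ ω t * fderiv ℝ f (Z θ ω) (Pi.single t 1)) Q :=
    fun θ t => by
      obtain ⟨B, hB⟩ := (hD t).bdd
      exact (((hXi t).const_mul _).add ((hYi t).const_mul _)).mul_bdd (c := B)
        (hDm θ t).aestronglyMeasurable (ae_of_all _ fun ω => hB _)
  have hderiv : ∀ θ, HasDerivAt (fun θ => ∫ ω, f (Z θ ω) ∂Q)
      (∫ ω, fderiv ℝ f (Z θ ω) (Z' θ ω) ∂Q) θ := fun θ => by
    refine (hasDerivAt_integral_of_dominated_loc_of_deriv_le (F := fun θ ω => f (Z θ ω))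
      (F' := fun θ ω => fderiv ℝ f (Z θ ω) (Z' θ ω))
      (bound := fun ω => M' * ∑ t, (‖X t ω.1‖ + ‖Y t ω.2‖)) univ_mem
      (Eventually.of_forall fun θ =>
        (hf.contDiff.continuous.measurable.comp (hZm θ)).aestronglyMeasurable)
      (GaussianFamily.integrable_bdd_comp (hf.contDiff.continuous.measurable.comp (hZm θ))
        ⟨M, fun ω => hM _⟩) ?_ ?_ ?_ ?_).2
    · have : (fun ω => fderiv ℝ f (Z θ ω) (Z' θ ω))
          = fun ω => ∑ t, Z' θ ω t * fderiv ℝ f (Z θ ω) (Pi.single t 1) := by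
        ext ω
        exact map_eq_sum_single _ _
      rw [this]
      exact (Finset.measurable_sum _ fun t _ => (hZm' θ t).mul (hDm θ t)).aestronglyMeasurable
    · refine ae_of_all _ fun ω θ _ => (ContinuousLinearMap.le_opNorm _ _).trans ?_
      have hn : ‖Z' θ ω‖ ≤ ∑ t, (‖X t ω.1‖ + ‖Y t ω.2‖) := by
        refine (pi_norm_le_iff_of_nonneg (by positivity)).2 fun t => ?_
        refine le_trans ?_ (Finset.single_le_sum (f := fun t => ‖X t ω.1‖ + ‖Y t ω.2‖)
          (fun t _ => by positivity) (Finset.mem_univ t))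
        refine (norm_add_le _ _).trans (add_le_add ?_ ?_)
        · rw [norm_mul]
          exact mul_le_of_le_one_left (norm_nonneg _) (Real.abs_cos_le_one θ)
        · rw [norm_mul, norm_neg]
          exact mul_le_of_le_one_left (norm_nonneg _) (Real.abs_sin_le_one θ)
      exact mul_le_mul (hM' _) hn (norm_nonneg _) ((norm_nonneg _).trans (hM' 0))
    · exact (integrable_finsetSum _ fun t _ => (hXi t).norm.add (hYi t).norm).const_mul _
    · refine ae_of_all _ fun ω θ _ => ?_
      have hZd : HasDerivAt (fun θ => Z θ ω) (Z' θ ω) θ := by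
        rw [hasDerivAt_pi]
        intro t
        exact ((Real.hasDerivAt_sin θ).mul_const _).add ((Real.hasDerivAt_cos θ).mul_const _)
      exact (((hf.contDiff.differentiable (by norm_num)) _).hasFDerivAt).comp_hasDerivAt θ hZd
  have hval : ∀ θ, ∫ ω, fderiv ℝ f (Z θ ω) (Z' θ ω) ∂Q = Real.sin θ * Real.cos θ *
      ∫ ω, ∑ t, fderiv ℝ (fun w => fderiv ℝ f w (Pi.single t 1)) (Z θ ω)
        (fun u => C t u - C' t u) ∂Q := fun θ => by
    have hW := (hX.smul_reindex (Sum.elim (fun _ : T => Real.sin θ) fun _ : T => Real.cos θ)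
      (Sum.elim id id)).prod_add (hY.smul_reindex
        (Sum.elim (fun _ : T => Real.cos θ) fun _ : T => -Real.sin θ) (Sum.elim id id))
    let L : (T ⊕ T → ℝ) →L[ℝ] (T → ℝ) :=
      ContinuousLinearMap.pi fun t => ContinuousLinearMap.proj (Sum.inl t)
    have hibp : ∀ t, ∫ ω, Z' θ ω t * fderiv ℝ f (Z θ ω) (Pi.single t 1) ∂Q
        = ∫ ω, Real.sin θ * Real.cos θ *
          fderiv ℝ (fun w => fderiv ℝ f w (Pi.single t 1)) (Z θ ω) (fun u => C t u - C' t u) ∂Q :=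
      fun t => by
        -- The multiplier is the velocity (`Sum.inr`) and the test function sees only the position
        -- (`Sum.inl`), so only their cross covariance `sin θ cos θ (C - C')` enters.
        have h := hW.ibp _ ((hD t).comp_affine L 0) (Sum.inr t)
        simp only [(hD t).fderiv_comp_affine] at h
        simp only [add_zero, ContinuousLinearMap.comp_apply] at h
        have e : L (fun u => Sum.elim (fun _ : T => Real.sin θ) (fun _ : T => Real.cos θ)
              (Sum.inr t) * Sum.elim (fun _ : T => Real.sin θ) (fun _ : T => Real.cos θ) u *
              C (Sum.elim id id (Sum.inr t)) (Sum.elim id id u) +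
            Sum.elim (fun _ : T => Real.cos θ) (fun _ : T => -Real.sin θ) (Sum.inr t) *
              Sum.elim (fun _ : T => Real.cos θ) (fun _ : T => -Real.sin θ) u *
              C' (Sum.elim id id (Sum.inr t)) (Sum.elim id id u))
            = (Real.sin θ * Real.cos θ) • fun u => C t u - C' t u := by
          ext u
          simp [L]
          ring
        rw [e] at h
        simp only [map_smul, smul_eq_mul] at h
        exact h
    have hi : ∀ t, Integrable (fun ω => fderiv ℝ (fun w => fderiv ℝ f w (Pi.single t 1)) (Z θ ω)
        (fun u => C t u - C' t u)) Q := fun t => by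
      obtain ⟨B, hB⟩ := (hD t).bdd_fderiv
      refine GaussianFamily.integrable_bdd_comp
        ((((hD t).contDiff.continuous_fderiv (by norm_num)).clm_apply
          continuous_const).measurable.comp (hZm θ)) ⟨B * ‖fun u => C t u - C' t u‖, fun ω =>
            (ContinuousLinearMap.le_opNorm _ _).trans
              (mul_le_mul_of_nonneg_right (hB _) (norm_nonneg _))⟩
    simp_rw [map_eq_sum_single (fderiv ℝ f (Z θ _)) (Z' θ _)]
    rw [integral_finsetSum _ fun t _ => hDint θ t, integral_finsetSum _ fun t _ => hi t,
      Finset.mul_sum]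
    refine Finset.sum_congr rfl fun t _ => ?_
    rw [hibp, integral_const_mul]
  have hmono : MonotoneOn (fun θ => ∫ ω, f (Z θ ω) ∂Q) (Icc 0 (Real.pi / 2)) := by
    refine monotoneOn_of_deriv_nonneg (convex_Icc _ _)
      (fun θ _ => (hderiv θ).continuousAt.continuousWithinAt)
      (fun θ _ => (hderiv θ).differentiableAt.differentiableWithinAt) fun θ hθ => ?_
    rw [interior_Icc] at hθ
    rw [(hderiv θ).deriv, hval]
    have h1 : 0 ≤ Real.sin θ :=
      Real.sin_nonneg_of_nonneg_of_le_pi hθ.1.le (by linarith [hθ.2, Real.pi_pos])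
    have h2 : 0 ≤ Real.cos θ :=
      Real.cos_nonneg_of_neg_pi_div_two_le_of_le (by linarith [hθ.1, Real.pi_pos]) hθ.2.le
    exact mul_nonneg (mul_nonneg h1 h2) (integral_nonneg fun ω => hpos _)
  have h := hmono (left_mem_Icc.2 (by positivity)) (right_mem_Icc.2 (by positivity))
    (by positivity : (0 : ℝ) ≤ Real.pi / 2)
  simp only [Z, Real.sin_zero, Real.cos_zero, Real.sin_pi_div_two, Real.cos_pi_div_two, zero_mul,
    one_mul, zero_add, add_zero] at h
  have e1 := integral_fun_snd (μ := P) (ν := P') fun ω' => f fun t => Y t ω'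
  have e2 := integral_fun_fst (μ := P) (ν := P') fun ω => f fun t => X t ω
  simp only [probReal_univ, one_smul] at e1 e2
  rwa [e1, e2] at h

/-! ### Smoothed indicators and Gordon's inequality -/

/-- The partial derivative of `h` along the coordinate `t`. -/
noncomputable def partialDeriv {T : Type*} [Fintype T] [DecidableEq T] (t : T)
    (h : (T → ℝ) → ℝ) : (T → ℝ) → ℝ :=
  fun z => fderiv ℝ h z (Pi.single t 1)

section partialDeriv

variable {T : Type*} [Fintype T] [DecidableEq T] {t u : T} {h A B R : (T → ℝ) → ℝ}

theorem hasDerivAt_partialDeriv (hh : Differentiable ℝ h) (t : T) (z : T → ℝ) :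
    HasDerivAt (fun c : ℝ => h (z + c • Pi.single t 1)) (partialDeriv t h z) 0 :=
  (hh z).hasFDerivAt.hasLineDerivAt _

theorem partialDeriv_eq_zero (hh : Differentiable ℝ h)
    (hi : ∀ z (c : ℝ), h (z + c • Pi.single t 1) = h z) : partialDeriv t h = 0 := by
  ext z
  have h1 := hasDerivAt_partialDeriv hh t z
  simp only [hi] at h1
  exact h1.unique (hasDerivAt_const _ _)

theorem partialDeriv_nonpos (hh : Differentiable ℝ h)
    (ha : ∀ z, Antitone fun c : ℝ => h (z + c • Pi.single t 1)) (z : T → ℝ) :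
    partialDeriv t h z ≤ 0 :=
  (hasDerivAt_partialDeriv hh t z).nonpos_of_antitone (ha z)

theorem partialDeriv_mul (hA : Differentiable ℝ A) (hB : Differentiable ℝ B) (t : T) :
    partialDeriv t (A * B) = partialDeriv t A * B + A * partialDeriv t B := by
  ext z
  simp only [partialDeriv]
  rw [fderiv_mul (hA z) (hB z)]
  simp [partialDeriv]
  ring

theorem partialDeriv_add_eq (hi : ∀ z (c : ℝ), h (z + c • Pi.single u 1) = h z) (z : T → ℝ)
    (c : ℝ) : partialDeriv t h (z + c • Pi.single u 1) = partialDeriv t h z := by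
  have e : (fun z => h (z + c • Pi.single u 1)) = h := by
    ext z
    exact hi z c
  have := fderiv_comp_add_right (𝕜 := ℝ) (f := h) (x := z) (c • Pi.single u 1)
  rw [e] at this
  simp only [partialDeriv]
  rw [this]

/-- In the coordinates `t` and `u` the three factors separate: only `A` feels `t` and only `B` feels
`u`, so each derivative hits a single factor. -/
theorem partialDeriv_partialDeriv_mul (hA : ContDiff ℝ 2 A) (hB : ContDiff ℝ 2 B)
    (hR : ContDiff ℝ 2 R) (hAu : ∀ z (c : ℝ), A (z + c • Pi.single u 1) = A z)
    (hBt : ∀ z (c : ℝ), B (z + c • Pi.single t 1) = B z)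
    (hRt : ∀ z (c : ℝ), R (z + c • Pi.single t 1) = R z)
    (hRu : ∀ z (c : ℝ), R (z + c • Pi.single u 1) = R z) :
    partialDeriv u (partialDeriv t (A * (B * R)))
      = partialDeriv t A * (partialDeriv u B * R) := by
  have dA := hA.differentiable (by norm_num)
  have dB := hB.differentiable (by norm_num)
  have dR := hR.differentiable (by norm_num)
  have dA' : Differentiable ℝ (partialDeriv t A) :=
    ((hA.fderiv_right (m := 1) (by norm_num)).clm_apply contDiff_const).differentiable (by norm_num)
  rw [partialDeriv_mul dA (dB.mul dR), partialDeriv_mul dB dR t, partialDeriv_eq_zero dB hBt,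
    partialDeriv_eq_zero dR hRt]
  simp only [zero_mul, mul_zero, add_zero]
  rw [partialDeriv_mul dA' (dB.mul dR), partialDeriv_mul dB dR u, partialDeriv_eq_zero dR hRu,
    partialDeriv_eq_zero dA' (partialDeriv_add_eq hAu)]
  simp

end partialDeriv

section sigmoid

variable {T : Type*} [Fintype T] [DecidableEq T]

/-- The smoothed indicator of `l t < z t`. -/
noncomputable def smoothStep (s : ℝ) (l : T → ℝ) (t : T) : (T → ℝ) → ℝ :=
  fun z => Real.sigmoid (s * (z t - l t))

omit [Fintype T] [DecidableEq T] in
theorem smoothStep_nonneg (s : ℝ) (l : T → ℝ) (t : T) (z : T → ℝ) : 0 ≤ smoothStep s l t z :=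
  Real.sigmoid_nonneg _

omit [Fintype T] [DecidableEq T] in
theorem smoothStep_le_one (s : ℝ) (l : T → ℝ) (t : T) (z : T → ℝ) : smoothStep s l t z ≤ 1 :=
  Real.sigmoid_le_one _

omit [DecidableEq T] in
theorem contDiff_smoothStep (s : ℝ) (l : T → ℝ) (t : T) : ContDiff ℝ 2 (smoothStep s l t) := by
  have h : ContDiff ℝ 2 fun z : T → ℝ => s * (z t - l t) := by fun_prop
  exact (contDiff_sigmoid.of_le le_top).comp h

theorem partialDeriv_smoothStep (s : ℝ) (l : T → ℝ) (t u : T) :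
    partialDeriv u (smoothStep s l t)
      = (if t = u then s else 0) • (smoothStep s l t * (1 - smoothStep s l t)) := by
  ext z
  have h1 : HasDerivAt (fun c : ℝ => smoothStep s l t (z + c • Pi.single u 1))
      (smoothStep s l t z * (1 - smoothStep s l t z) * (s * (Pi.single u (1 : ℝ) : T → ℝ) t)) 0 := by
    have h2 : HasDerivAt (fun c : ℝ => s * ((z + c • (Pi.single u 1 : T → ℝ)) t - l t))
        (s * (Pi.single u (1 : ℝ) : T → ℝ) t) 0 := by
      simpa using ((((hasDerivAt_id (0 : ℝ)).mul_const
        ((Pi.single u (1 : ℝ) : T → ℝ) t)).const_add (z t)).sub_const (l t)).const_mul s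
    have h3 := (Real.hasDerivAt_sigmoid (s * ((z + (0 : ℝ) • (Pi.single u 1 : T → ℝ)) t - l t))).comp (0 : ℝ) h2
    simpa [smoothStep, Function.comp_def] using h3
  have h4 := hasDerivAt_partialDeriv ((contDiff_smoothStep s l t).differentiable (by norm_num)) u z
  rw [h4.unique h1]
  by_cases h : t = u
  · subst h
    simp
    ring
  · simp [h]

/-- The algebra generated by the smoothed indicators; it is stable under partial derivatives and
consists of bounded functions. -/
noncomputable def smoothStepAlgebra (s : ℝ) (l : T → ℝ) : Subalgebra ℝ ((T → ℝ) → ℝ) :=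
  Algebra.adjoin ℝ (range (smoothStep s l))

/-- Everything rests on `σ' = σ(1 - σ)`: a derivative of a generator is again a polynomial in the
generators. Boundedness of all derivatives of the test functions then comes for free by iteration.
-/
theorem smoothStepAlgebra_spec {s : ℝ} {l : T → ℝ} {h : (T → ℝ) → ℝ}
    (hh : h ∈ smoothStepAlgebra s l) :
    ContDiff ℝ 2 h ∧ (∃ M, ∀ z, ‖h z‖ ≤ M) ∧ ∀ u, partialDeriv u h ∈ smoothStepAlgebra s l := by
  induction hh using Algebra.adjoin_induction with
  | mem x hx =>
    have hx' : x ∈ smoothStepAlgebra s l := Algebra.subset_adjoin hx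
    obtain ⟨t, rfl⟩ := hx
    refine ⟨contDiff_smoothStep s l t, ⟨1, fun z => ?_⟩, fun u => ?_⟩
    · rw [Real.norm_of_nonneg (smoothStep_nonneg s l t z)]
      exact smoothStep_le_one s l t z
    · rw [partialDeriv_smoothStep]
      exact Subalgebra.smul_mem _ (mul_mem hx' (sub_mem (one_mem _) hx')) _
  | algebraMap r =>
    refine ⟨contDiff_const, ⟨‖r‖, fun z => le_rfl⟩, fun u => ?_⟩
    have e : partialDeriv u (algebraMap ℝ ((T → ℝ) → ℝ) r) = 0 :=
      partialDeriv_eq_zero (differentiable_const r) fun _ _ => rfl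
    rw [e]
    exact zero_mem _
  | add x y hx hy ihx ihy =>
    obtain ⟨cx, ⟨Mx, bx⟩, px⟩ := ihx
    obtain ⟨cy, ⟨My, byy⟩, py⟩ := ihy
    refine ⟨cx.add cy, ⟨Mx + My, fun z => (norm_add_le _ _).trans (add_le_add (bx z) (byy z))⟩,
      fun u => ?_⟩
    have e : partialDeriv u (x + y) = partialDeriv u x + partialDeriv u y := by
      ext z
      simp only [partialDeriv]
      rw [fderiv_add ((cx.differentiable (by norm_num)) z) ((cy.differentiable (by norm_num)) z)]
      simp [partialDeriv]
    rw [e]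
    exact add_mem (px u) (py u)
  | mul x y hx hy ihx ihy =>
    obtain ⟨cx, ⟨Mx, bx⟩, px⟩ := ihx
    obtain ⟨cy, ⟨My, byy⟩, py⟩ := ihy
    refine ⟨cx.mul cy, ⟨Mx * My, fun z => ?_⟩, fun u => ?_⟩
    · rw [Pi.mul_apply, norm_mul]
      exact mul_le_mul (bx z) (byy z) (norm_nonneg _) ((norm_nonneg _).trans (bx z))
    · rw [partialDeriv_mul (cx.differentiable (by norm_num)) (cy.differentiable (by norm_num))]
      exact add_mem (mul_mem (px u) hy) (mul_mem hx (py u))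

theorem bddC1_of_mem_smoothStepAlgebra {s : ℝ} {l : T → ℝ} {h : (T → ℝ) → ℝ}
    (hh : h ∈ smoothStepAlgebra s l) : BddC1 h := by
  obtain ⟨hc, hb, hp⟩ := smoothStepAlgebra_spec hh
  refine ⟨hc.of_le (by norm_num), hb, ?_⟩
  choose M hM using fun u => (smoothStepAlgebra_spec (hp u)).2.1
  have hM0 : ∀ u, 0 ≤ M u := fun u => (norm_nonneg _).trans (hM u 0)
  refine ⟨∑ u, M u, fun z => ContinuousLinearMap.opNorm_le_bound _
    (Finset.sum_nonneg fun u _ => hM0 u) fun v => ?_⟩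
  rw [map_eq_sum_single, Finset.sum_mul]
  refine (norm_sum_le _ _).trans (Finset.sum_le_sum fun u _ => ?_)
  rw [norm_mul, mul_comm]
  exact mul_le_mul (hM u z) (norm_le_pi_norm v u) (norm_nonneg _) (hM0 u)

end sigmoid

section gordon

variable {I J : Type*} [Fintype I] [Fintype J]

/-- The smoothed indicator of `∃ j, z (i, j) ≤ l (i, j)`. -/
noncomputable def smoothFail (s : ℝ) (l : I × J → ℝ) (i : I) : (I × J → ℝ) → ℝ :=
  1 - ∏ j, smoothStep s l (i, j)

omit [Fintype I] in
theorem smoothFail_apply (s : ℝ) (l : I × J → ℝ) (i : I) (z : I × J → ℝ) :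
    smoothFail s l i z = 1 - ∏ j, smoothStep s l (i, j) z := by
  simp [smoothFail]

omit [Fintype I] in
theorem smoothFail_nonneg (s : ℝ) (l : I × J → ℝ) (i : I) (z : I × J → ℝ) :
    0 ≤ smoothFail s l i z := by
  rw [smoothFail_apply, sub_nonneg]
  exact Finset.prod_le_one (fun j _ => smoothStep_nonneg _ _ _ _)
    fun j _ => smoothStep_le_one _ _ _ _

theorem contDiff_smoothFail (s : ℝ) (l : I × J → ℝ) (i : I) : ContDiff ℝ 2 (smoothFail s l i) := by
  have : ContDiff ℝ 2 fun z : I × J → ℝ => 1 - ∏ j, smoothStep s l (i, j) z :=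
    contDiff_const.sub (contDiff_prod fun j _ => contDiff_smoothStep s l (i, j))
  convert this using 1
  ext z
  exact smoothFail_apply s l i z

variable [DecidableEq I] [DecidableEq J]

omit [Fintype I] in
theorem smoothFail_add_single (s : ℝ) (l : I × J → ℝ) {i i' : I} (h : i ≠ i') (j : J)
    (z : I × J → ℝ) (c : ℝ) :
    smoothFail s l i (z + c • Pi.single (i', j) 1) = smoothFail s l i z := by
  simp [smoothFail_apply, smoothStep, h]

omit [Fintype I] in
theorem antitone_smoothFail {s : ℝ} (hs : 0 ≤ s) (l : I × J → ℝ) (i : I) (t : I × J)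
    (z : I × J → ℝ) : Antitone fun c : ℝ => smoothFail s l i (z + c • Pi.single t 1) := by
  intro a b hab
  simp only [smoothFail_apply]
  refine sub_le_sub_left (Finset.prod_le_prod (fun j _ => smoothStep_nonneg _ _ _ _)
    fun j _ => ?_) 1
  refine Real.sigmoid_monotone (mul_le_mul_of_nonneg_left (sub_le_sub_right ?_ _) hs)
  simp only [Pi.add_apply, Pi.smul_apply, smul_eq_mul, add_le_add_iff_left]
  refine mul_le_mul_of_nonneg_right hab ?_
  rw [Pi.single_apply]
  split_ifs <;> norm_num

omit [DecidableEq I] [DecidableEq J] in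
theorem prod_smoothFail_mem (s : ℝ) (l : I × J → ℝ) :
    ∏ i, smoothFail s l i ∈ smoothStepAlgebra s l := by
  refine prod_mem fun i _ => sub_mem (one_mem _) (prod_mem fun j _ => ?_)
  exact Algebra.subset_adjoin (mem_range_self _)

/-- For coordinates in different rows the mixed derivative is a product of two row derivatives, both
nonpositive because a row is less likely to fail when an entry grows, and of the nonnegative
remaining rows. Pairs in the same row have no such sign; they drop out of the comparison because the
covariances agree there. -/
theorem partialDeriv_partialDeriv_prod_smoothFail_nonneg {s : ℝ} (hs : 0 ≤ s) (l : I × J → ℝ)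
    {t u : I × J} (htu : t.1 ≠ u.1) (z : I × J → ℝ) :
    0 ≤ partialDeriv u (partialDeriv t (∏ i, smoothFail s l i)) z := by
  obtain ⟨i, j⟩ := t
  obtain ⟨i', j'⟩ := u
  simp only at htu
  set R : (I × J → ℝ) → ℝ := ∏ k ∈ (Finset.univ.erase i).erase i', smoothFail s l k with hR
  have hRz : ∀ z, R z = ∏ k ∈ (Finset.univ.erase i).erase i', smoothFail s l k z := fun z => by
    rw [hR, Finset.prod_apply]
  have e : ∏ i, smoothFail s l i = smoothFail s l i * (smoothFail s l i' * R) := by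
    rw [hR, Finset.mul_prod_erase _ _ (by simp [Ne.symm htu]),
      Finset.mul_prod_erase _ _ (Finset.mem_univ i)]
  have cR : ContDiff ℝ 2 R := by
    have : ContDiff ℝ 2 fun z => ∏ k ∈ (Finset.univ.erase i).erase i', smoothFail s l k z :=
      contDiff_prod fun k _ => contDiff_smoothFail s l k
    convert this using 1
    ext z
    exact hRz z
  rw [e, partialDeriv_partialDeriv_mul (contDiff_smoothFail s l i) (contDiff_smoothFail s l i') cR
    (smoothFail_add_single s l htu j') (smoothFail_add_single s l htu.symm j)]
  · have h1 := partialDeriv_nonpos ((contDiff_smoothFail s l i).differentiable (by norm_num))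
      (antitone_smoothFail hs l i (i, j)) z
    have h2 := partialDeriv_nonpos ((contDiff_smoothFail s l i').differentiable (by norm_num))
      (antitone_smoothFail hs l i' (i', j')) z
    have h3 : 0 ≤ R z := by
      rw [hRz]
      exact Finset.prod_nonneg fun k _ => smoothFail_nonneg _ _ _ _
    simp only [Pi.mul_apply]
    exact mul_nonneg_of_nonpos_of_nonpos h1 (mul_nonpos_of_nonpos_of_nonneg h2 h3)
  · intro z c
    rw [hRz, hRz]
    refine Finset.prod_congr rfl fun k hk => smoothFail_add_single s l ?_ j z c
    simp only [Finset.mem_erase] at hk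
    exact hk.2.1
  · intro z c
    rw [hRz, hRz]
    refine Finset.prod_congr rfl fun k hk => smoothFail_add_single s l ?_ j' z c
    simp only [Finset.mem_erase] at hk
    exact hk.1

variable {Ω Ω' : Type*} [MeasurableSpace Ω] [MeasurableSpace Ω'] {P : Measure Ω}
  {P' : Measure Ω'} [IsProbabilityMeasure P] [IsProbabilityMeasure P']

/-- The product is the smoothed indicator that every row fails. Larger covariances between different
rows make simultaneous failure more likely, so the family with the larger covariances has the larger
integral. -/
theorem integral_prod_smoothFail_le {X : I × J → Ω → ℝ} {Y : I × J → Ω' → ℝ}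
    {C C' : I × J → I × J → ℝ} (hX : GaussianFamily P X C) (hY : GaussianFamily P' Y C')
    (hsame : ∀ t u, t.1 = u.1 → C t u = C' t u) (hle : ∀ t u, C' t u ≤ C t u) {s : ℝ}
    (hs : 0 ≤ s) (l : I × J → ℝ) :
    ∫ ω, ∏ i, smoothFail s l i (fun t => Y t ω) ∂P'
      ≤ ∫ ω, ∏ i, smoothFail s l i (fun t => X t ω) ∂P := by
  have hmem := prod_smoothFail_mem s l
  have key := hX.integral_le_integral hY (bddC1_of_mem_smoothStepAlgebra hmem)
    (fun t => bddC1_of_mem_smoothStepAlgebra ((smoothStepAlgebra_spec hmem).2.2 t)) fun z => ?_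
  · simpa only [Finset.prod_apply] using key
  · refine Finset.sum_nonneg fun t _ => ?_
    rw [map_eq_sum_single]
    refine Finset.sum_nonneg fun u _ => ?_
    by_cases h : t.1 = u.1
    · rw [hsame t u h]
      simp
    · exact mul_nonneg (sub_nonneg.2 (hle t u))
        (partialDeriv_partialDeriv_prod_smoothFail_nonneg hs l h z)

/-- The pointwise limit of `Real.sigmoid (n * x)`. -/
noncomputable def sharpStep (x : ℝ) : ℝ := if 0 < x then 1 else if x = 0 then 2⁻¹ else 0

theorem tendsto_sigmoid_nat_mul (x : ℝ) :
    Tendsto (fun n : ℕ => Real.sigmoid (n * x)) atTop (𝓝 (sharpStep x)) := by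
  unfold sharpStep
  split_ifs with h1 h2
  · exact Real.tendsto_sigmoid_atTop.comp (tendsto_natCast_atTop_atTop.atTop_mul_const h1)
  · subst h2
    simp
  · have h3 : x < 0 := lt_of_le_of_ne (not_lt.1 h1) h2
    exact Real.tendsto_sigmoid_atBot.comp (tendsto_natCast_atTop_atTop.atTop_mul_const_of_neg h3)

theorem sharpStep_nonneg (x : ℝ) : 0 ≤ sharpStep x := by
  unfold sharpStep
  split_ifs <;> norm_num

theorem sharpStep_le_one (x : ℝ) : sharpStep x ≤ 1 := by
  unfold sharpStep
  split_ifs <;> norm_num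

theorem measurable_sharpStep : Measurable sharpStep :=
  Measurable.ite measurableSet_Ioi measurable_const
    (Measurable.ite (measurableSet_singleton 0) measurable_const measurable_const)

theorem measureReal_le_one_sub_integral {Ω : Type*} [MeasurableSpace Ω] {P : Measure Ω}
    [IsProbabilityMeasure P] {S : Set Ω} (hS : MeasurableSet S) {g : Ω → ℝ} (hg : Measurable g)
    (h0 : ∀ ω, 0 ≤ g ω) (h1 : ∀ ω, g ω ≤ 1) (hgS : ∀ ω ∈ S, g ω = 0) :
    P.real S ≤ 1 - ∫ ω, g ω ∂P := by
  have hi : Integrable g P := GaussianFamily.integrable_bdd_comp hg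
    ⟨1, fun ω => by rw [Real.norm_of_nonneg (h0 ω)]; exact h1 ω⟩
  have e : 1 - ∫ ω, g ω ∂P = ∫ ω, (1 - g ω) ∂P := by
    rw [integral_sub (integrable_const _) hi]
    simp
  rw [e, ← integral_indicator_one hS]
  refine integral_mono ((integrable_const _).indicator hS) ((integrable_const _).sub hi) fun ω => ?_
  by_cases h : ω ∈ S
  · simp [h, hgS ω h]
  · simp [h, h1 ω]

theorem one_sub_integral_le_measureReal {Ω : Type*} [MeasurableSpace Ω] {P : Measure Ω}
    [IsProbabilityMeasure P] {S : Set Ω} (hS : MeasurableSet S) {g : Ω → ℝ} (hg : Measurable g)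
    (h0 : ∀ ω, 0 ≤ g ω) (h1 : ∀ ω, g ω ≤ 1) (hgS : ∀ ω ∉ S, g ω = 1) :
    1 - ∫ ω, g ω ∂P ≤ P.real S := by
  have hi : Integrable g P := GaussianFamily.integrable_bdd_comp hg
    ⟨1, fun ω => by rw [Real.norm_of_nonneg (h0 ω)]; exact h1 ω⟩
  have e : 1 - ∫ ω, g ω ∂P = ∫ ω, (1 - g ω) ∂P := by
    rw [integral_sub (integrable_const _) hi]
    simp
  rw [e, ← integral_indicator_one hS]
  refine integral_mono ((integrable_const _).sub hi) ((integrable_const _).indicator hS) fun ω => ?_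
  by_cases h : ω ∈ S
  · simp [h, h0 ω]
  · simp [h, hgS ω h]

/-- The pointwise limit of `∏ i, smoothFail n l i` as `n → ∞`. -/
noncomputable def sharpMiss (l z : I × J → ℝ) : ℝ :=
  ∏ i, (1 - ∏ j, sharpStep (z (i, j) - l (i, j)))

omit [Fintype I] [DecidableEq I] [DecidableEq J] in
theorem one_sub_prod_sharpStep_nonneg (l z : I × J → ℝ) (i : I) :
    0 ≤ 1 - ∏ j, sharpStep (z (i, j) - l (i, j)) :=
  sub_nonneg.2 (Finset.prod_le_one (fun _ _ => sharpStep_nonneg _) fun _ _ => sharpStep_le_one _)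

omit [DecidableEq I] [DecidableEq J]

theorem sharpMiss_nonneg (l z : I × J → ℝ) : 0 ≤ sharpMiss l z :=
  Finset.prod_nonneg fun i _ => one_sub_prod_sharpStep_nonneg l z i

theorem sharpMiss_le_one (l z : I × J → ℝ) : sharpMiss l z ≤ 1 :=
  Finset.prod_le_one (fun i _ => one_sub_prod_sharpStep_nonneg l z i) fun _ _ =>
    sub_le_self _ (Finset.prod_nonneg fun _ _ => sharpStep_nonneg _)

theorem measurable_sharpMiss (l : I × J → ℝ) : Measurable (sharpMiss l) := by
  refine Finset.measurable_prod _ fun i _ => measurable_const.sub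
    (Finset.measurable_prod _ fun j _ => measurable_sharpStep.comp ?_)
  fun_prop

theorem tendsto_prod_smoothFail (l z : I × J → ℝ) :
    Tendsto (fun n : ℕ => ∏ i, smoothFail n l i z) atTop (𝓝 (sharpMiss l z)) := by
  refine tendsto_finsetProd _ fun i _ => ?_
  simp only [smoothFail_apply]
  exact tendsto_const_nhds.sub (tendsto_finsetProd _ fun j _ => tendsto_sigmoid_nat_mul _)

theorem norm_prod_smoothFail_le_one (s : ℝ) (l z : I × J → ℝ) :
    ‖∏ i, smoothFail s l i z‖ ≤ 1 := by
  rw [Real.norm_of_nonneg (Finset.prod_nonneg fun i _ => smoothFail_nonneg _ _ _ _)]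
  refine Finset.prod_le_one (fun i _ => smoothFail_nonneg _ _ _ _) fun i _ => ?_
  rw [smoothFail_apply]
  exact sub_le_self _ (Finset.prod_nonneg fun j _ => smoothStep_nonneg _ _ _ _)

theorem tendsto_integral_prod_smoothFail {X : I × J → Ω → ℝ} (hX : ∀ t, Measurable (X t))
    (l : I × J → ℝ) :
    Tendsto (fun n : ℕ => ∫ ω, ∏ i, smoothFail n l i (fun t => X t ω) ∂P) atTop
      (𝓝 (∫ ω, sharpMiss l (fun t => X t ω) ∂P)) := by
  have hm : ∀ n : ℕ, Measurable fun z : I × J → ℝ => ∏ i, smoothFail n l i z := fun n =>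
    Finset.measurable_prod _ fun i _ => (contDiff_smoothFail _ l i).continuous.measurable
  exact tendsto_integral_of_dominated_convergence (fun _ => 1)
    (fun n => ((hm n).comp (measurable_pi_lambda _ hX)).aestronglyMeasurable) (integrable_const _)
    (fun n => ae_of_all _ fun ω => norm_prod_smoothFail_le_one _ _ _)
    (ae_of_all _ fun ω => tendsto_prod_smoothFail _ _)

theorem measureReal_le_one_sub_integral_sharpMiss {X : I × J → Ω → ℝ}
    (hX : ∀ t, Measurable (X t)) (l : I × J → ℝ) :
    P.real {ω | ∃ i, ∀ j, l (i, j) < X (i, j) ω}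
      ≤ 1 - ∫ ω, sharpMiss l (fun t => X t ω) ∂P := by
  have mX : MeasurableSet {ω | ∃ i, ∀ j, l (i, j) < X (i, j) ω} := by
    simp only [ofPred_exists, ofPred_forall]
    exact MeasurableSet.iUnion fun i => MeasurableSet.iInter fun j =>
      measurableSet_lt measurable_const (hX _)
  refine measureReal_le_one_sub_integral mX (g := fun ω => sharpMiss l fun t => X t ω)
    ((measurable_sharpMiss l).comp (measurable_pi_lambda _ hX)) (fun ω => sharpMiss_nonneg _ _)
    (fun ω => sharpMiss_le_one _ _) fun ω h => ?_
  obtain ⟨i, hi⟩ := h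
  refine Finset.prod_eq_zero (Finset.mem_univ i) ?_
  rw [Finset.prod_eq_one, sub_self]
  intro j _
  simp [sharpStep, hi j]

theorem one_sub_integral_sharpMiss_le_measureReal {X : I × J → Ω → ℝ}
    (hX : ∀ t, Measurable (X t)) (l : I × J → ℝ) :
    1 - ∫ ω, sharpMiss l (fun t => X t ω) ∂P
      ≤ P.real {ω | ∃ i, ∀ j, l (i, j) ≤ X (i, j) ω} := by
  have mX : MeasurableSet {ω | ∃ i, ∀ j, l (i, j) ≤ X (i, j) ω} := by
    simp only [ofPred_exists, ofPred_forall]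
    exact MeasurableSet.iUnion fun i => MeasurableSet.iInter fun j =>
      measurableSet_le measurable_const (hX _)
  refine one_sub_integral_le_measureReal mX (g := fun ω => sharpMiss l fun t => X t ω)
    ((measurable_sharpMiss l).comp (measurable_pi_lambda _ hX)) (fun ω => sharpMiss_nonneg _ _)
    (fun ω => sharpMiss_le_one _ _) fun ω h => ?_
  refine Finset.prod_eq_one fun i _ => ?_
  simp only [mem_ofPred_eq, not_exists, not_forall, not_le] at h
  obtain ⟨j, hj⟩ := h i
  rw [Finset.prod_eq_zero (Finset.mem_univ j), sub_zero]
  simp only [sharpStep]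
  rw [if_neg (by linarith), if_neg (by linarith)]

/-- Gordon's comparison inequality for finite index sets. -/
theorem GaussianFamily.gordon_finite {X : I × J → Ω → ℝ} {Y : I × J → Ω' → ℝ}
    {C C' : I × J → I × J → ℝ} (hX : GaussianFamily P X C) (hY : GaussianFamily P' Y C')
    (hsame : ∀ t u, t.1 = u.1 → C t u = C' t u) (hle : ∀ t u, C' t u ≤ C t u)
    (l : I × J → ℝ) :
    P {ω | ∃ i, ∀ j, l (i, j) < X (i, j) ω} ≤ P' {ω | ∃ i, ∀ j, l (i, j) ≤ Y (i, j) ω} := by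
  classical
  -- As the steepness tends to infinity the test function tends to `sharpMiss`, which takes
  -- intermediate values only at ties `z = l`. Bounding it on either side of the ties gives `<` for
  -- `X` and `≤` for `Y`, so the laws need not be atomless.
  have hg := le_of_tendsto_of_tendsto' (tendsto_integral_prod_smoothFail hY.measurable l)
    (tendsto_integral_prod_smoothFail hX.measurable l) fun n =>
      integral_prod_smoothFail_le hX hY hsame hle n.cast_nonneg l
  have bX := measureReal_le_one_sub_integral_sharpMiss (P := P) hX.measurable l
  have bY := one_sub_integral_sharpMiss_le_measureReal (P := P') hY.measurable l
  have hreal : P.real {ω | ∃ i, ∀ j, l (i, j) < X (i, j) ω}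
      ≤ P'.real {ω | ∃ i, ∀ j, l (i, j) ≤ Y (i, j) ω} := by linarith
  exact (ENNReal.toReal_le_toReal (measure_ne_top _ _) (measure_ne_top _ _)).1 hreal

end gordon

/-- Gordon's comparison inequality for countable index sets. -/
theorem GaussianFamily.gordon {Ω Ω' I J : Type*} [MeasurableSpace Ω] [MeasurableSpace Ω']
    [Countable I] [Countable J] {P : Measure Ω} {P' : Measure Ω'} [IsProbabilityMeasure P]
    [IsProbabilityMeasure P'] {X : I × J → Ω → ℝ} {Y : I × J → Ω' → ℝ}
    {C C' : I × J → I × J → ℝ}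
    (hX : ∀ (A : Finset I) (B : Finset J), GaussianFamily P
      (fun t : A × B => X (t.1, t.2)) fun t u => C (t.1, t.2) (u.1, u.2))
    (hY : ∀ (A : Finset I) (B : Finset J), GaussianFamily P'
      (fun t : A × B => Y (t.1, t.2)) fun t u => C' (t.1, t.2) (u.1, u.2))
    (hsame : ∀ t u, t.1 = u.1 → C t u = C' t u) (hle : ∀ t u, C' t u ≤ C t u)
    (l : I × J → ℝ) :
    P {ω | ∃ i, ∀ j, l (i, j) < X (i, j) ω} ≤ P' {ω | ∃ i, ∀ j, l (i, j) ≤ Y (i, j) ω} := by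
  classical
  have hYm : ∀ i j, Measurable (Y (i, j)) := fun i j =>
    (hY {i} {j}).measurable (⟨i, Finset.mem_singleton_self i⟩, ⟨j, Finset.mem_singleton_self j⟩)
  have e : {ω | ∃ i, ∀ j, l (i, j) < X (i, j) ω}
      = ⋃ A : Finset I, {ω | ∃ i ∈ A, ∀ j, l (i, j) < X (i, j) ω} := by
    ext ω
    simp only [mem_ofPred_eq, mem_iUnion]
    exact ⟨fun ⟨i, hi⟩ => ⟨{i}, i, Finset.mem_singleton_self i, hi⟩,
      fun ⟨_, i, _, hi⟩ => ⟨i, hi⟩⟩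
  -- The existential quantifier is exhausted from below by finite sets of rows, the universal one
  -- from above by finite sets of columns; continuity of the measure handles both limits.
  have hmono : Monotone fun A : Finset I => {ω | ∃ i ∈ A, ∀ j, l (i, j) < X (i, j) ω} :=
    fun A A' h ω ⟨i, hi, hj⟩ => ⟨i, h hi, hj⟩
  rw [e, hmono.measure_iUnion]
  refine iSup_le fun A => ?_
  have hfin : ∀ B : Finset J, P {ω | ∃ i ∈ A, ∀ j, l (i, j) < X (i, j) ω}
      ≤ P' {ω | ∃ i ∈ A, ∀ j ∈ B, l (i, j) ≤ Y (i, j) ω} := fun B => by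
    have h := (hX A B).gordon_finite (hY A B) (fun t u htu => hsame _ _ (by simp [htu]))
      (fun t u => hle _ _) fun t => l (t.1, t.2)
    refine (measure_mono ?_).trans (h.trans (measure_mono ?_))
    · rintro ω ⟨i, hi, hj⟩
      exact ⟨⟨i, hi⟩, fun j => hj j⟩
    · rintro ω ⟨i, hj⟩
      exact ⟨i, i.2, fun j hjB => hj ⟨j, hjB⟩⟩
  have hanti : Antitone fun B : Finset J => {ω | ∃ i ∈ A, ∀ j ∈ B, l (i, j) ≤ Y (i, j) ω} :=
    fun B B' h ω ⟨i, hi, hj⟩ => ⟨i, hi, fun j hjB => hj j (h hjB)⟩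
  have hms : ∀ B : Finset J, MeasurableSet {ω | ∃ i ∈ A, ∀ j ∈ B, l (i, j) ≤ Y (i, j) ω} :=
    fun B => by
      have : {ω | ∃ i ∈ A, ∀ j ∈ B, l (i, j) ≤ Y (i, j) ω}
          = ⋃ i ∈ A, ⋂ j ∈ B, {ω | l (i, j) ≤ Y (i, j) ω} := by
        ext ω
        simp
      rw [this]
      exact Finset.measurableSet_biUnion _ fun i _ => Finset.measurableSet_biInter _ fun j _ =>
        measurableSet_le measurable_const (hYm i j)
  refine (le_iInf hfin).trans ?_
  rw [← hanti.measure_iInter (fun B => (hms B).nullMeasurableSet) ⟨∅, measure_ne_top _ _⟩]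
  refine measure_mono fun ω hω => ?_
  simp only [mem_iInter, mem_ofPred_eq] at hω
  by_contra hcon
  simp only [mem_ofPred_eq, not_exists, not_forall] at hcon
  -- If every row failed, one failing column for each of the finitely many rows in `A` would make a
  -- finite set of columns contradicting `hω`.
  choose j hj using hcon
  obtain ⟨i, hi, hiB⟩ := hω (A.image j)
  exact hj i (hiB _ (Finset.mem_image_of_mem j hi))

/-! ### Exponential moments and tails of Gaussian vectors -/

/-- The law of a vector of `n` independent standard Gaussians. -/
noncomputable abbrev stdGaussianVec (n : ℕ) : Measure (Fin n → ℝ) :=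
  Measure.pi fun _ => gaussianReal 0 1

theorem inv_sqrt_one_sub_le_exp {t : ℝ} (h0 : 0 ≤ t) (h1 : t ≤ 1 / 4) :
    √((1 - 2 * t)⁻¹) ≤ Real.exp (t + 2 * t ^ 2) := by
  have hpos : 0 < 1 - 2 * t := by linarith
  have h2 : Real.exp (-(2 * t + 4 * t ^ 2)) ≤ 1 - 2 * t := by
    set x := 2 * t + 4 * t ^ 2 with hx
    have hx0 : 0 ≤ x := by positivity
    have hq := Real.quadratic_le_exp_of_nonneg hx0
    rw [Real.exp_neg]
    refine inv_le_of_inv_le₀ hpos ?_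
    refine le_trans ?_ hq
    rw [inv_le_iff_one_le_mul₀ hpos, hx]
    nlinarith [mul_nonneg (pow_nonneg h0 2) (by linarith : (0 : ℝ) ≤ 1 - 4 * t),
      mul_nonneg (pow_nonneg h0 3) (by linarith : (0 : ℝ) ≤ 1 - 4 * t),
      mul_nonneg (pow_nonneg h0 4) (by linarith : (0 : ℝ) ≤ 1 - 4 * t), pow_nonneg h0 2,
      pow_nonneg h0 3, pow_nonneg h0 4]
  rw [Real.sqrt_le_left (Real.exp_pos _).le, ← Real.exp_nat_mul]
  calc (1 - 2 * t)⁻¹ ≤ (Real.exp (-(2 * t + 4 * t ^ 2)))⁻¹ := inv_anti₀ (Real.exp_pos _) h2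
    _ = Real.exp (2 * t + 4 * t ^ 2) := by rw [Real.exp_neg, inv_inv]
    _ = _ := by
      congr 1
      push_cast
      ring

theorem integrable_exp_sq_gaussianReal {t : ℝ} (h1 : t ≤ 1 / 4) :
    Integrable (fun x => Real.exp (t * x ^ 2)) (gaussianReal 0 1) := by
  rw [gaussianReal_of_var_ne_zero 0 one_ne_zero,
    integrable_withDensity_iff_integrable_smul' (measurable_gaussianPDF 0 1)
      (ae_of_all _ fun x => gaussianPDF_lt_top)]
  have h := (integrable_exp_neg_mul_sq (b := 1 / 2 - t) (by linarith)).const_mul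
    ((√(2 * Real.pi * (1 : ℝ≥0)))⁻¹)
  refine h.congr (ae_of_all _ fun x => ?_)
  simp only [toReal_gaussianPDF, gaussianPDFReal, smul_eq_mul]
  rw [mul_assoc _ (Real.exp _) (Real.exp _), ← Real.exp_add]
  congr 2
  simp
  ring

theorem integral_exp_sq_gaussianReal_le {t : ℝ} (h0 : 0 ≤ t) (h1 : t ≤ 1 / 4) :
    ∫ x, Real.exp (t * x ^ 2) ∂gaussianReal 0 1 ≤ Real.exp (t + 2 * t ^ 2) := by
  rw [integral_gaussianReal_eq_integral_smul one_ne_zero]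
  have e : ∀ x, gaussianPDFReal 0 1 x • Real.exp (t * x ^ 2)
      = (√(2 * Real.pi))⁻¹ * Real.exp (-(1 / 2 - t) * x ^ 2) := fun x => by
    simp only [gaussianPDFReal, smul_eq_mul]
    rw [mul_assoc, ← Real.exp_add]
    simp
    ring_nf
    simp
  simp_rw [e]
  rw [integral_const_mul, integral_gaussian]
  refine le_trans (le_of_eq ?_) (inv_sqrt_one_sub_le_exp h0 h1)
  rw [← Real.sqrt_inv, ← Real.sqrt_mul (by positivity)]
  congr 1
  have : 1 - 2 * t ≠ 0 := by linarith
  have h2 : 1 / 2 - t ≠ 0 := by linarith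
  field_simp

theorem exp_mul_sum {ι : Type*} (s : Finset ι) (t : ℝ) (f : ι → ℝ) :
    Real.exp (t * ∑ i ∈ s, f i) = ∏ i ∈ s, Real.exp (t * f i) := by
  rw [Finset.mul_sum, Real.exp_sum]

theorem integrable_exp_sum_sq (n : ℕ) {t : ℝ} (h1 : t ≤ 1 / 4) :
    Integrable (fun g => Real.exp (t * ∑ i, g i ^ 2)) (stdGaussianVec n) := by
  simp_rw [exp_mul_sum]
  exact Integrable.fintype_prod fun i => integrable_exp_sq_gaussianReal h1

theorem integral_exp_sum_sq_le (n : ℕ) {t : ℝ} (h0 : 0 ≤ t) (h1 : t ≤ 1 / 4) :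
    ∫ g, Real.exp (t * ∑ i, g i ^ 2) ∂stdGaussianVec n ≤ Real.exp (n * (t + 2 * t ^ 2)) := by
  simp_rw [exp_mul_sum]
  rw [integral_fintype_prod_eq_prod (fun (_ : Fin n) x => Real.exp (t * x ^ 2)),
    Real.exp_nat_mul, Finset.prod_const, Finset.card_univ, Fintype.card_fin]
  exact pow_le_pow_left₀ (integral_nonneg fun x => (Real.exp_pos _).le)
    (integral_exp_sq_gaussianReal_le h0 h1) n

theorem measure_le_of_integral_exp_le {Ω : Type*} [MeasurableSpace Ω] {P : Measure Ω}
    [IsProbabilityMeasure P] {X : Ω → ℝ} {t a b : ℝ} (ht : 0 ≤ t)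
    (hi : Integrable (fun ω => Real.exp (t * X ω)) P)
    (hb : ∫ ω, Real.exp (t * X ω) ∂P ≤ Real.exp b) :
    P {ω | a ≤ X ω} ≤ ENNReal.ofReal (Real.exp (b - t * a)) := by
  have h := measure_ge_le_exp_mul_mgf a ht hi
  rw [← ofReal_measureReal]
  refine ENNReal.ofReal_le_ofReal (h.trans ?_)
  rw [sub_eq_neg_add, Real.exp_add, ← neg_mul]
  exact mul_le_mul_of_nonneg_left hb (Real.exp_pos _).le

/-- Upper tail of the squared norm of a standard Gaussian vector. -/
theorem stdGaussianVec_sum_sq_tail (n : ℕ) {δ : ℝ} (h0 : 0 ≤ δ) (h1 : δ ≤ 1) :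
    stdGaussianVec n {g | n * (1 + δ) ≤ ∑ i, g i ^ 2}
      ≤ ENNReal.ofReal (Real.exp (-(n * δ ^ 2 / 8))) := by
  -- With Chernoff parameter `t = δ/4` the exponent `n(t + 2t²) - tn(1 + δ)` equals `-nδ²/8`, and `δ
  -- ≤ 1` keeps `t ≤ 1/4`.
  have h := measure_le_of_integral_exp_le (a := n * (1 + δ)) (by positivity : (0 : ℝ) ≤ δ / 4)
    (integrable_exp_sum_sq n (by linarith)) (integral_exp_sum_sq_le n (by positivity) (by linarith))
  refine h.trans (le_of_eq ?_)
  congr 2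
  ring

theorem integrable_exp_mul_gaussianReal_zero (v : ℝ≥0) (a : ℝ) :
    Integrable (fun x => Real.exp (a * x)) (gaussianReal 0 v) :=
  integrable_exp_mul_gaussianReal a

theorem integral_exp_mul_gaussianReal_zero (v : ℝ≥0) (a : ℝ) :
    ∫ x, Real.exp (a * x) ∂gaussianReal 0 v = Real.exp (v * a ^ 2 / 2) := by
  have h := congrFun (mgf_fun_id_gaussianReal (μ := 0) (v := v)) a
  simpa [mgf] using h

theorem integrable_exp_sum_gaussianVec (n : ℕ) (v : ℝ≥0) (a : Fin n → ℝ) :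
    Integrable (fun g => Real.exp (∑ i, a i * g i)) (Measure.pi fun _ => gaussianReal 0 v) := by
  simp_rw [Real.exp_sum]
  exact Integrable.fintype_prod fun i => integrable_exp_mul_gaussianReal_zero v (a i)

theorem integral_exp_sum_gaussianVec (n : ℕ) (v : ℝ≥0) (a : Fin n → ℝ) :
    ∫ g, Real.exp (∑ i, a i * g i) ∂(Measure.pi fun _ => gaussianReal 0 v)
      = Real.exp (v * (∑ i, a i ^ 2) / 2) := by
  simp_rw [Real.exp_sum]
  rw [integral_fintype_prod_eq_prod (fun i x => Real.exp (a i * x))]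
  simp_rw [integral_exp_mul_gaussianReal_zero]
  rw [← Real.exp_sum, Finset.mul_sum, Finset.sum_div]

theorem integrable_exp_sum_gaussianMatrixLaw (n m : ℕ) (v : ℝ≥0) (a : Fin n → Fin m → ℝ) :
    Integrable (fun G => Real.exp (∑ i, ∑ j, a i j * G i j)) (gaussianMatrixLaw n m v) := by
  have e : ∀ G : Fin n → Fin m → ℝ, Real.exp (∑ i, ∑ j, a i j * G i j)
      = ∏ i, Real.exp (∑ j, a i j * G i j) := fun G => Real.exp_sum _ _
  simp_rw [e]
  exact Integrable.fintype_prod (f := fun i (g : Fin m → ℝ) => Real.exp (∑ j, a i j * g j))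
    (μ := fun _ => Measure.pi fun _ => gaussianReal 0 v)
    fun i => integrable_exp_sum_gaussianVec m v (a i)

theorem integral_exp_sum_gaussianMatrixLaw (n m : ℕ) (v : ℝ≥0) (a : Fin n → Fin m → ℝ) :
    ∫ G, Real.exp (∑ i, ∑ j, a i j * G i j) ∂gaussianMatrixLaw n m v
      = Real.exp (v * (∑ i, ∑ j, a i j ^ 2) / 2) := by
  have e : ∀ G : Fin n → Fin m → ℝ, Real.exp (∑ i, ∑ j, a i j * G i j)
      = ∏ i, Real.exp (∑ j, a i j * G i j) := fun G => Real.exp_sum _ _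
  simp_rw [e]
  rw [gaussianMatrixLaw, integral_fintype_prod_eq_prod
    (fun i (g : Fin m → ℝ) => Real.exp (∑ j, a i j * g j))]
  simp_rw [integral_exp_sum_gaussianVec]
  rw [← Real.exp_sum, Finset.mul_sum, Finset.sum_div]

/-- Upper tail of a linear functional of a standard Gaussian vector. -/
theorem stdGaussianVec_inner_tail (n : ℕ) (a : Fin n → ℝ) {r A : ℝ} (hr : 0 ≤ r) (hA : 0 < A)
    (ha : ∑ i, a i ^ 2 ≤ A) :
    stdGaussianVec n {g | r ≤ ∑ i, a i * g i} ≤ ENNReal.ofReal (Real.exp (-(r ^ 2 / (2 * A)))) := by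
  have e : ∀ (g : Fin n → ℝ), (r / A) * ∑ i, a i * g i = ∑ i, (r / A * a i) * g i := fun g => by
    rw [Finset.mul_sum]
    exact Finset.sum_congr rfl fun i _ => by ring
  have h := measure_le_of_integral_exp_le (P := stdGaussianVec n) (X := fun g => ∑ i, a i * g i)
    (t := r / A) (a := r) (b := r ^ 2 / (2 * A)) (by positivity)
    (by simp_rw [e]; exact integrable_exp_sum_gaussianVec n 1 _) (by
      simp_rw [e]
      rw [integral_exp_sum_gaussianVec]
      refine Real.exp_le_exp.2 ?_
      simp_rw [mul_pow]
      rw [← Finset.mul_sum]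
      calc ((1 : ℝ≥0) : ℝ) * ((r / A) ^ 2 * ∑ i, a i ^ 2) / 2
          ≤ ((1 : ℝ≥0) : ℝ) * ((r / A) ^ 2 * A) / 2 := by gcongr
        _ = r ^ 2 / (2 * A) := by
          push_cast
          field_simp)
  refine h.trans (le_of_eq ?_)
  congr 2
  field_simp
  ring

theorem prod_measure_le_of_forall {Ω Ω' : Type*} [MeasurableSpace Ω] [MeasurableSpace Ω']
    {P : Measure Ω} {P' : Measure Ω'} [IsProbabilityMeasure P] [IsProbabilityMeasure P']
    {S : Set (Ω × Ω')} (hS : MeasurableSet S) {c : ℝ≥0∞}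
    (h : ∀ ω, P' {ω' | (ω, ω') ∈ S} ≤ c) : P.prod P' S ≤ c := by
  rw [Measure.prod_apply hS]
  refine (lintegral_mono h).trans ?_
  simp

theorem prod_measure_fst_preimage {Ω Ω' : Type*} [MeasurableSpace Ω] [MeasurableSpace Ω']
    (P : Measure Ω) (P' : Measure Ω') [IsProbabilityMeasure P] [IsProbabilityMeasure P']
    (S : Set Ω) : P.prod P' {ω | ω.1 ∈ S} = P S := by
  have : {ω : Ω × Ω' | ω.1 ∈ S} = S ×ˢ univ := by ext; simp
  rw [this, Measure.prod_prod, measure_univ, mul_one]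

theorem prod_measure_snd_preimage {Ω Ω' : Type*} [MeasurableSpace Ω] [MeasurableSpace Ω']
    (P : Measure Ω) (P' : Measure Ω') [IsProbabilityMeasure P] [IsProbabilityMeasure P']
    (S : Set Ω') : P.prod P' {ω | ω.2 ∈ S} = P' S := by
  have : {ω : Ω × Ω' | ω.2 ∈ S} = univ ×ˢ S := by ext; simp
  rw [this, Measure.prod_prod, measure_univ, one_mul]

/-- Tail of the inner product of two independent standard Gaussian vectors. -/
theorem stdGaussianVec_prod_inner_tail (n : ℕ) {δ : ℝ} (h0 : 0 ≤ δ) (h1 : δ ≤ 1) :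
    ((stdGaussianVec n).prod (stdGaussianVec n)) {p | n * δ ≤ |∑ i, p.1 i * p.2 i|}
      ≤ 3 * ENNReal.ofReal (Real.exp (-(n * δ ^ 2 / 8))) := by
  rcases Nat.eq_zero_or_pos n with rfl | hn
  · refine prob_le_one.trans ?_
    simp
  have hn' : (0 : ℝ) < n := by exact_mod_cast hn
  set c := ENNReal.ofReal (Real.exp (-(n * δ ^ 2 / 8))) with hc
  -- Unless the first vector has squared norm at least `2n`, it can be frozen: the inner product is
  -- then a Gaussian of variance below `2n`. The two signs of the absolute value are treated
  -- separately, hence three terms.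
  have hsub : {p : (Fin n → ℝ) × (Fin n → ℝ) | n * δ ≤ |∑ i, p.1 i * p.2 i|}
      ⊆ {p | p.1 ∈ {g | n * (1 + 1 : ℝ) ≤ ∑ i, g i ^ 2}} ∪
        ({p | ∑ i, p.1 i ^ 2 < n * (1 + 1 : ℝ) ∧ n * δ ≤ ∑ i, p.1 i * p.2 i} ∪
         {p | ∑ i, p.1 i ^ 2 < n * (1 + 1 : ℝ) ∧ n * δ ≤ ∑ i, (-p.1 i) * p.2 i}) := by
    intro p hp
    simp only [mem_union, mem_ofPred_eq] at hp ⊢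
    rcases le_or_gt (n * (1 + 1 : ℝ)) (∑ i, p.1 i ^ 2) with h | h
    · exact Or.inl h
    · rcases le_abs.1 hp with h2 | h2
      · exact Or.inr (Or.inl ⟨h, h2⟩)
      · refine Or.inr (Or.inr ⟨h, ?_⟩)
        simpa using h2
  have hsec : ∀ s : ℝ, s ^ 2 = 1 → ((stdGaussianVec n).prod (stdGaussianVec n))
      {p | ∑ i, p.1 i ^ 2 < n * (1 + 1 : ℝ) ∧ n * δ ≤ ∑ i, (s * p.1 i) * p.2 i} ≤ c := by
    intro s hs
    refine prod_measure_le_of_forall ?_ fun g => ?_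
    · have m1 : MeasurableSet {p : (Fin n → ℝ) × (Fin n → ℝ) | ∑ i, p.1 i ^ 2 < n * (1 + 1 : ℝ)} :=
        measurableSet_lt (by fun_prop) measurable_const
      have m2 : MeasurableSet
          {p : (Fin n → ℝ) × (Fin n → ℝ) | n * δ ≤ ∑ i, (s * p.1 i) * p.2 i} :=
        measurableSet_le measurable_const (by fun_prop)
      exact m1.inter m2
    · by_cases hg : ∑ i, g i ^ 2 < n * (1 + 1 : ℝ)
      · refine (measure_mono fun h hh => hh.2).trans ((stdGaussianVec_inner_tail n
          (fun i => s * g i) (r := n * δ) (A := n * (1 + 1)) (by positivity) (by positivity)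
          ?_).trans ?_)
        · simp_rw [mul_pow, hs, one_mul]
          exact hg.le
        · refine ENNReal.ofReal_le_ofReal (Real.exp_le_exp.2 (neg_le_neg ?_))
          rw [div_le_div_iff₀ (by positivity) (by positivity)]
          nlinarith [mul_nonneg (mul_nonneg hn'.le hn'.le) (sq_nonneg δ)]
      · simp [hg]
  refine (measure_mono hsub).trans ((measure_union_le _ _).trans ?_)
  have e3 : 3 * c = c + (c + c) := by ring
  rw [e3]
  refine add_le_add ?_ ((measure_union_le _ _).trans (add_le_add ?_ ?_))
  · rw [prod_measure_fst_preimage]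
    refine (stdGaussianVec_sum_sq_tail n zero_le_one le_rfl).trans
      (ENNReal.ofReal_le_ofReal (Real.exp_le_exp.2 (neg_le_neg ?_)))
    gcongr
  · simpa using hsec 1 (by norm_num)
  · simpa using hsec (-1) (by norm_num)

/-- Linearizing the square by `e^{ts²} = E e^{√(2t) s z}` makes the exponent linear in `G`, which is
then integrated out first. This gives the exponential moment of `|Gᵀa|²` without identifying its
law; Tonelli needs no integrability beforehand. -/
theorem lintegral_exp_sum_sq_transpose (n m : ℕ) (v : ℝ≥0) (a : Fin n → ℝ) {t : ℝ} (ht : 0 ≤ t) :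
    ∫⁻ G, ENNReal.ofReal (Real.exp (t * ∑ j, (∑ i, G i j * a i) ^ 2)) ∂gaussianMatrixLaw n m v
      = ∫⁻ z, ENNReal.ofReal (Real.exp (t * v * (∑ i, a i ^ 2) * ∑ j, z j ^ 2))
          ∂stdGaussianVec m := by
  have e1 : ∀ G : Fin n → Fin m → ℝ,
      ENNReal.ofReal (Real.exp (t * ∑ j, (∑ i, G i j * a i) ^ 2))
        = ∫⁻ z, ENNReal.ofReal (Real.exp (∑ j, (√(2 * t) * ∑ i, G i j * a i) * z j))
          ∂stdGaussianVec m := fun G => by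
    rw [← ofReal_integral_eq_lintegral_ofReal (integrable_exp_sum_gaussianVec m 1 _)
      (ae_of_all _ fun z => (Real.exp_pos _).le), integral_exp_sum_gaussianVec]
    simp_rw [mul_pow, Real.sq_sqrt (by positivity : 0 ≤ 2 * t)]
    rw [← Finset.mul_sum]
    congr 2
    push_cast
    ring
  have e2 : ∀ (G : Fin n → Fin m → ℝ) (z : Fin m → ℝ),
      ∑ j, (√(2 * t) * ∑ i, G i j * a i) * z j = ∑ i, ∑ j, (√(2 * t) * a i * z j) * G i j :=
    fun G z => by
      rw [Finset.sum_comm]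
      refine Finset.sum_congr rfl fun j _ => ?_
      rw [Finset.mul_sum, Finset.sum_mul]
      exact Finset.sum_congr rfl fun i _ => by ring
  simp_rw [e1, e2]
  rw [lintegral_lintegral_swap]
  · refine lintegral_congr fun z => ?_
    rw [← ofReal_integral_eq_lintegral_ofReal (integrable_exp_sum_gaussianMatrixLaw n m v _)
      (ae_of_all _ fun z => (Real.exp_pos _).le), integral_exp_sum_gaussianMatrixLaw]
    simp_rw [mul_pow, Real.sq_sqrt (by positivity : 0 ≤ 2 * t)]
    congr 2
    simp_rw [← Finset.mul_sum, ← Finset.sum_mul]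
    rw [← Finset.mul_sum]
    ring
  · refine Measurable.aemeasurable ?_
    fun_prop

/-- Upper tail of `|Gᵀ a|²` for a Gaussian matrix `G` with entries of variance `1 / m`. -/
theorem gaussianMatrixLaw_transpose_tail (n m : ℕ) (hm : 0 < m) (a : Fin n → ℝ)
    (ha : 0 < ∑ i, a i ^ 2) {δ : ℝ} (h0 : 0 ≤ δ) (h1 : δ ≤ 1) :
    gaussianMatrixLaw n m (1 / m) {G | (1 + δ) * ∑ i, a i ^ 2 ≤ ∑ j, (∑ i, G i j * a i) ^ 2}
      ≤ ENNReal.ofReal (Real.exp (-(m * δ ^ 2 / 8))) := by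
  set A := ∑ i, a i ^ 2 with hA
  have hm' : (0 : ℝ) < m := by exact_mod_cast hm
  -- Normalized so that `t · (1/m) · |a|² = δ/4`, the optimal parameter of the standard case.
  set t : ℝ := δ / 4 * m / A with ht
  have ht0 : 0 ≤ t := by positivity
  have key := lintegral_exp_sum_sq_transpose n m (1 / m) a ht0
  have e : t * ((1 / m : ℝ≥0) : ℝ) * A = δ / 4 := by
    rw [ht]
    push_cast
    field_simp
  rw [← hA, e, ← ofReal_integral_eq_lintegral_ofReal (integrable_exp_sum_sq m (by linarith))
    (ae_of_all _ fun z => (Real.exp_pos _).le)] at key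
  have hmeas : AEStronglyMeasurable
      (fun G : Fin n → Fin m → ℝ => Real.exp (t * ∑ j, (∑ i, G i j * a i) ^ 2))
      (gaussianMatrixLaw n m (1 / m)) := by
    refine Measurable.aestronglyMeasurable ?_
    fun_prop
  have hint : Integrable (fun G : Fin n → Fin m → ℝ => Real.exp (t * ∑ j, (∑ i, G i j * a i) ^ 2))
      (gaussianMatrixLaw n m (1 / m)) := by
    refine ⟨hmeas, ?_⟩
    rw [hasFiniteIntegral_iff_ofReal (ae_of_all _ fun z => (Real.exp_pos _).le), key]
    exact ENNReal.ofReal_lt_top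
  have hle : ∫ G : Fin n → Fin m → ℝ, Real.exp (t * ∑ j, (∑ i, G i j * a i) ^ 2)
      ∂gaussianMatrixLaw n m (1 / m) ≤ Real.exp (m * (δ / 4 + 2 * (δ / 4) ^ 2)) := by
    rw [integral_eq_lintegral_of_nonneg_ae (ae_of_all _ fun z => (Real.exp_pos _).le) hmeas, key,
      ENNReal.toReal_ofReal (integral_nonneg fun z => (Real.exp_pos _).le)]
    exact integral_exp_sum_sq_le m (by positivity) (by linarith)
  refine (measure_le_of_integral_exp_le ht0 hint hle).trans (le_of_eq ?_)
  congr 2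
  rw [ht]
  field_simp
  ring

/-! ### Comparison inequalities for Gaussian bilinear forms -/

/-- The Euclidean norm of a coordinate vector. -/
noncomputable def vnorm {n : ℕ} (x : Fin n → ℝ) : ℝ := √(x ⬝ᵥ x)

theorem dotProduct_self_nonneg_real {n : ℕ} (x : Fin n → ℝ) : 0 ≤ x ⬝ᵥ x :=
  Finset.sum_nonneg fun i _ => mul_self_nonneg (x i)

theorem dotProduct_self_pos {n : ℕ} {x : Fin n → ℝ} (hx : x ≠ 0) : 0 < x ⬝ᵥ x :=
  lt_of_le_of_ne (dotProduct_self_nonneg_real x) fun h => hx (dotProduct_self_eq_zero.1 h.symm)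

theorem dotProduct_self_eq_sum_sq {n : ℕ} (x : Fin n → ℝ) : x ⬝ᵥ x = ∑ i, x i ^ 2 := by
  simp [dotProduct, sq]

theorem vnorm_nonneg {n : ℕ} (x : Fin n → ℝ) : 0 ≤ vnorm x := Real.sqrt_nonneg _

theorem vnorm_sq {n : ℕ} (x : Fin n → ℝ) : vnorm x ^ 2 = x ⬝ᵥ x :=
  Real.sq_sqrt (dotProduct_self_nonneg_real x)

theorem vnorm_mul_self {n : ℕ} (x : Fin n → ℝ) : vnorm x * vnorm x = x ⬝ᵥ x := by
  rw [← sq, vnorm_sq]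

theorem continuous_vnorm {n : ℕ} : Continuous (vnorm : (Fin n → ℝ) → ℝ) := by
  unfold vnorm dotProduct
  fun_prop

theorem dotProduct_le_vnorm_mul {n : ℕ} (x y : Fin n → ℝ) : x ⬝ᵥ y ≤ vnorm x * vnorm y := by
  have h := Finset.sum_mul_sq_le_sq_mul_sq Finset.univ x y
  rw [← dotProduct_self_eq_sum_sq, ← dotProduct_self_eq_sum_sq] at h
  refine le_of_sq_le_sq ?_ (mul_nonneg (vnorm_nonneg x) (vnorm_nonneg y))
  rw [mul_pow, vnorm_sq, vnorm_sq]
  exact h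

theorem half_le_gaussianReal_Ici (v : ℝ≥0) : 2⁻¹ ≤ gaussianReal 0 v (Ici 0) := by
  have h1 : gaussianReal 0 v (Iic 0) = gaussianReal 0 v (Ici 0) := by
    have h := gaussianReal_map_neg (μ := 0) (v := v)
    rw [neg_zero] at h
    conv_rhs => rw [← h]
    rw [Measure.map_apply measurable_neg measurableSet_Ici]
    congr 1
    ext x
    simp
  have h2 : 1 ≤ gaussianReal 0 v (Ici 0) + gaussianReal 0 v (Ici 0) := by
    calc (1 : ℝ≥0∞) = gaussianReal 0 v (Iic 0 ∪ Ici 0) := by rw [Iic_union_Ici, measure_univ]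
      _ ≤ _ := (measure_union_le _ _).trans (by rw [h1])
  rw [← two_mul] at h2
  rw [ENNReal.inv_le_iff_le_mul (by simp) (by simp)]
  exact h2

/-- The process `⟨p, Gx⟩` has smaller variance than the split process, and the deficit is filled by
an independent term `|p||x|z`. That term can only help when `z ≥ 0`, which has probability at least
`1/2`; hence a factor `2` for each matrix. -/
theorem measure_le_two_mul_prod {Ω : Type*} [MeasurableSpace Ω] (P : Measure Ω) [SFinite P]
    (v : ℝ≥0) (S : Set Ω) : P S ≤ 2 * P.prod (gaussianReal 0 v) (S ×ˢ Ici 0) := by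
  rw [Measure.prod_prod]
  calc P S = 2 * (P S * 2⁻¹) := by
        rw [mul_comm (P S), ← mul_assoc, ENNReal.mul_inv_cancel (by simp) (by simp), one_mul]
    _ ≤ _ := by
        gcongr
        exact half_le_gaussianReal_Ici v

theorem GaussianFamily.bilinear {T : Type*} [Fintype T] (n m : ℕ) (v : ℝ≥0) (c : ℝ)
    (p : T → Fin n → ℝ) (x : T → Fin m → ℝ) :
    GaussianFamily (gaussianMatrixLaw n m v)
      (fun t G => c * (p t ⬝ᵥ Matrix.of G *ᵥ x t))
      (fun t u => v * c ^ 2 * ((p t ⬝ᵥ p u) * (x t ⬝ᵥ x u))) := by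
  refine (GaussianFamily.matrix n m v fun t i j => c * p t i * x t j).congr ?_ ?_
  · intro t G
    simp only [dotProduct, Matrix.mulVec, Matrix.of_apply, Finset.mul_sum]
    refine Finset.sum_congr rfl fun i _ => Finset.sum_congr rfl fun j _ => ?_
    ring
  · intro t u
    simp only [dotProduct]
    rw [Finset.sum_mul_sum, mul_assoc, Finset.mul_sum]
    congr 1
    refine Finset.sum_congr rfl fun i _ => ?_
    rw [Finset.mul_sum]
    refine Finset.sum_congr rfl fun j _ => ?_
    ring

theorem GaussianFamily.std {T : Type*} [Fintype T] (n : ℕ) (a : T → Fin n → ℝ) :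
    GaussianFamily (stdGaussianVec n) (fun t g => a t ⬝ᵥ g) (fun t u => a t ⬝ᵥ a u) :=
  (GaussianFamily.vector n 1 a).congr (fun _ _ => rfl) fun t u => by simp [dotProduct]

/-- The covariance of the process `‖x‖⟨p, g⟩ + ‖p‖⟨x, h⟩`. -/
noncomputable def splitCov {n m : ℕ} (p p' : Fin n → ℝ) (x x' : Fin m → ℝ) : ℝ :=
  vnorm x * vnorm x' * (p ⬝ᵥ p') + vnorm p * vnorm p' * (x ⬝ᵥ x')

/-- The gap is the product of two Cauchy–Schwarz defects, `(|p||p'| - ⟨p, p'⟩)(|x||x'| - ⟨x, x'⟩)`.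
It vanishes when `x = x'`, which yields the equality of covariances that Gordon's inequality
requires within a row. -/
theorem splitCov_le {n m : ℕ} (p p' : Fin n → ℝ) (x x' : Fin m → ℝ) :
    splitCov p p' x x' ≤ (p ⬝ᵥ p') * (x ⬝ᵥ x') + vnorm p * vnorm p' * (vnorm x * vnorm x') := by
  have h := mul_nonneg (sub_nonneg.2 (dotProduct_le_vnorm_mul p p'))
    (sub_nonneg.2 (dotProduct_le_vnorm_mul x x'))
  unfold splitCov
  linarith

theorem splitCov_self_right {n m : ℕ} (p p' : Fin n → ℝ) (x : Fin m → ℝ) :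
    splitCov p p' x x = (p ⬝ᵥ p') * (x ⬝ᵥ x) + vnorm p * vnorm p' * (vnorm x * vnorm x) := by
  unfold splitCov
  rw [vnorm_mul_self]
  ring

theorem GaussianFamily.split {T : Type*} [Fintype T] (n m : ℕ) (c : ℝ)
    (p : T → Fin n → ℝ) (x : T → Fin m → ℝ) :
    GaussianFamily ((stdGaussianVec n).prod (stdGaussianVec m))
      (fun t ω => c * (vnorm (x t) * (p t ⬝ᵥ ω.1) + vnorm (p t) * (x t ⬝ᵥ ω.2)))
      (fun t u => c ^ 2 * splitCov (p t) (p u) (x t) (x u)) := by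
  refine ((GaussianFamily.std n fun t => (c * vnorm (x t)) • p t).prod_add
    (GaussianFamily.std m fun t => (c * vnorm (p t)) • x t)).congr ?_ ?_
  · intro t ω
    simp only [smul_dotProduct, smul_eq_mul]
    ring
  · intro t u
    simp only [smul_dotProduct, dotProduct_smul, smul_eq_mul, splitCov]
    ring

/-- Gordon's inequality for bilinear forms of a Gaussian matrix. -/
theorem gaussianMatrixLaw_gordon {I J : Type*} [Countable I] [Countable J] (n m : ℕ) (hm : 0 < m)
    (c : ℝ) (hc : 0 ≤ c) (p : I × J → Fin n → ℝ) (x : I → Fin m → ℝ) (l : I × J → ℝ) :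
    gaussianMatrixLaw n m (1 / m)
        {G | ∃ i, ∀ j, l (i, j) < c * (p (i, j) ⬝ᵥ Matrix.of G *ᵥ x i)}
      ≤ 2 * ((stdGaussianVec n).prod (stdGaussianVec m)) {ω | ∃ i, ∀ j, l (i, j) ≤
        c / √m * (vnorm (x i) * (p (i, j) ⬝ᵥ ω.1) + vnorm (p (i, j)) * (x i ⬝ᵥ ω.2))} := by
  refine (measure_le_two_mul_prod (gaussianMatrixLaw n m (1 / m)) (1 / m) _).trans ?_
  refine mul_le_mul_right ?_ 2
  have hv : (((1 / m : ℝ≥0)) : ℝ) * c ^ 2 = (c / √m) ^ 2 := by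
    rw [div_pow, Real.sq_sqrt (by positivity)]
    push_cast
    ring
  have hG := GaussianFamily.gordon (I := I) (J := J)
    (P := (gaussianMatrixLaw n m (1 / m)).prod (gaussianReal 0 (1 / m)))
    (P' := (stdGaussianVec n).prod (stdGaussianVec m))
    (X := fun t ω => c * (p t ⬝ᵥ Matrix.of ω.1 *ᵥ x t.1) + c * (vnorm (p t) * vnorm (x t.1)) * ω.2)
    (Y := fun t ω => c / √m * (vnorm (x t.1) * (p t ⬝ᵥ ω.1) + vnorm (p t) * (x t.1 ⬝ᵥ ω.2)))
    (C := fun t u => (c / √m) ^ 2 * ((p t ⬝ᵥ p u) * (x t.1 ⬝ᵥ x u.1)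
      + vnorm (p t) * vnorm (p u) * (vnorm (x t.1) * vnorm (x u.1))))
    (C' := fun t u => (c / √m) ^ 2 * splitCov (p t) (p u) (x t.1) (x u.1))
    ?_ ?_ ?_ ?_ l
  · refine (measure_mono ?_).trans hG
    rintro ⟨G, z⟩ ⟨⟨i, hi⟩, hz⟩
    refine ⟨i, fun j => (hi j).trans_le (le_add_of_nonneg_right ?_)⟩
    exact mul_nonneg (mul_nonneg hc (mul_nonneg (vnorm_nonneg _) (vnorm_nonneg _))) hz
  · intro A B
    refine ((GaussianFamily.bilinear n m (1 / m) c (fun t : A × B => p (t.1, t.2))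
      fun t => x t.1).prod_add (GaussianFamily.gaussianReal (1 / m) fun t : A × B =>
        c * (vnorm (p (t.1, t.2)) * vnorm (x t.1)))).congr (fun _ _ => rfl) fun t u => ?_
    rw [← hv]
    ring
  · intro A B
    exact GaussianFamily.split n m (c / √m) (fun t : A × B => p (t.1, t.2)) fun t => x t.1
  · rintro ⟨i, j⟩ ⟨i', j'⟩ h
    simp only at h
    subst h
    simp only [splitCov_self_right]
  · intro t u
    exact mul_le_mul_of_nonneg_left (splitCov_le _ _ _ _) (sq_nonneg _)

/-- Slepian's inequality for sums of bilinear forms of two independent Gaussian matrices, against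
any Gaussian process with the split covariance. -/
theorem gaussianMatrixLaw_prod_slepian {I : Type*} [Countable I] {n m : ℕ} (v : ℝ≥0)
    {c₁ c₂ : ℝ} (h₁ : 0 ≤ c₁) (h₂ : 0 ≤ c₂) (p q : I → Fin n → ℝ) (x y : I → Fin m → ℝ)
    (l : I → ℝ) {Ω' : Type*} [MeasurableSpace Ω'] {P' : Measure Ω'} [IsProbabilityMeasure P']
    {Y : I → Ω' → ℝ}
    (hY : ∀ (A : Finset I) (B : Finset Unit), GaussianFamily P' (fun t : A × B => Y t.1)
      fun t u => v * c₁ ^ 2 * splitCov (p t.1) (p u.1) (x t.1) (x u.1)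
        + v * c₂ ^ 2 * splitCov (q t.1) (q u.1) (y t.1) (y u.1)) :
    ((gaussianMatrixLaw n m v).prod (gaussianMatrixLaw n m v)) {ω | ∃ i, l i <
        c₁ * (p i ⬝ᵥ Matrix.of ω.1 *ᵥ x i) + c₂ * (q i ⬝ᵥ Matrix.of ω.2 *ᵥ y i)}
      ≤ 4 * P' {ω | ∃ i, l i ≤ Y i ω} := by
  refine (measure_le_two_mul_prod _ v _).trans ?_
  rw [show (4 : ℝ≥0∞) = 2 * 2 by norm_num, mul_assoc]
  refine mul_le_mul_right ((measure_le_two_mul_prod _ v _).trans (mul_le_mul_right ?_ 2)) 2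
  -- A one-point column set turns Gordon's min-max inequality into Slepian's.
  refine (measure_mono ?_).trans ((GaussianFamily.gordon (I := I) (J := Unit)
    (P := (((gaussianMatrixLaw n m v).prod (gaussianMatrixLaw n m v)).prod
      (gaussianReal 0 v)).prod (gaussianReal 0 v)) (P' := P')
    (X := fun t ω => c₁ * (p t.1 ⬝ᵥ Matrix.of ω.1.1.1 *ᵥ x t.1)
      + c₂ * (q t.1 ⬝ᵥ Matrix.of ω.1.1.2 *ᵥ y t.1)
      + c₁ * (vnorm (p t.1) * vnorm (x t.1)) * ω.1.2
      + c₂ * (vnorm (q t.1) * vnorm (y t.1)) * ω.2)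
    (Y := fun t ω => Y t.1 ω)
    (C := fun t u => v * c₁ ^ 2 * ((p t.1 ⬝ᵥ p u.1) * (x t.1 ⬝ᵥ x u.1)
        + vnorm (p t.1) * vnorm (p u.1) * (vnorm (x t.1) * vnorm (x u.1)))
      + v * c₂ ^ 2 * ((q t.1 ⬝ᵥ q u.1) * (y t.1 ⬝ᵥ y u.1)
        + vnorm (q t.1) * vnorm (q u.1) * (vnorm (y t.1) * vnorm (y u.1))))
    (C' := fun t u => v * c₁ ^ 2 * splitCov (p t.1) (p u.1) (x t.1) (x u.1)
        + v * c₂ ^ 2 * splitCov (q t.1) (q u.1) (y t.1) (y u.1))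
    ?_ hY ?_ ?_ fun t => l t.1).trans (measure_mono ?_))
  · rintro ⟨⟨ω, z⟩, z'⟩ ⟨⟨⟨i, hi⟩, hz⟩, hz'⟩
    refine ⟨i, fun _ => hi.trans_le ?_⟩
    have e1 : 0 ≤ c₁ * (vnorm (p i) * vnorm (x i)) * z :=
      mul_nonneg (mul_nonneg h₁ (mul_nonneg (vnorm_nonneg _) (vnorm_nonneg _))) hz
    have e2 : 0 ≤ c₂ * (vnorm (q i) * vnorm (y i)) * z' :=
      mul_nonneg (mul_nonneg h₂ (mul_nonneg (vnorm_nonneg _) (vnorm_nonneg _))) hz'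
    linarith
  · intro A B
    refine ((((GaussianFamily.bilinear n m v c₁ (fun t : A × B => p t.1) fun t => x t.1).prod_add
      (GaussianFamily.bilinear n m v c₂ (fun t : A × B => q t.1) fun t => y t.1)).prod_add
      (GaussianFamily.gaussianReal v fun t : A × B =>
        c₁ * (vnorm (p t.1) * vnorm (x t.1)))).prod_add
      (GaussianFamily.gaussianReal v fun t : A × B =>
        c₂ * (vnorm (q t.1) * vnorm (y t.1)))).congr (fun _ _ => rfl) fun t u => ?_
    ring
  · rintro ⟨i, j⟩ ⟨i', j'⟩ h
    simp only at h
    subst h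
    simp only [splitCov_self_right]
  · intro t u
    exact add_le_add
      (mul_le_mul_of_nonneg_left (splitCov_le _ _ _ _) (mul_nonneg v.2 (sq_nonneg _)))
      (mul_le_mul_of_nonneg_left (splitCov_le _ _ _ _) (mul_nonneg v.2 (sq_nonneg _)))
  · rintro ω ⟨i, hi⟩
    exact ⟨i, hi ()⟩

/-! ### From eigenvalues to quadratic forms -/

/-- Without real eigenvalues `lambdaMax` is the supremum of the empty set, which is `0` by
convention; a nonzero value therefore certifies a genuine eigenvalue. -/
theorem exists_eigenvector_lambdaMax {ι : Type*} [Fintype ι] [DecidableEq ι] {W : Matrix ι ι ℝ}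
    (h : lambdaMax W ≠ 0) : ∃ w : ι → ℝ, w ≠ 0 ∧ W *ᵥ w = lambdaMax W • w := by
  have hne : (spectrum ℝ W).Nonempty := by
    by_contra hcon
    rw [not_nonempty_iff_eq_empty] at hcon
    exact h (by rw [lambdaMax, hcon, Real.sSup_empty])
  have hmem := (isGreatest_lambdaMax W hne).1
  rw [← Matrix.spectrum_toLin', ← Module.End.hasEigenvalue_iff_mem_spectrum] at hmem
  obtain ⟨w, hw⟩ := hmem.exists_hasEigenvector
  exact ⟨w, hw.2, by simpa [Matrix.toLin'_apply] using hw.apply_eq_smul⟩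

/-- A strict inequality is an open condition, so an uncontrolled random witness can be moved into a
fixed countable set. Both measurability of the events and the comparison inequalities call for such
index sets. -/
theorem exists_denseSeq_pos {E : Type*} [TopologicalSpace E] [TopologicalSpace.SeparableSpace E]
    [Nonempty E] {F : E → ℝ} (hF : Continuous F) {e : E} (he : 0 < F e) :
    ∃ k, 0 < F (TopologicalSpace.denseSeq E k) := by
  obtain ⟨k, hk⟩ := (TopologicalSpace.denseRange_denseSeq E).exists_mem_open
    (isOpen_lt continuous_const hF) ⟨e, he⟩
  exact ⟨k, hk⟩

/-- The quadratic form `|x|² + |y|² - 2κ⟨x, y⟩`. -/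
noncomputable def couplingForm {d : ℕ} (κ : ℝ) (x y : Fin d → ℝ) : ℝ :=
  x ⬝ᵥ x + y ⬝ᵥ y - 2 * κ * (x ⬝ᵥ y)

theorem le_couplingForm {d : ℕ} {κ : ℝ} (h0 : 0 ≤ κ) (x y : Fin d → ℝ) :
    (1 - κ) * (x ⬝ᵥ x + y ⬝ᵥ y) ≤ couplingForm κ x y := by
  have h := dotProduct_self_nonneg_real (x - y)
  simp only [sub_dotProduct, dotProduct_sub] at h
  rw [dotProduct_comm y x] at h
  unfold couplingForm
  nlinarith

theorem couplingForm_pos {d : ℕ} {κ : ℝ} (h0 : 0 ≤ κ) (h1 : κ < 1) {x y : Fin d → ℝ}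
    (h : (x, y) ≠ 0) : 0 < couplingForm κ x y := by
  refine lt_of_lt_of_le (mul_pos (by linarith) ?_) (le_couplingForm h0 x y)
  by_cases hx : x = 0
  · have hy : y ≠ 0 := fun hy => h (by rw [hx, hy]; rfl)
    exact add_pos_of_nonneg_of_pos (dotProduct_self_nonneg_real x) (dotProduct_self_pos hy)
  · exact add_pos_of_pos_of_nonneg (dotProduct_self_pos hx) (dotProduct_self_nonneg_real y)

/-- Eliminating between the two rows of the eigenvalue equation gives `(1 - κ²)Ax = Λ(x - κy)` and
`(1 - κ²)By = Λ(y - κx)`; pairing with `x` and `y` produces the coupling form. -/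
theorem exists_couplingForm_le_of_le_lambdaMax {d : ℕ} {κ r : ℝ} (h0 : 0 ≤ κ) (h1 : κ < 1)
    (hr : 0 < r) {A B : Matrix (Fin d) (Fin d) ℝ} (h : r ≤ lambdaMax (spikedW κ A B)) :
    ∃ x y : Fin d → ℝ, (x, y) ≠ 0 ∧
      r * couplingForm κ x y ≤ (1 - κ ^ 2) * (x ⬝ᵥ A *ᵥ x + y ⬝ᵥ B *ᵥ y) := by
  obtain ⟨w, hw, hW⟩ := exists_eigenvector_lambdaMax (hr.trans_le h).ne'
  set Λ := lambdaMax (spikedW κ A B) with hΛ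
  obtain ⟨x, y, rfl⟩ : ∃ x y, w = Sum.elim x y :=
    ⟨w ∘ Sum.inl, w ∘ Sum.inr, (Sum.elim_comp_inl_inr w).symm⟩
  have hxy : (x, y) ≠ 0 := by
    intro he
    rw [Prod.mk_eq_zero] at he
    apply hw
    ext i
    cases i <;> simp [he.1, he.2]
  refine ⟨x, y, hxy, ?_⟩
  rw [spikedW, Matrix.fromBlocks_mulVec] at hW
  have e1 : A *ᵥ x + κ • (B *ᵥ y) = Λ • x := by
    ext i
    have := congrFun hW (Sum.inl i)
    simpa [Matrix.smul_mulVec] using this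
  have e2 : κ • (A *ᵥ x) + B *ᵥ y = Λ • y := by
    ext i
    have := congrFun hW (Sum.inr i)
    simpa [Matrix.smul_mulVec] using this
  have f1 := congrArg (fun z => x ⬝ᵥ z) e1
  have f2 := congrArg (fun z => x ⬝ᵥ z) e2
  have f3 := congrArg (fun z => y ⬝ᵥ z) e1
  have f4 := congrArg (fun z => y ⬝ᵥ z) e2
  simp only [dotProduct_add, dotProduct_smul, smul_eq_mul] at f1 f2 f3 f4
  rw [dotProduct_comm y x] at f3
  have hq : (1 - κ ^ 2) * (x ⬝ᵥ A *ᵥ x + y ⬝ᵥ B *ᵥ y) = Λ * couplingForm κ x y := by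
    unfold couplingForm
    linear_combination f1 - κ * f2 + f4 - κ * f3
  rw [hq]
  exact mul_le_mul_of_nonneg_right h (couplingForm_pos h0 h1 hxy).le

/-- The rank-two quadratic form `⟨g, x⟩² + ⟨h, y⟩²` is controlled by the coupling form. -/
theorem sq_add_sq_le_couplingForm {d : ℕ} {κ N M : ℝ} (h0 : 0 ≤ κ) (h1 : κ ≤ 1)
    {g h : Fin d → ℝ} (hN : 0 < N) (hM : 0 ≤ M) (hg : g ⬝ᵥ g ≤ N) (hh : h ⬝ᵥ h ≤ N)
    (hgh : |g ⬝ᵥ h| ≤ M) (x y : Fin d → ℝ) :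
    (1 - κ ^ 2) * ((g ⬝ᵥ x) ^ 2 + (h ⬝ᵥ y) ^ 2) ≤ (N + M) * couplingForm κ x y := by
  set s := g ⬝ᵥ x with hs
  set t := h ⬝ᵥ y with ht
  -- The point is shifted by `ρK(sg, th)`, with `K = [[1, κ], [κ, 1]]`. The value of `ρ` optimizes
  -- the square once `N + M` bounds the Gram form of `(sg, th)` twisted by `K`.
  set ρ := (N + M)⁻¹ with hρ
  have hNM : 0 < N + M := by linarith
  have hκ : 0 ≤ 1 - κ ^ 2 := by nlinarith
  -- a sum of squares: the coupling form at a shifted point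
  have key := le_trans (mul_nonneg (sub_nonneg.2 h1)
    (add_nonneg (dotProduct_self_nonneg_real _) (dotProduct_self_nonneg_real _)))
    (le_couplingForm h0 (x - ρ • (s • g + (κ * t) • h)) (y - ρ • ((κ * s) • g + t • h)))
  have e : couplingForm κ (x - ρ • (s • g + (κ * t) • h)) (y - ρ • ((κ * s) • g + t • h))
      = couplingForm κ x y - 2 * ρ * (1 - κ ^ 2) * (s ^ 2 + t ^ 2)
        + ρ ^ 2 * (1 - κ ^ 2) * (s ^ 2 * (g ⬝ᵥ g) + t ^ 2 * (h ⬝ᵥ h)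
          + 2 * κ * (s * t) * (g ⬝ᵥ h)) := by
    unfold couplingForm
    simp only [sub_dotProduct, dotProduct_sub, add_dotProduct, dotProduct_add, smul_dotProduct,
      dotProduct_smul, smul_eq_mul]
    rw [dotProduct_comm x g, dotProduct_comm y h, dotProduct_comm x h, dotProduct_comm y g,
      dotProduct_comm h g, ← hs, ← ht]
    ring
  rw [e] at key
  have hb : s ^ 2 * (g ⬝ᵥ g) + t ^ 2 * (h ⬝ᵥ h) + 2 * κ * (s * t) * (g ⬝ᵥ h)
      ≤ (s ^ 2 + t ^ 2) * (N + M) := by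
    have b1 : s ^ 2 * (g ⬝ᵥ g) ≤ s ^ 2 * N := mul_le_mul_of_nonneg_left hg (sq_nonneg s)
    have b2 : t ^ 2 * (h ⬝ᵥ h) ≤ t ^ 2 * N := mul_le_mul_of_nonneg_left hh (sq_nonneg t)
    have b3 : 2 * κ * (s * t) * (g ⬝ᵥ h) ≤ (s ^ 2 + t ^ 2) * M := by
      refine (le_abs_self _).trans ?_
      rw [abs_mul]
      refine mul_le_mul ?_ hgh (abs_nonneg _) (by positivity)
      rw [abs_mul, abs_of_nonneg (by positivity : (0 : ℝ) ≤ 2 * κ), abs_mul]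
      have := two_mul_le_add_sq |s| |t|
      rw [sq_abs, sq_abs] at this
      have h4 : 0 ≤ |s| * |t| := by positivity
      nlinarith
    linarith
  have hρ1 : ρ * (N + M) = 1 := inv_mul_cancel₀ hNM.ne'
  have hb2 := mul_le_mul_of_nonneg_left hb (mul_nonneg (sq_nonneg ρ) hκ)
  have e3 : ρ ^ 2 * (1 - κ ^ 2) * ((s ^ 2 + t ^ 2) * (N + M))
      = ρ * (1 - κ ^ 2) * (s ^ 2 + t ^ 2) := by
    calc _ = ρ * (ρ * (N + M)) * (1 - κ ^ 2) * (s ^ 2 + t ^ 2) := by ring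
      _ = _ := by rw [hρ1]; ring
  rw [e3] at hb2
  have h5 : ρ * ((1 - κ ^ 2) * (s ^ 2 + t ^ 2)) ≤ couplingForm κ x y := by linarith
  calc (1 - κ ^ 2) * (s ^ 2 + t ^ 2)
      = (N + M) * (ρ * ((1 - κ ^ 2) * (s ^ 2 + t ^ 2))) := by
        rw [← mul_assoc, mul_comm (N + M), hρ1, one_mul]
    _ ≤ _ := mul_le_mul_of_nonneg_left h5 hNM.le

/-! ### Typical vectors and the spiked Wigner model -/

theorem mul_ofReal_exp_le {K a b : ℝ} (hK : 0 < K) (h : Real.log K + b ≤ a) :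
    ENNReal.ofReal K * ENNReal.ofReal (Real.exp (-a)) ≤ ENNReal.ofReal (Real.exp (-b)) := by
  rw [← ENNReal.ofReal_mul hK.le]
  refine ENNReal.ofReal_le_ofReal ?_
  calc K * Real.exp (-a) = Real.exp (Real.log K + -a) := by rw [Real.exp_add, Real.exp_log hK]
    _ ≤ _ := Real.exp_le_exp.2 (by linarith)

theorem stdGaussianVec_prod_bad_le (n : ℕ) {δ : ℝ} (h0 : 0 ≤ δ) (h1 : δ ≤ 1) :
    ((stdGaussianVec n).prod (stdGaussianVec n)) {p | ¬ (p.1 ⬝ᵥ p.1 < n * (1 + δ) ∧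
      p.2 ⬝ᵥ p.2 < n * (1 + δ) ∧ |p.1 ⬝ᵥ p.2| < n * δ)}
      ≤ 5 * ENNReal.ofReal (Real.exp (-(n * δ ^ 2 / 8))) := by
  set c := ENNReal.ofReal (Real.exp (-(n * δ ^ 2 / 8))) with hc
  have hsub : {p : (Fin n → ℝ) × (Fin n → ℝ) | ¬ (p.1 ⬝ᵥ p.1 < n * (1 + δ) ∧
      p.2 ⬝ᵥ p.2 < n * (1 + δ) ∧ |p.1 ⬝ᵥ p.2| < n * δ)}
      ⊆ {p | p.1 ∈ {g | n * (1 + δ) ≤ ∑ i, g i ^ 2}} ∪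
        ({p | p.2 ∈ {g | n * (1 + δ) ≤ ∑ i, g i ^ 2}} ∪
         {p | n * δ ≤ |∑ i, p.1 i * p.2 i|}) := by
    intro p hp
    simp only [mem_ofPred_eq, mem_union, ← dotProduct_self_eq_sum_sq] at hp ⊢
    by_contra hcon
    simp only [not_or, not_le] at hcon
    exact hp hcon
  refine (measure_mono hsub).trans ((measure_union_le _ _).trans ?_)
  have e5 : 5 * c = c + (c + 3 * c) := by ring
  rw [e5]
  refine add_le_add ?_ ((measure_union_le _ _).trans (add_le_add ?_ ?_))
  · rw [prod_measure_fst_preimage]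
    exact stdGaussianVec_sum_sq_tail n h0 h1
  · rw [prod_measure_snd_preimage]
    exact stdGaussianVec_sum_sq_tail n h0 h1
  · exact stdGaussianVec_prod_inner_tail n h0 h1

/-- For typical `g` and `h`, the comparison process of the spiked Wigner matrix stays below its
threshold at every nonzero `(x, y)`. -/
theorem wigner_deterministic {n : ℕ} (hn : 0 < n) {α β κ ε : ℝ} (h0 : 0 ≤ κ) (h1 : κ < 1)
    (hε : 0 < ε) {x y g h : Fin n → ℝ} (hxy : (x, y) ≠ 0)
    (hg : g ⬝ᵥ g < n * (1 + ε / 8)) (hh : h ⬝ᵥ h < n * (1 + ε / 8))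
    (hgh : |g ⬝ᵥ h| < n * (ε / 8)) :
    2 * α / √n * vnorm x * (x ⬝ᵥ g) + 2 * β / √n * vnorm y * (y ⬝ᵥ h)
      < α ^ 2 * (x ⬝ᵥ x) + β ^ 2 * (y ⬝ᵥ y) + (1 + ε / 2) / (1 - κ ^ 2) * couplingForm κ x y := by
  have hn' : (0 : ℝ) < n := by exact_mod_cast hn
  have hκ : 0 < 1 - κ ^ 2 := by nlinarith
  have hQ := couplingForm_pos h0 h1 hxy
  have hs := Real.sq_sqrt hn'.le
  have hs0 : √(n : ℝ) ≠ 0 := (Real.sqrt_pos.2 hn').ne'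
  have key := sq_add_sq_le_couplingForm h0 h1.le (by positivity : (0 : ℝ) < n * (1 + ε / 8))
    (by positivity : (0 : ℝ) ≤ n * (ε / 8)) hg.le hh.le hgh.le x y
  -- The term `a²|u|²` is precisely the shift subtracted in `wignerBar`. What remains has the
  -- constant `(1 + ε/8) + ε/8 = 1 + ε/4`, strictly below the available `1 + ε/2`.
  have amgm : ∀ (a : ℝ) (u w : Fin n → ℝ),
      2 * a / √n * vnorm u * (u ⬝ᵥ w) ≤ a ^ 2 * (u ⬝ᵥ u) + (w ⬝ᵥ u) ^ 2 / n := fun a u w => by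
    have e := sq_nonneg (a * vnorm u - (w ⬝ᵥ u) / √n)
    rw [sub_sq, mul_pow, vnorm_sq, div_pow, hs] at e
    rw [dotProduct_comm u w]
    have e2 : 2 * a / √n * vnorm u * (w ⬝ᵥ u) = 2 * (a * vnorm u) * ((w ⬝ᵥ u) / √n) := by
      field_simp
    linarith
  have a1 := amgm α x g
  have a2 := amgm β y h
  have k2 : (g ⬝ᵥ x) ^ 2 / n + (h ⬝ᵥ y) ^ 2 / n
      ≤ (1 + ε / 4) / (1 - κ ^ 2) * couplingForm κ x y := by
    rw [← add_div, div_le_iff₀ hn', div_mul_eq_mul_div, div_mul_eq_mul_div, le_div_iff₀ hκ]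
    linarith
  have k3 : (1 + ε / 4) / (1 - κ ^ 2) * couplingForm κ x y
      < (1 + ε / 2) / (1 - κ ^ 2) * couplingForm κ x y := by
    refine mul_lt_mul_of_pos_right (div_lt_div_of_pos_right (by linarith) hκ) hQ
  linarith

theorem goeMap_bilinear {n : ℕ} (G : Fin n → Fin n → ℝ) (x : Fin n → ℝ) :
    x ⬝ᵥ Matrix.of (goeMap n G) *ᵥ x = 2 / √(2 * n) * (x ⬝ᵥ Matrix.of G *ᵥ x) := by
  have e1 : Matrix.of (goeMap n G) = (√(2 * n))⁻¹ • (Matrix.of G + (Matrix.of G)ᵀ) := by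
    ext i j
    simp [goeMap]
    ring
  rw [e1, Matrix.smul_mulVec, Matrix.add_mulVec, dotProduct_smul, dotProduct_add,
    Matrix.mulVec_transpose, dotProduct_comm x (x ᵥ* _), ← Matrix.dotProduct_mulVec, smul_eq_mul]
  ring

theorem wigner_tail {n : ℕ} (hn : 0 < n) {α β κ ε : ℝ} (hα : 0 ≤ α) (hβ : 0 ≤ β) (h0 : 0 ≤ κ)
    (h1 : κ < 1) (hε : ε ∈ Ioo (0 : ℝ) 1) :
    wignerNull n {p | 1 + ε ≤ lambdaMax
        (spikedW κ (wignerBar α (Matrix.of p.1)) (wignerBar β (Matrix.of p.2)))}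
      ≤ ENNReal.ofReal 20 * ENNReal.ofReal (Real.exp (-(n * ε ^ 2 / 512))) := by
  have hn' : (0 : ℝ) < n := by exact_mod_cast hn
  have hκ : 0 < 1 - κ ^ 2 := by nlinarith
  have hε0 := hε.1
  let E := (Fin n → ℝ) × (Fin n → ℝ)
  let D : ℕ → E := TopologicalSpace.denseSeq E
  let I := {k : ℕ // D k ≠ 0}
  let x : I → Fin n → ℝ := fun i => (D i).1
  let y : I → Fin n → ℝ := fun i => (D i).2
  let l : I → ℝ := fun i => α ^ 2 * (x i ⬝ᵥ x i) + β ^ 2 * (y i ⬝ᵥ y i)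
    + (1 + ε / 2) / (1 - κ ^ 2) * couplingForm κ (x i) (y i)
  let S : Set ((Fin n → Fin n → ℝ) × (Fin n → Fin n → ℝ)) := {p | ∃ i, l i <
    α * (x i ⬝ᵥ Matrix.of p.1 *ᵥ x i) + β * (y i ⬝ᵥ Matrix.of p.2 *ᵥ y i)}
  have hS : MeasurableSet S := by
    have : S = ⋃ i, {p | l i < α * (x i ⬝ᵥ Matrix.of p.1 *ᵥ x i)
        + β * (y i ⬝ᵥ Matrix.of p.2 *ᵥ y i)} := by
      ext p
      simp [S]
    rw [this]
    refine MeasurableSet.iUnion fun i => measurableSet_lt measurable_const ?_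
    simp only [dotProduct, Matrix.mulVec, Matrix.of_apply]
    fun_prop
  have hsub : {p : (Fin n → Fin n → ℝ) × (Fin n → Fin n → ℝ) | 1 + ε ≤ lambdaMax
      (spikedW κ (wignerBar α (Matrix.of p.1)) (wignerBar β (Matrix.of p.2)))} ⊆ S := by
    intro p hp
    obtain ⟨x', y', hxy, hle⟩ := exists_couplingForm_le_of_le_lambdaMax h0 h1
      (by linarith : 0 < 1 + ε) hp
    have hQ := couplingForm_pos h0 h1 hxy
    let F : E → ℝ := fun e => α * (e.1 ⬝ᵥ Matrix.of p.1 *ᵥ e.1)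
      + β * (e.2 ⬝ᵥ Matrix.of p.2 *ᵥ e.2) - (α ^ 2 * (e.1 ⬝ᵥ e.1) + β ^ 2 * (e.2 ⬝ᵥ e.2)
      + (1 + ε / 2) / (1 - κ ^ 2) * couplingForm κ e.1 e.2)
    have hF : Continuous F := by
      unfold F E couplingForm dotProduct Matrix.mulVec
      fun_prop
    have hpos : 0 < F (x', y') := by
      have e : ∀ (a : ℝ) (M : Matrix (Fin n) (Fin n) ℝ) (z : Fin n → ℝ),
          z ⬝ᵥ wignerBar a M *ᵥ z = a * (z ⬝ᵥ M *ᵥ z) - a ^ 2 * (z ⬝ᵥ z) := fun a M z => by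
        simp [wignerBar, Matrix.sub_mulVec, Matrix.smul_mulVec, dotProduct_sub]
      rw [e, e] at hle
      have h2 : (1 + ε / 2) / (1 - κ ^ 2) * couplingForm κ x' y'
          < α * (x' ⬝ᵥ Matrix.of p.1 *ᵥ x') - α ^ 2 * (x' ⬝ᵥ x')
            + (β * (y' ⬝ᵥ Matrix.of p.2 *ᵥ y') - β ^ 2 * (y' ⬝ᵥ y')) := by
        rw [div_mul_eq_mul_div, div_lt_iff₀ hκ, mul_comm _ (1 - κ ^ 2)]
        exact lt_of_lt_of_le (mul_lt_mul_of_pos_right (by linarith) hQ) hle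
      simp only [F]
      linarith
    obtain ⟨k, hk⟩ := exists_denseSeq_pos hF hpos
    -- The origin must be excluded from the index set since the strict deterministic bound fails
    -- there; a witness with `F > 0` is never the origin.
    have hk0 : D k ≠ 0 := by
      intro h
      have hz : F 0 = 0 := by simp [F, couplingForm]
      have hk' : 0 < F (D k) := hk
      rw [h, hz] at hk'
      exact lt_irrefl _ hk'
    exact ⟨⟨k, hk0⟩, sub_pos.1 hk⟩
  refine (measure_mono hsub).trans ?_
  have hmap : wignerNull n = ((gaussianMatrixLaw n n 1).prod (gaussianMatrixLaw n n 1)).map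
      (Prod.map (goeMap n) (goeMap n)) :=
    Measure.map_prod_map _ _ (measurable_goeMap n) (measurable_goeMap n)
  rw [hmap, Measure.map_apply ((measurable_goeMap n).prodMap (measurable_goeMap n)) hS]
  have hpre : Prod.map (goeMap n) (goeMap n) ⁻¹' S = {p | ∃ i, l i <
      α * (2 / √(2 * n)) * (x i ⬝ᵥ Matrix.of p.1 *ᵥ x i)
        + β * (2 / √(2 * n)) * (y i ⬝ᵥ Matrix.of p.2 *ᵥ y i)} := by
    ext p
    simp only [S, mem_preimage, mem_ofPred_eq, Prod.map_fst, Prod.map_snd, goeMap_bilinear,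
      mul_assoc]
  rw [hpre]
  -- With both arguments equal to `x`, the two halves of the split covariance coincide, so one
  -- Gaussian vector with doubled variance suffices as comparison process.
  have hcoef : ∀ a : ℝ, (a * (2 / √(2 * n))) ^ 2 * 2 = (2 * a / √n) ^ 2 := fun a => by
    rw [mul_pow, div_pow, div_pow, Real.sq_sqrt (by positivity), Real.sq_sqrt hn'.le]
    field_simp
  refine (gaussianMatrixLaw_prod_slepian (I := I) 1 (c₁ := α * (2 / √(2 * n)))
    (c₂ := β * (2 / √(2 * n))) (by positivity) (by positivity) x y x y l
    (P' := (stdGaussianVec n).prod (stdGaussianVec n))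
    (Y := fun i ω => 2 * α / √n * vnorm (x i) * (x i ⬝ᵥ ω.1)
      + 2 * β / √n * vnorm (y i) * (y i ⬝ᵥ ω.2)) fun A B => ?_).trans ?_
  · refine ((GaussianFamily.std n fun t : A × B => (2 * α / √n * vnorm (x t.1)) • x t.1).prod_add
      (GaussianFamily.std n fun t : A × B => (2 * β / √n * vnorm (y t.1)) • y t.1)).congr ?_ ?_
    · intro t ω
      simp only [smul_dotProduct, smul_eq_mul]
    · intro t u
      have a1 := hcoef α
      have a2 := hcoef β
      simp only [smul_dotProduct, dotProduct_smul, smul_eq_mul, splitCov, NNReal.coe_one]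
      linear_combination (vnorm (x t.1) * vnorm (x u.1) * (x t.1 ⬝ᵥ x u.1)) * a1
        + (vnorm (y t.1) * vnorm (y u.1) * (y t.1 ⬝ᵥ y u.1)) * a2
  · have hbad := stdGaussianVec_prod_bad_le n (δ := ε / 8) (by linarith) (by linarith [hε.2])
    have e20 : ENNReal.ofReal 20 = 4 * 5 := by
      rw [show (4 * 5 : ℝ≥0∞) = ((20 : ℕ) : ℝ≥0∞) by norm_num, ← ENNReal.ofReal_natCast]
      norm_num
    rw [e20, mul_assoc]
    refine mul_le_mul_right ((measure_mono ?_).trans (hbad.trans (le_of_eq ?_))) 4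
    · rintro ω ⟨i, hi⟩ ⟨b1, b2, b3⟩
      exact absurd hi (not_le.2 (wigner_deterministic hn h0 h1 hε0 i.2 b1 b2 b3))
    · congr 4
      ring

/-! ### The spiked Wishart model -/

/-- Maximizing over `p` leaves `(α/(1+α))(|x||g| + ⟨h, x⟩)²/m`. The prefactor is the one for which
the square splits as `α|x|²|g|² + ⟨h, x⟩²`, the first part being matched with the shift. -/
theorem wishart_block_le {n m : ℕ} (hm : 0 < m) {α r : ℝ} (hα : 0 < α) (p g : Fin n → ℝ)
    (x h : Fin m → ℝ) (hg : g ⬝ᵥ g ≤ m * r) :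
    2 * (α / (1 + α)) / √m * (vnorm x * (p ⬝ᵥ g) + vnorm p * (x ⬝ᵥ h))
      ≤ α / (1 + α) * (p ⬝ᵥ p) + α * r * (x ⬝ᵥ x) + (h ⬝ᵥ x) ^ 2 / m := by
  have hm' : (0 : ℝ) < m := by exact_mod_cast hm
  have hs := Real.sq_sqrt hm'.le
  have hs0 : 0 < √(m : ℝ) := Real.sqrt_pos.2 hm'
  have hX := vnorm_nonneg x
  have hP := vnorm_nonneg p
  have hG := vnorm_nonneg g
  set X := vnorm x with hXd
  set P := vnorm p with hPd
  set G := vnorm g with hGd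
  set T := h ⬝ᵥ x with hT
  set a := α / (1 + α) with ha
  have ha0 : 0 < a := by positivity
  have b1 : X * (p ⬝ᵥ g) + P * (x ⬝ᵥ h) ≤ P * (X * G + T) := by
    rw [dotProduct_comm x h]
    have := mul_le_mul_of_nonneg_left (dotProduct_le_vnorm_mul p g) hX
    rw [← hPd, ← hGd] at this
    linarith
  have b2 : 2 * a / √m * (P * (X * G + T)) ≤ a * P ^ 2 + a * (X * G + T) ^ 2 / m := by
    have e := mul_nonneg ha0.le (sq_nonneg (P - (X * G + T) / √m))
    rw [sub_sq, div_pow, hs] at e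
    have e2 : 2 * a / √m * (P * (X * G + T)) = a * (2 * P * ((X * G + T) / √m)) := by
      field_simp
    rw [e2, mul_div_assoc]
    linarith
  have b3 : a * (X * G + T) ^ 2 ≤ α * X ^ 2 * G ^ 2 + T ^ 2 := by
    rw [ha, div_mul_eq_mul_div, div_le_iff₀ (by linarith)]
    -- After clearing `1 + α`, the difference of the two sides is the square `(αs - t)²` with `s =
    -- XG` and `t = T`.
    nlinarith [sq_nonneg (α * (X * G) - T)]
  have b4 : α * X ^ 2 * G ^ 2 ≤ α * X ^ 2 * (m * r) := by
    rw [show G ^ 2 = g ⬝ᵥ g from vnorm_sq g]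
    exact mul_le_mul_of_nonneg_left hg (mul_nonneg hα.le (sq_nonneg X))
  calc _ ≤ 2 * a / √m * (P * (X * G + T)) := mul_le_mul_of_nonneg_left b1 (by positivity)
    _ ≤ a * P ^ 2 + a * (X * G + T) ^ 2 / m := b2
    _ ≤ a * P ^ 2 + (α * X ^ 2 * (m * r) + T ^ 2) / m := by
      gcongr
      linarith
    _ = _ := by
      rw [hPd, hXd, vnorm_sq, vnorm_sq]
      field_simp
      ring

theorem wishart_deterministic {n m : ℕ} (hm : 0 < m) {α β τ κ ε : ℝ} (hα : 0 < α) (hβ : 0 < β)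
    (h0 : 0 ≤ κ) (h1 : κ < 1) (hε : 0 < ε) {x y h h' : Fin m → ℝ} {p q g g' : Fin n → ℝ}
    (hxy : (x, y) ≠ 0) (hg : g ⬝ᵥ g ≤ m * (τ + ε / (16 * (α + β))))
    (hg' : g' ⬝ᵥ g' ≤ m * (τ + ε / (16 * (α + β))))
    (hh : h ⬝ᵥ h < m * (1 + ε / 8)) (hh' : h' ⬝ᵥ h' < m * (1 + ε / 8))
    (hhh : |h ⬝ᵥ h'| < m * (ε / 8)) :
    2 * (α / (1 + α)) / √m * (vnorm x * (p ⬝ᵥ g) + vnorm p * (x ⬝ᵥ h))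
      + 2 * (β / (1 + β)) / √m * (vnorm y * (q ⬝ᵥ g') + vnorm q * (y ⬝ᵥ h'))
      < α / (1 + α) * (p ⬝ᵥ p) + β / (1 + β) * (q ⬝ᵥ q) + α * τ * (x ⬝ᵥ x) + β * τ * (y ⬝ᵥ y)
        + (1 + ε / 2) / (1 - κ ^ 2) * couplingForm κ x y := by
  have hm' : (0 : ℝ) < m := by exact_mod_cast hm
  have hκ : 0 < 1 - κ ^ 2 := by nlinarith
  have hQ := couplingForm_pos h0 h1 hxy
  have a1 := wishart_block_le hm hα p g x h hg
  have a2 := wishart_block_le hm hβ q g' y h' hg'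
  have key := sq_add_sq_le_couplingForm h0 h1.le (by positivity : (0 : ℝ) < m * (1 + ε / 8))
    (by positivity : (0 : ℝ) ≤ m * (ε / 8)) hh.le hh'.le hhh.le x y
  have k2 : (h ⬝ᵥ x) ^ 2 / m + (h' ⬝ᵥ y) ^ 2 / m
      ≤ (1 + ε / 4) / (1 - κ ^ 2) * couplingForm κ x y := by
    rw [← add_div, div_le_iff₀ hm', div_mul_eq_mul_div, div_mul_eq_mul_div, le_div_iff₀ hκ]
    linarith
  have hx := dotProduct_self_nonneg_real x
  have hy := dotProduct_self_nonneg_real y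
  -- The cost of `|g|²` and `|g'|²` exceeding `mτ`. The slack `ε/(16(α+β))` per unit is chosen so
  -- that this takes only `ε/8` of the `ε/4` left over by `k2`.
  have k4 : α * (ε / (16 * (α + β))) * (x ⬝ᵥ x) + β * (ε / (16 * (α + β))) * (y ⬝ᵥ y)
      ≤ (ε / 8) / (1 - κ ^ 2) * couplingForm κ x y := by
    have c1 : ∀ c, 0 < c → c ≤ α + β → c * (ε / (16 * (α + β))) ≤ ε / 16 := fun c _ hc => by
      rw [mul_div_assoc', div_le_div_iff₀ (by positivity) (by norm_num)]
      nlinarith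
    have c2 := mul_le_mul_of_nonneg_right (c1 α hα (by linarith)) hx
    have c3 := mul_le_mul_of_nonneg_right (c1 β hβ (by linarith)) hy
    have c4 := le_couplingForm h0 x y
    have c5 : ε / 16 * (x ⬝ᵥ x + y ⬝ᵥ y) ≤ (ε / 8) / (1 - κ ^ 2) * couplingForm κ x y := by
      rw [div_mul_eq_mul_div (ε / 8), le_div_iff₀ hκ]
      have : (1 - κ ^ 2) = (1 - κ) * (1 + κ) := by ring
      rw [this]
      have c6 := mul_le_mul_of_nonneg_left c4 (by positivity : 0 ≤ ε / 16 * (1 + κ))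
      have c7 : ε / 16 * (1 + κ) * couplingForm κ x y ≤ ε / 8 * couplingForm κ x y :=
        mul_le_mul_of_nonneg_right (by nlinarith) hQ.le
      linarith
    linarith
  have k3 : (1 + ε / 4) / (1 - κ ^ 2) * couplingForm κ x y
      + (ε / 8) / (1 - κ ^ 2) * couplingForm κ x y
      < (1 + ε / 2) / (1 - κ ^ 2) * couplingForm κ x y := by
    rw [← add_mul, ← add_div]
    exact mul_lt_mul_of_pos_right (div_lt_div_of_pos_right (by linarith) hκ) hQ
  linarith

theorem wishart_tail {n m : ℕ} (hm : 0 < m) {α β τ κ ε δ : ℝ} (hα : 0 < α) (hβ : 0 < β)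
    (h0 : 0 ≤ κ) (h1 : κ < 1) (hε : ε ∈ Ioo (0 : ℝ) 1) (hδ0 : 0 ≤ δ) (hδ1 : δ ≤ 1)
    (hδ : n * (1 + δ) ≤ m * (τ + ε / (16 * (α + β)))) :
    wishartNull n m {p | 1 + ε ≤ lambdaMax
        (spikedW κ (wishartBar α τ (Matrix.of p.1)) (wishartBar β τ (Matrix.of p.2)))}
      ≤ ENNReal.ofReal 8 * ENNReal.ofReal (Real.exp (-(n * δ ^ 2 / 8)))
        + ENNReal.ofReal 20 * ENNReal.ofReal (Real.exp (-(m * ε ^ 2 / 512))) := by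
  have hm' : (0 : ℝ) < m := by exact_mod_cast hm
  have hκ : 0 < 1 - κ ^ 2 := by nlinarith
  have hε0 := hε.1
  let E := ((Fin m → ℝ) × (Fin m → ℝ)) × ((Fin n → ℝ) × (Fin n → ℝ))
  let D : ℕ → E := TopologicalSpace.denseSeq E
  let I := {k : ℕ // (D k).1 ≠ 0}
  let x : I → Fin m → ℝ := fun i => (D i).1.1
  let y : I → Fin m → ℝ := fun i => (D i).1.2
  let p : I → Fin n → ℝ := fun i => (D i).2.1
  let q : I → Fin n → ℝ := fun i => (D i).2.2
  let a := α / (1 + α)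
  let b := β / (1 + β)
  have ha : 0 < a := by positivity
  have hb : 0 < b := by positivity
  let l : I → ℝ := fun i => a * (p i ⬝ᵥ p i) + b * (q i ⬝ᵥ q i) + α * τ * (x i ⬝ᵥ x i)
    + β * τ * (y i ⬝ᵥ y i) + (1 + ε / 2) / (1 - κ ^ 2) * couplingForm κ (x i) (y i)
  have hsub : {w : (Fin n → Fin m → ℝ) × (Fin n → Fin m → ℝ) | 1 + ε ≤ lambdaMax
      (spikedW κ (wishartBar α τ (Matrix.of w.1)) (wishartBar β τ (Matrix.of w.2)))}
      ⊆ {w | ∃ i, l i < 2 * a * (p i ⬝ᵥ Matrix.of w.1 *ᵥ x i)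
        + 2 * b * (q i ⬝ᵥ Matrix.of w.2 *ᵥ y i)} := by
    intro w hw
    obtain ⟨x', y', hxy, hle⟩ := exists_couplingForm_le_of_le_lambdaMax h0 h1
      (by linarith : 0 < 1 + ε) hw
    have hQ := couplingForm_pos h0 h1 hxy
    let F : E → ℝ := fun e => 2 * a * (e.2.1 ⬝ᵥ Matrix.of w.1 *ᵥ e.1.1)
      + 2 * b * (e.2.2 ⬝ᵥ Matrix.of w.2 *ᵥ e.1.2)
      - (a * (e.2.1 ⬝ᵥ e.2.1) + b * (e.2.2 ⬝ᵥ e.2.2) + α * τ * (e.1.1 ⬝ᵥ e.1.1)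
        + β * τ * (e.1.2 ⬝ᵥ e.1.2) + (1 + ε / 2) / (1 - κ ^ 2) * couplingForm κ e.1.1 e.1.2)
    have hF : Continuous F := by
      unfold F E couplingForm dotProduct Matrix.mulVec
      fun_prop
    -- At `p = Ux` and `q = Vy` the linearization `2⟨p, Ux⟩ - |p|²` attains `|Ux|²`, so the
    -- quadratic form is recovered.
    have hpos : 0 < F ((x', y'), (Matrix.of w.1 *ᵥ x', Matrix.of w.2 *ᵥ y')) := by
      have e : ∀ (c : ℝ) (M : Matrix (Fin n) (Fin m) ℝ) (z : Fin m → ℝ),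
          z ⬝ᵥ wishartBar c τ M *ᵥ z
            = c / (1 + c) * (M *ᵥ z ⬝ᵥ M *ᵥ z) - c * τ * (z ⬝ᵥ z) := fun c M z => by
        rw [wishartBar, Matrix.sub_mulVec, Matrix.smul_mulVec, Matrix.smul_mulVec,
          dotProduct_sub, dotProduct_smul, dotProduct_smul, Matrix.one_mulVec,
          ← Matrix.mulVec_mulVec, Matrix.dotProduct_mulVec, Matrix.vecMul_transpose]
        rfl
      rw [e, e] at hle
      have h2 : (1 + ε / 2) / (1 - κ ^ 2) * couplingForm κ x' y'
          < a * (Matrix.of w.1 *ᵥ x' ⬝ᵥ Matrix.of w.1 *ᵥ x') - α * τ * (x' ⬝ᵥ x')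
            + (b * (Matrix.of w.2 *ᵥ y' ⬝ᵥ Matrix.of w.2 *ᵥ y') - β * τ * (y' ⬝ᵥ y')) := by
        rw [div_mul_eq_mul_div, div_lt_iff₀ hκ, mul_comm _ (1 - κ ^ 2)]
        exact lt_of_lt_of_le (mul_lt_mul_of_pos_right (by linarith) hQ) hle
      simp only [F]
      linarith
    obtain ⟨k, hk⟩ := exists_denseSeq_pos hF hpos
    have hk0 : (D k).1 ≠ 0 := by
      intro h
      have hk' : 0 < F (D k) := hk
      have hz : F (D k) = -(a * ((D k).2.1 ⬝ᵥ (D k).2.1) + b * ((D k).2.2 ⬝ᵥ (D k).2.2)) := by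
        simp [F, couplingForm, h]
      rw [hz] at hk'
      have c1 := mul_nonneg ha.le (dotProduct_self_nonneg_real (D k).2.1)
      have c2 := mul_nonneg hb.le (dotProduct_self_nonneg_real (D k).2.2)
      linarith
    exact ⟨⟨k, hk0⟩, sub_pos.1 hk⟩
  refine (measure_mono hsub).trans ?_
  have hv : ∀ c : ℝ, ((1 / m : ℝ≥0) : ℝ) * (2 * c) ^ 2 = (2 * c / √m) ^ 2 := fun c => by
    rw [div_pow, Real.sq_sqrt hm'.le]
    push_cast
    ring
  have hG := gaussianMatrixLaw_prod_slepian (I := I) (1 / m) (c₁ := 2 * a) (c₂ := 2 * b)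
    (by positivity) (by positivity) p q x y l
    (P' := ((stdGaussianVec n).prod (stdGaussianVec n)).prod
      ((stdGaussianVec m).prod (stdGaussianVec m)))
    (Y := fun i ω => 2 * a / √m * (vnorm (x i) * (p i ⬝ᵥ ω.1.1) + vnorm (p i) * (x i ⬝ᵥ ω.2.1))
      + 2 * b / √m * (vnorm (y i) * (q i ⬝ᵥ ω.1.2) + vnorm (q i) * (y i ⬝ᵥ ω.2.2)))
    fun A B => by
      refine (((GaussianFamily.std n fun t : A × B =>
        (2 * a / √m * vnorm (x t.1)) • p t.1).prod_add (GaussianFamily.std n fun t : A × B =>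
          (2 * b / √m * vnorm (y t.1)) • q t.1)).prod_add ((GaussianFamily.std m fun t : A × B =>
        (2 * a / √m * vnorm (p t.1)) • x t.1).prod_add (GaussianFamily.std m fun t : A × B =>
          (2 * b / √m * vnorm (q t.1)) • y t.1))).congr ?_ ?_
      · intro t ω
        simp only [smul_dotProduct, smul_eq_mul]
        ring
      · intro t u
        simp only [smul_dotProduct, dotProduct_smul, smul_eq_mul, splitCov, hv]
        ring
  refine hG.trans ?_
  set e₁ := ENNReal.ofReal (Real.exp (-(n * δ ^ 2 / 8))) with he₁
  have hbad := stdGaussianVec_prod_bad_le m (δ := ε / 8) (by linarith) (by linarith [hε.2])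
  have e2 : (m : ℝ) * (ε / 8) ^ 2 / 8 = m * ε ^ 2 / 512 := by ring
  rw [e2] at hbad
  set e₂ := ENNReal.ofReal (Real.exp (-(m * ε ^ 2 / 512))) with he₂
  have hT : stdGaussianVec n {g | m * (τ + ε / (16 * (α + β))) < g ⬝ᵥ g} ≤ e₁ := by
    refine (measure_mono fun g hg => ?_).trans (stdGaussianVec_sum_sq_tail n hδ0 hδ1)
    rw [mem_ofPred_eq, ← dotProduct_self_eq_sum_sq]
    exact hδ.trans (le_of_lt hg)
  have hcover : {ω : ((Fin n → ℝ) × (Fin n → ℝ)) × ((Fin m → ℝ) × (Fin m → ℝ)) | ∃ i, l i ≤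
      2 * a / √m * (vnorm (x i) * (p i ⬝ᵥ ω.1.1) + vnorm (p i) * (x i ⬝ᵥ ω.2.1))
      + 2 * b / √m * (vnorm (y i) * (q i ⬝ᵥ ω.1.2) + vnorm (q i) * (y i ⬝ᵥ ω.2.2))}
      ⊆ {ω | ω.1 ∈ {w | w.1 ∈ {g | m * (τ + ε / (16 * (α + β))) < g ⬝ᵥ g}}
            ∪ {w | w.2 ∈ {g | m * (τ + ε / (16 * (α + β))) < g ⬝ᵥ g}}} ∪
        {ω | ω.2 ∈ {w | ¬ (w.1 ⬝ᵥ w.1 < m * (1 + ε / 8) ∧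
          w.2 ⬝ᵥ w.2 < m * (1 + ε / 8) ∧ |w.1 ⬝ᵥ w.2| < m * (ε / 8))}} := by
    rintro ω ⟨i, hi⟩
    by_contra hcon
    simp only [mem_union, mem_ofPred_eq, not_or, not_not] at hcon
    obtain ⟨⟨c1, c2⟩, b1, b2, b3⟩ := hcon
    exact absurd hi (not_le.2 (wishart_deterministic hm hα hβ h0 h1 hε0 i.2 (not_lt.1 c1)
      (not_lt.1 c2) b1 b2 b3))
  -- The comparison factor `4` multiplies two norm events for the `n`-vectors and the fivefold bound
  -- for the `m`-vectors.
  have hfin : 4 * (e₁ + e₁ + 5 * e₂) = ENNReal.ofReal 8 * e₁ + ENNReal.ofReal 20 * e₂ := by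
    have e8 : ENNReal.ofReal 8 = 8 := by simp
    have e20 : ENNReal.ofReal 20 = 20 := by simp
    rw [e8, e20]
    ring
  rw [← hfin]
  refine mul_le_mul_right ((measure_mono hcover).trans ((measure_union_le _ _).trans ?_)) 4
  refine add_le_add ?_ ?_
  · rw [prod_measure_fst_preimage]
    refine (measure_union_le _ _).trans (add_le_add ?_ ?_)
    · rw [prod_measure_fst_preimage]
      exact hT
    · rw [prod_measure_snd_preimage]
      exact hT
  · rw [prod_measure_snd_preimage]
    exact hbad

/-! ### The canonical correlation model -/

theorem dotProduct_transpose_mulVec {n m : ℕ} (U : Matrix (Fin n) (Fin m) ℝ) (r : Fin n → ℝ)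
    (x : Fin m → ℝ) : (Uᵀ *ᵥ r) ⬝ᵥ x = r ⬝ᵥ U *ᵥ x := by
  rw [Matrix.mulVec_transpose, ← Matrix.dotProduct_mulVec]

/-- The quadratic form of the canonical correlation matrix in terms of `L = (1 - κ²) / κ`: adding
any vector `r` yields an upper bound. -/
theorem cca_form_le {n m : ℕ} {κ L : ℝ} (hκ : 0 < κ) (hL : L * κ = 1 - κ ^ 2) (hL0 : 0 ≤ L)
    (U : Matrix (Fin n) (Fin m) ℝ) (x : Fin m → ℝ) (v r : Fin n → ℝ) :
    2 * ((U *ᵥ x) ⬝ᵥ v) - κ * ((U *ᵥ x) ⬝ᵥ (U *ᵥ x)) - κ * (v ⬝ᵥ v) - L * (x ⬝ᵥ x)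
      ≤ L * (v ⬝ᵥ v) - 2 * L * (r ⬝ᵥ v) + L * (r ⬝ᵥ r)
        + κ ^ 2 * L * ((Uᵀ *ᵥ r) ⬝ᵥ (Uᵀ *ᵥ r) - r ⬝ᵥ r) := by
  set u := U *ᵥ x with hu
  -- The right side minus the left side is the sum `L|x - κUᵀr|² + κ⁻¹|v - κu - κLr|²`. The identity
  -- `κ⁻¹ = L + κ`, equivalent to the formula for the threshold, makes the coefficients match.
  have s1 := mul_nonneg hL0 (dotProduct_self_nonneg_real (x - κ • (Uᵀ *ᵥ r)))
  have s2 := mul_nonneg (inv_nonneg.2 hκ.le)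
    (dotProduct_self_nonneg_real (v - κ • u - (κ * L) • r))
  simp only [sub_dotProduct, dotProduct_sub, smul_dotProduct, dotProduct_smul, smul_eq_mul] at s1 s2
  rw [dotProduct_comm x (Uᵀ *ᵥ r), dotProduct_transpose_mulVec, ← hu] at s1
  rw [dotProduct_comm v u, dotProduct_comm v r, dotProduct_comm u r] at s2
  have e : κ⁻¹ * (v ⬝ᵥ v - κ * u ⬝ᵥ v - κ * L * r ⬝ᵥ v
        - κ * (u ⬝ᵥ v - κ * u ⬝ᵥ u - κ * L * r ⬝ᵥ u)
        - κ * L * (r ⬝ᵥ v - κ * r ⬝ᵥ u - κ * L * r ⬝ᵥ r))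
      = κ⁻¹ * (v ⬝ᵥ v) - 2 * (u ⬝ᵥ v) - 2 * L * (r ⬝ᵥ v) + κ * (u ⬝ᵥ u)
        + 2 * κ * L * (r ⬝ᵥ u) + κ * L ^ 2 * (r ⬝ᵥ r) := by
    field_simp
    ring
  have e2 : κ⁻¹ = L + κ := by
    field_simp
    linarith
  have e3 : κ * L ^ 2 = L * (1 - κ ^ 2) := by rw [← hL]; ring
  have s2' : 0 ≤ κ⁻¹ * (v ⬝ᵥ v) - 2 * (u ⬝ᵥ v) - 2 * L * (r ⬝ᵥ v) + κ * (u ⬝ᵥ u)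
        + 2 * κ * L * (r ⬝ᵥ u) + κ * L ^ 2 * (r ⬝ᵥ r) := by
    rw [← e]
    refine s2.trans (le_of_eq ?_)
    ring
  rw [e2, e3] at s2'
  linarith

/-- Strictness uses up half of the `ε` margin. The other half is retained on `y` alone, because `x`
will be eliminated exactly and only `y` survives in the comparison. -/
theorem cca_exists_of_le_lambdaMax {n m k : ℕ} {κ L ε : ℝ} (hL0 : 0 ≤ L) (hε : 0 < ε)
    {U : Matrix (Fin n) (Fin m) ℝ} {V : Matrix (Fin n) (Fin k) ℝ}
    (h : L + ε ≤ lambdaMax (ccaW κ U V)) :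
    ∃ (x : Fin m → ℝ) (y : Fin k → ℝ), L * (x ⬝ᵥ x) + (L + ε / 2) * (y ⬝ᵥ y)
      < 2 * ((U *ᵥ x) ⬝ᵥ (V *ᵥ y)) - κ * ((U *ᵥ x) ⬝ᵥ (U *ᵥ x))
        - κ * ((V *ᵥ y) ⬝ᵥ (V *ᵥ y)) := by
  obtain ⟨w, hw, hW⟩ := exists_eigenvector_lambdaMax ((by linarith : (0 : ℝ) < L + ε).trans_le h).ne'
  set Λ := lambdaMax (ccaW κ U V) with hΛ
  obtain ⟨x, y, rfl⟩ : ∃ x y, w = Sum.elim x y :=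
    ⟨w ∘ Sum.inl, w ∘ Sum.inr, (Sum.elim_comp_inl_inr w).symm⟩
  have hpos : 0 < x ⬝ᵥ x + y ⬝ᵥ y := by
    by_cases hx : x = 0
    · have hy : y ≠ 0 := fun hy => hw (by ext i; cases i <;> simp [hx, hy])
      exact add_pos_of_nonneg_of_pos (dotProduct_self_nonneg_real x) (dotProduct_self_pos hy)
    · exact add_pos_of_pos_of_nonneg (dotProduct_self_pos hx) (dotProduct_self_nonneg_real y)
  refine ⟨x, y, ?_⟩
  rw [ccaW, Matrix.fromBlocks_mulVec] at hW
  have e1 : -κ • (Uᵀ *ᵥ (U *ᵥ x)) + Uᵀ *ᵥ (V *ᵥ y) = Λ • x := by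
    ext i
    have := congrFun hW (Sum.inl i)
    simpa [Matrix.neg_mulVec, Matrix.smul_mulVec, Matrix.mulVec_mulVec] using this
  have e2 : Vᵀ *ᵥ (U *ᵥ x) + -κ • (Vᵀ *ᵥ (V *ᵥ y)) = Λ • y := by
    ext i
    have := congrFun hW (Sum.inr i)
    simpa [Matrix.neg_mulVec, Matrix.smul_mulVec, Matrix.mulVec_mulVec] using this
  have f1 := congrArg (fun z => z ⬝ᵥ x) e1
  have f2 := congrArg (fun z => z ⬝ᵥ y) e2
  simp only [add_dotProduct, smul_dotProduct, smul_eq_mul, dotProduct_transpose_mulVec] at f1 f2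
  rw [dotProduct_comm (V *ᵥ y) (U *ᵥ x)] at f1
  have hx := dotProduct_self_nonneg_real x
  have hy := dotProduct_self_nonneg_real y
  have h1 := mul_le_mul_of_nonneg_right h hpos.le
  nlinarith

/-- Optimizing the comparison process over `r`. -/
theorem cca_deterministic {n m k : ℕ} (hk : 0 < k) {κ L η : ℝ} (hL0 : 0 < L)
    (U : Matrix (Fin n) (Fin m) ℝ) {y h : Fin k → ℝ} {p g : Fin n → ℝ} (hy : y ≠ 0)
    (H : ∀ r : Fin n → ℝ, (p ⬝ᵥ p) / L - L * (r ⬝ᵥ r)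
        - κ ^ 2 * L * ((Uᵀ *ᵥ r) ⬝ᵥ (Uᵀ *ᵥ r) - r ⬝ᵥ r) + (L + η) * (y ⬝ᵥ y)
      ≤ 2 / √k * (vnorm y * ((p - L • r) ⬝ᵥ g) + vnorm (p - L • r) * (y ⬝ᵥ h))) :
    k * (L + η) ≤ L * (h ⬝ᵥ h) + κ ^ 2 * L * ((Uᵀ *ᵥ g) ⬝ᵥ (Uᵀ *ᵥ g) - g ⬝ᵥ g) := by
  have hk' : (0 : ℝ) < k := by exact_mod_cast hk
  have hs0 : 0 < √(k : ℝ) := Real.sqrt_pos.2 hk'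
  set s := (√(k : ℝ))⁻¹ with hs
  have hs2 : s ^ 2 = (k : ℝ)⁻¹ := by rw [hs, inv_pow, Real.sq_sqrt hk'.le]
  have hspos : 0 < s := inv_pos.2 hs0
  set Y := vnorm y with hY
  have hY2 : Y ^ 2 = y ⬝ᵥ y := vnorm_sq y
  have hYY : 0 < Y ^ 2 := by rw [hY2]; exact dotProduct_self_pos hy
  -- The choice `r = (|y|/√k) g` cancels every term linear or quadratic in `g` except those
  -- multiplied by `κ²L`; what is left in `w = p - Lr` is absorbed by completing a square.
  have hr := H ((Y * s) • g)
  set w := p - L • ((Y * s) • g) with hw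
  have hp : p = w + L • ((Y * s) • g) := by rw [hw]; abel
  have hpp : p ⬝ᵥ p = w ⬝ᵥ w + 2 * L * (Y * s) * (w ⬝ᵥ g) + (L * (Y * s)) ^ 2 * (g ⬝ᵥ g) := by
    rw [hp]
    simp only [add_dotProduct, dotProduct_add, smul_dotProduct, dotProduct_smul, smul_eq_mul]
    rw [dotProduct_comm g w]
    ring
  rw [Matrix.mulVec_smul] at hr
  simp only [smul_dotProduct, dotProduct_smul, smul_eq_mul] at hr
  have e1 : (p ⬝ᵥ p) / L = (w ⬝ᵥ w) / L + 2 * (Y * s) * (w ⬝ᵥ g)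
      + L * (Y * s) ^ 2 * (g ⬝ᵥ g) := by
    rw [hpp]
    field_simp
  have e2 : 2 / √(k : ℝ) = 2 * s := by rw [hs]; ring
  rw [e1, e2, ← hY2] at hr
  have b1 : vnorm w * (y ⬝ᵥ h) ≤ vnorm w * (Y * vnorm h) :=
    mul_le_mul_of_nonneg_left (dotProduct_le_vnorm_mul y h) (vnorm_nonneg w)
  have b2 : 2 * s * (vnorm w * (Y * vnorm h)) ≤ (w ⬝ᵥ w) / L + L * s ^ 2 * Y ^ 2 * (h ⬝ᵥ h) := by
    have e := mul_nonneg (inv_nonneg.2 hL0.le) (sq_nonneg (vnorm w - L * s * Y * vnorm h))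
    have e3 : L⁻¹ * (vnorm w - L * s * Y * vnorm h) ^ 2 = (vnorm w ^ 2) / L
        - 2 * s * (vnorm w * (Y * vnorm h)) + L * s ^ 2 * Y ^ 2 * vnorm h ^ 2 := by
      field_simp
      ring
    rw [e3, vnorm_sq w, vnorm_sq h] at e
    linarith
  have b3 := mul_le_mul_of_nonneg_left b1 (by positivity : 0 ≤ 2 * s)
  set A := (Uᵀ *ᵥ g) ⬝ᵥ (Uᵀ *ᵥ g) with hA
  have b4 : Y ^ 2 * (L + η) ≤ Y ^ 2 * (s ^ 2 * (L * (h ⬝ᵥ h) + κ ^ 2 * L * (A - g ⬝ᵥ g))) := by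
    linarith
  have b5 := le_of_mul_le_mul_left b4 hYY
  rw [hs2, inv_mul_eq_div, le_div_iff₀ hk'] at b5
  linarith

/-- With `U` frozen, the outer index is `(y, p)`, where `p` linearizes `L|Vy|²`, and the inner index
is the dual vector `r` that eliminated `x`. The Gaussian matrix acts on `y` alone, a function of the
outer index, as Gordon's inequality demands. -/
theorem cca_section_le {n m k : ℕ} (hk : 0 < k) {κ L ε : ℝ} (hκ : 0 < κ)
    (hL : L * κ = 1 - κ ^ 2) (hL0 : 0 < L) (U : Matrix (Fin n) (Fin m) ℝ) :
    gaussianMatrixLaw n k (1 / k) {G | ∃ (x : Fin m → ℝ) (y : Fin k → ℝ),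
      L * (x ⬝ᵥ x) + (L + ε / 2) * (y ⬝ᵥ y) < 2 * ((U *ᵥ x) ⬝ᵥ (Matrix.of G *ᵥ y))
        - κ * ((U *ᵥ x) ⬝ᵥ (U *ᵥ x)) - κ * ((Matrix.of G *ᵥ y) ⬝ᵥ (Matrix.of G *ᵥ y))}
      ≤ 2 * ((stdGaussianVec n).prod (stdGaussianVec k)) {ω | k * (L + ε / 2)
        ≤ L * (ω.2 ⬝ᵥ ω.2) + κ ^ 2 * L * ((Uᵀ *ᵥ ω.1) ⬝ᵥ (Uᵀ *ᵥ ω.1) - ω.1 ⬝ᵥ ω.1)} := by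
  let E := (Fin k → ℝ) × (Fin n → ℝ)
  let D : ℕ → E := TopologicalSpace.denseSeq E
  let R : ℕ → (Fin n → ℝ) := TopologicalSpace.denseSeq (Fin n → ℝ)
  let I := {j : ℕ // (D j).1 ≠ 0}
  let y : I → Fin k → ℝ := fun i => (D i).1
  let p : I → Fin n → ℝ := fun i => (D i).2
  let l : (Fin k → ℝ) → (Fin n → ℝ) → (Fin n → ℝ) → ℝ := fun y p r => (p ⬝ᵥ p) / L - L * (r ⬝ᵥ r)
    - κ ^ 2 * L * ((Uᵀ *ᵥ r) ⬝ᵥ (Uᵀ *ᵥ r) - r ⬝ᵥ r) + (L + ε / 2) * (y ⬝ᵥ y)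
  have hG := gaussianMatrixLaw_gordon (I := I) (J := ℕ) n k hk 2 (by norm_num)
    (fun t => p t.1 - L • R t.2) y fun t => l (y t.1) (p t.1) (R t.2)
  refine (measure_mono ?_).trans (hG.trans (mul_le_mul_right (measure_mono ?_) 2))
  · rintro G ⟨x', y', h⟩
    let F : E → ℝ := fun e => 2 * (e.2 ⬝ᵥ (Matrix.of G *ᵥ e.1)) - (e.2 ⬝ᵥ e.2) / L
      - (L + ε / 2) * (e.1 ⬝ᵥ e.1) + (2 * ((U *ᵥ x') ⬝ᵥ (Matrix.of G *ᵥ e.1))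
      - κ * ((U *ᵥ x') ⬝ᵥ (U *ᵥ x')) - κ * ((Matrix.of G *ᵥ e.1) ⬝ᵥ (Matrix.of G *ᵥ e.1))
      - L * (x' ⬝ᵥ x')) - L * ((Matrix.of G *ᵥ e.1) ⬝ᵥ (Matrix.of G *ᵥ e.1))
    have hF : Continuous F := by
      unfold F E dotProduct Matrix.mulVec dotProduct
      fun_prop
    -- `p = LVy` is the maximizer of `2⟨p, Vy⟩ - |p|²/L`; there the added and subtracted `L|Vy|²`
    -- cancel and the hypothesis is recovered.
    have hpos : 0 < F (y', L • (Matrix.of G *ᵥ y')) := by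
      simp only [F, smul_dotProduct, dotProduct_smul, smul_eq_mul]
      have e : ∀ q : ℝ, L * (L * q) / L = L * q := fun q => by field_simp
      rw [e]
      linarith
    obtain ⟨j, hj⟩ := exists_denseSeq_pos hF hpos
    have hj' : 0 < F (D j) := hj
    have hj0 : (D j).1 ≠ 0 := by
      intro h0
      have hz : F (D j) = -(((D j).2 ⬝ᵥ (D j).2) / L + κ * ((U *ᵥ x') ⬝ᵥ (U *ᵥ x'))
          + L * (x' ⬝ᵥ x')) := by
        simp [F, h0]
        ring
      rw [hz] at hj'
      have c1 := div_nonneg (dotProduct_self_nonneg_real (D j).2) hL0.le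
      have c2 := mul_nonneg hκ.le (dotProduct_self_nonneg_real (U *ᵥ x'))
      have c3 := mul_nonneg hL0.le (dotProduct_self_nonneg_real x')
      linarith
    refine ⟨⟨j, hj0⟩, fun j' => ?_⟩
    have key := cca_form_le hκ hL hL0.le U x' (Matrix.of G *ᵥ (D j).1) (R j')
    simp only [F] at hj'
    simp only [l, y, p, sub_dotProduct, smul_dotProduct, smul_eq_mul]
    linarith
  · rintro ω ⟨i, hi⟩
    refine cca_deterministic hk hL0 U i.2 (p := p i) fun r => ?_
    have hc1 : Continuous fun r => l (y i) (p i) r := by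
      unfold l dotProduct Matrix.mulVec dotProduct
      fun_prop
    have hc2 : Continuous fun r : Fin n → ℝ => 2 / √(k : ℝ) *
        (vnorm (y i) * ((p i - L • r) ⬝ᵥ ω.1) + vnorm (p i - L • r) * (y i ⬝ᵥ ω.2)) := by
      have hv : Continuous fun r : Fin n → ℝ => vnorm (p i - L • r) :=
        continuous_vnorm.comp (by fun_prop)
      have hd : Continuous fun r : Fin n → ℝ => (p i - L • r) ⬝ᵥ ω.1 := by
        unfold dotProduct
        fun_prop
      fun_prop
    have hcl : IsClosed {r : Fin n → ℝ | l (y i) (p i) r ≤ 2 / √(k : ℝ) *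
        (vnorm (y i) * ((p i - L • r) ⬝ᵥ ω.1) + vnorm (p i - L • r) * (y i ⬝ᵥ ω.2))} :=
      isClosed_le hc1 hc2
    -- The comparison only supplies countably many `r`; both sides are continuous in `r`, so the
    -- inequality passes to the particular `r` needed afterwards.
    have hd : DenseRange R := TopologicalSpace.denseRange_denseSeq _
    exact hd.induction_on (p := fun r => l (y i) (p i) r ≤ 2 / √(k : ℝ) *
        (vnorm (y i) * ((p i - L • r) ⬝ᵥ ω.1) + vnorm (p i - L • r) * (y i ⬝ᵥ ω.2)))
      r hcl hi

theorem cca_tail {n m k : ℕ} (hm : 0 < m) (hk : 0 < k) {κ L ε δ δ' : ℝ} (hκ : 0 < κ) (hκ1 : κ < 1)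
    (hL : L * κ = 1 - κ ^ 2) (hε : 0 < ε) (hδ : δ ∈ Icc (0 : ℝ) 1) (hδ' : δ' ∈ Icc (0 : ℝ) 1)
    (h₁ : L * δ ≤ ε / 4) (h₂ : δ' * (n * (1 + 1)) ≤ k * (ε / 4)) :
    ccaNull n m k {p | L + ε ≤ lambdaMax (ccaW κ (Matrix.of p.1) (Matrix.of p.2))}
      ≤ 2 * (ENNReal.ofReal (Real.exp (-(k * δ ^ 2 / 8))) +
        (ENNReal.ofReal (Real.exp (-(n * 1 ^ 2 / 8))) +
          ENNReal.ofReal (Real.exp (-(m * δ' ^ 2 / 8))))) := by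
  have hk' : (0 : ℝ) < k := by exact_mod_cast hk
  have hL0 : 0 < L := by
    have e : L = (1 - κ ^ 2) / κ := by
      field_simp
      linarith
    rw [e]
    exact div_pos (by nlinarith) hκ
  let E := (Fin m → ℝ) × (Fin k → ℝ)
  let D : ℕ → E := TopologicalSpace.denseSeq E
  let Φ : (Fin n → Fin m → ℝ) × (Fin n → Fin k → ℝ) → E → ℝ := fun w e =>
    2 * ((Matrix.of w.1 *ᵥ e.1) ⬝ᵥ (Matrix.of w.2 *ᵥ e.2))
      - κ * ((Matrix.of w.1 *ᵥ e.1) ⬝ᵥ (Matrix.of w.1 *ᵥ e.1))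
      - κ * ((Matrix.of w.2 *ᵥ e.2) ⬝ᵥ (Matrix.of w.2 *ᵥ e.2))
      - (L * (e.1 ⬝ᵥ e.1) + (L + ε / 2) * (e.2 ⬝ᵥ e.2))
  let S : Set ((Fin n → Fin m → ℝ) × (Fin n → Fin k → ℝ)) := {w | ∃ j, 0 < Φ w (D j)}
  have hS : MeasurableSet S := by
    have : S = ⋃ j, {w | 0 < Φ w (D j)} := by
      ext w
      simp [S]
    rw [this]
    refine MeasurableSet.iUnion fun j => measurableSet_lt measurable_const ?_
    simp only [Φ, dotProduct, Matrix.mulVec, Matrix.of_apply]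
    fun_prop
  have hsub : {p : (Fin n → Fin m → ℝ) × (Fin n → Fin k → ℝ) | L + ε ≤
      lambdaMax (ccaW κ (Matrix.of p.1) (Matrix.of p.2))} ⊆ S := by
    intro w hw
    obtain ⟨x, y, hxy⟩ := cca_exists_of_le_lambdaMax hL0.le hε hw
    have hF : Continuous (Φ w) := by
      unfold Φ E dotProduct Matrix.mulVec dotProduct
      fun_prop
    obtain ⟨j, hj⟩ := exists_denseSeq_pos hF (e := (x, y)) (sub_pos.2 hxy)
    exact ⟨j, hj⟩
  refine (measure_mono hsub).trans ?_
  let B : Set ((Fin n → Fin m → ℝ) × ((Fin n → ℝ) × (Fin k → ℝ))) := {w | k * (L + ε / 2)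
    ≤ L * (w.2.2 ⬝ᵥ w.2.2) + κ ^ 2 * L * (((Matrix.of w.1)ᵀ *ᵥ w.2.1) ⬝ᵥ
      ((Matrix.of w.1)ᵀ *ᵥ w.2.1) - w.2.1 ⬝ᵥ w.2.1)}
  have hB : MeasurableSet B := by
    refine measurableSet_le measurable_const ?_
    simp only [dotProduct, Matrix.mulVec, Matrix.of_apply, Matrix.transpose_apply]
    fun_prop
  have step : ccaNull n m k S ≤ 2 * (gaussianMatrixLaw n m (1 / m)).prod
      ((stdGaussianVec n).prod (stdGaussianVec k)) B := by
    rw [ccaNull, Measure.prod_apply hS, Measure.prod_apply hB,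
      ← lintegral_const_mul _ (measurable_measure_prodMk_left hB)]
    refine lintegral_mono fun U => ?_
    refine (measure_mono ?_).trans (cca_section_le hk hκ hL hL0 (Matrix.of U))
    rintro G ⟨j, hj⟩
    exact ⟨(D j).1, (D j).2, sub_pos.1 hj⟩
  refine step.trans (mul_le_mul_right ?_ 2)
  let B' : Set ((Fin n → Fin m → ℝ) × ((Fin n → ℝ) × (Fin k → ℝ))) :=
    {w | w.2.1 ⬝ᵥ w.2.1 < n * (1 + 1) ∧ w.2.1 ⬝ᵥ w.2.1 + k * (ε / 4)
      ≤ ∑ j, (∑ i, w.1 i j * w.2.1 i) ^ 2}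
  have hB' : MeasurableSet B' := by
    have m1 : MeasurableSet {w : (Fin n → Fin m → ℝ) × ((Fin n → ℝ) × (Fin k → ℝ)) |
        w.2.1 ⬝ᵥ w.2.1 < n * (1 + 1)} := by
      refine measurableSet_lt ?_ measurable_const
      simp only [dotProduct]
      fun_prop
    have m2 : MeasurableSet {w : (Fin n → Fin m → ℝ) × ((Fin n → ℝ) × (Fin k → ℝ)) |
        w.2.1 ⬝ᵥ w.2.1 + k * (ε / 4) ≤ ∑ j, (∑ i, w.1 i j * w.2.1 i) ^ 2} := by
      refine measurableSet_le ?_ (by fun_prop)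
      simp only [dotProduct]
      fun_prop
    exact m1.inter m2
  -- Half of the margin `ε/2` is charged to `|h|²` exceeding `k` and half to `|Uᵀg|²` exceeding
  -- `|g|²`, using `κ²L = κ(1 - κ²) ≤ 1`. The cap `|g|² < 2n` turns a relative deviation `δ'` into
  -- an absolute one.
  have hcover : B ⊆ {w | w.2 ∈ {q | q.2 ∈ {h | k * (1 + δ) ≤ ∑ i, h i ^ 2}}} ∪
      ({w | w.2 ∈ {q | q.1 ∈ {g | n * (1 + 1 : ℝ) ≤ ∑ i, g i ^ 2}}} ∪ B') := by
    rintro ⟨U, g, h⟩ hw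
    simp only [B, B', mem_union, mem_ofPred_eq] at hw ⊢
    by_contra hcon
    simp only [not_or, not_and, not_le] at hcon
    obtain ⟨c1, c2, c3⟩ := hcon
    rw [← dotProduct_self_eq_sum_sq] at c1 c2
    have c3 := c3 c2
    have e : ((Matrix.of U)ᵀ *ᵥ g) ⬝ᵥ ((Matrix.of U)ᵀ *ᵥ g) = ∑ j, (∑ i, U i j * g i) ^ 2 := by
      rw [dotProduct_self_eq_sum_sq]
      rfl
    rw [e] at hw
    have c4 : L * (h ⬝ᵥ h) < k * (L + ε / 4) := by
      have d1 := mul_lt_mul_of_pos_left c1 hL0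
      have d2 := mul_le_mul_of_nonneg_left h₁ hk'.le
      linarith
    have c5 : κ ^ 2 * L * (∑ j, (∑ i, U i j * g i) ^ 2 - g ⬝ᵥ g) < k * (ε / 4) := by
      have hq : κ ^ 2 * L ≤ 1 := by
        have : κ ^ 2 * L = κ * (1 - κ ^ 2) := by rw [← hL]; ring
        rw [this]
        nlinarith
      have hq0 : 0 < κ ^ 2 * L := by positivity
      calc κ ^ 2 * L * (∑ j, (∑ i, U i j * g i) ^ 2 - g ⬝ᵥ g)
          < κ ^ 2 * L * (k * (ε / 4)) := mul_lt_mul_of_pos_left (by linarith) hq0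
        _ ≤ 1 * (k * (ε / 4)) := mul_le_mul_of_nonneg_right hq (by positivity)
        _ = _ := one_mul _
    linarith
  have htail : (gaussianMatrixLaw n m (1 / m)).prod ((stdGaussianVec n).prod (stdGaussianVec k)) B'
      ≤ ENNReal.ofReal (Real.exp (-(m * δ' ^ 2 / 8))) := by
    rw [Measure.prod_apply_symm hB']
    refine (lintegral_mono (g := fun _ => ENNReal.ofReal (Real.exp (-(m * δ' ^ 2 / 8))))
      fun q => ?_).trans (by simp)
    obtain ⟨g, h⟩ := q
    -- The tail bound for `|Uᵀg|²` normalizes by `|g|²`. For `g = 0` the event is empty because of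
    -- the positive term `kε/4`.
    by_cases hg0 : g = 0
    · have : (fun x => (x, ((g, h) : (Fin n → ℝ) × (Fin k → ℝ)))) ⁻¹' B' = ∅ := by
        ext U
        simp only [B', hg0, mem_preimage, mem_ofPred_eq, mem_empty_iff_false, iff_false, not_and,
          not_le]
        intro _
        simp
        positivity
      rw [this]
      simp
    · have hgp : 0 < ∑ i, g i ^ 2 := by
        rw [← dotProduct_self_eq_sum_sq]
        exact dotProduct_self_pos hg0
      refine (measure_mono ?_).trans
        (gaussianMatrixLaw_transpose_tail n m hm g hgp hδ'.1 hδ'.2)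
      rintro U ⟨b1, b2⟩
      simp only at b1 b2
      rw [mem_ofPred_eq, ← dotProduct_self_eq_sum_sq]
      refine le_trans ?_ b2
      have := mul_le_mul_of_nonneg_left b1.le hδ'.1
      linarith
  refine (measure_mono hcover).trans ((measure_union_le _ _).trans (add_le_add ?_
    ((measure_union_le _ _).trans (add_le_add ?_ htail))))
  · rw [prod_measure_snd_preimage, prod_measure_snd_preimage]
    exact stdGaussianVec_sum_sq_tail k hδ.1 hδ.2
  · rw [prod_measure_snd_preimage, prod_measure_fst_preimage]
    exact stdGaussianVec_sum_sq_tail n zero_le_one le_rfl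

/-! ### Choice of constants -/

theorem spikedKappa_nonneg {α β τ : ℝ} (hα : τ * α ^ 2 ≤ 1) (hβ : τ * β ^ 2 ≤ 1) :
    0 ≤ spikedKappa α β τ := by
  refine Real.rpow_nonneg (div_nonneg (mul_nonneg (by linarith) (by linarith)) ?_) _
  positivity

/-- If `n / m → τ > 0` and `n → ∞`, then eventually `m` is positive and `n ≤ 2 τ m`. -/
theorem eventually_le_two_mul {n m : ℕ → ℕ} {τ : ℝ} (hτ : 0 < τ)
    (h : Tendsto (fun j => (n j : ℝ) / (m j : ℝ)) atTop (𝓝 τ)) :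
    ∀ᶠ j in atTop, 0 < m j ∧ (n j : ℝ) ≤ 2 * τ * m j := by
  filter_upwards [h.eventually (lt_mem_nhds hτ), h.eventually (gt_mem_nhds
    (by linarith : τ < 2 * τ))] with j h1 h2
  have hm : 0 < m j := by
    rcases Nat.eq_zero_or_pos (m j) with h0 | h0
    · rw [h0] at h1
      simp at h1
    · exact h0
  have hm' : (0 : ℝ) < m j := by exact_mod_cast hm
  exact ⟨hm, ((div_lt_iff₀ hm').1 h2).le⟩

theorem cca_bound {τm τk : ℝ} (hτm : 0 < τm) (hτk : 0 < τk) (hκ1 : ccaKappa τm τk < 1) :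
    ∃ c > (0 : ℝ), ∃ C > (0 : ℝ), ∀ n m k : ℕ → ℕ,
      Tendsto (fun j => (n j : ℝ) / (m j : ℝ)) atTop (𝓝 τm) →
      Tendsto (fun j => (n j : ℝ) / (k j : ℝ)) atTop (𝓝 τk) →
      ∀ᶠ j in atTop, ∀ ε ∈ Ioo (0 : ℝ) 1, C ≤ (n j : ℝ) * ε ^ 2 →
        ccaNull (n j) (m j) (k j)
            {p | (1 - ccaKappa τm τk ^ 2) / ccaKappa τm τk + ε ≤
              lambdaMax (ccaW (ccaKappa τm τk) (Matrix.of p.1) (Matrix.of p.2))}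
          ≤ ENNReal.ofReal (Real.exp (-(c * (n j : ℝ) * ε ^ 2))) := by
  have hκ : 0 < ccaKappa τm τk := Real.rpow_pos_of_pos (mul_pos hτm hτk) _
  set κ := ccaKappa τm τk
  set L := (1 - κ ^ 2) / κ with hLdef
  have hL : L * κ = 1 - κ ^ 2 := div_mul_cancel₀ _ hκ.ne'
  have hL0 : 0 < L := div_pos (by nlinarith) hκ
  -- The deviations are `δ = εd` and `δ' = εd'`: the caps give `Lδ ≤ ε/4` and, through `n ≤ 2τk·k`,
  -- the bound `2nδ' ≤ kε/4`.
  set d := min 1 (1 / (4 * L)) with hd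
  set d' := min 1 (1 / (16 * τk)) with hd'
  have d0 : 0 < d := lt_min one_pos (by positivity)
  have d0' : 0 < d' := lt_min one_pos (by positivity)
  set c₁ := d ^ 2 / (16 * τk) with hc₁
  set c₂ := d' ^ 2 / (16 * τm) with hc₂
  set c₀ := min c₁ (min (1 / 8) c₂) with hc₀
  have c₀pos : 0 < c₀ := lt_min (by positivity) (lt_min (by norm_num) (by positivity))
  have hlog : 0 < Real.log 6 := Real.log_pos (by norm_num)
  -- Half of the exponent is given up to absorb the prefactor `6`; `C` ensures that this half is at
  -- least `log 6`.
  refine ⟨c₀ / 2, by positivity, 2 * Real.log 6 / c₀, by positivity, fun n m k hm hk => ?_⟩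
  filter_upwards [eventually_le_two_mul hτm hm, eventually_le_two_mul hτk hk]
    with j ⟨hmj, hnm⟩ ⟨hkj, hnk⟩ ε hε hC
  have hε0 := hε.1
  have hn0 : (0 : ℝ) ≤ n j := Nat.cast_nonneg _
  have hmem : ∀ t, 0 < t → t ≤ 1 → ε * t ∈ Icc (0 : ℝ) 1 := fun t ht ht1 =>
    ⟨by positivity, mul_le_one₀ hε.2.le ht.le ht1⟩
  have hb := cca_tail (n := n j) hmj hkj hκ hκ1 hL hε0 (hmem d d0 (min_le_left _ _))
    (hmem d' d0' (min_le_left _ _)) (by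
      have : d ≤ 1 / (4 * L) := min_le_right _ _
      rw [le_div_iff₀ (by positivity)] at this
      nlinarith) (by
      have : d' ≤ 1 / (16 * τk) := min_le_right _ _
      rw [le_div_iff₀ (by positivity)] at this
      have h1 : d' * n j ≤ d' * (2 * τk * k j) := mul_le_mul_of_nonneg_left hnk d0'.le
      have hk0 : (0 : ℝ) ≤ k j := Nat.cast_nonneg _
      have h2 : d' * (16 * τk) * k j ≤ 1 * k j := mul_le_mul_of_nonneg_right this hk0
      have h3 : d' * (n j * (1 + 1)) ≤ k j / 4 := by linarith
      calc ε * d' * (n j * (1 + 1)) = ε * (d' * (n j * (1 + 1))) := by ring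
        _ ≤ ε * (k j / 4) := mul_le_mul_of_nonneg_left h3 hε0.le
        _ = _ := by ring)
  refine hb.trans ?_
  have hx : 0 ≤ (n j : ℝ) * ε ^ 2 := by positivity
  have t1 : c₀ * (n j * ε ^ 2) ≤ k j * (ε * d) ^ 2 / 8 := by
    refine (mul_le_mul_of_nonneg_right (min_le_left _ _ : c₀ ≤ c₁) hx).trans ?_
    rw [hc₁, div_mul_eq_mul_div, div_le_iff₀ (by positivity)]
    have := mul_le_mul_of_nonneg_left hnk (by positivity : 0 ≤ d ^ 2 * ε ^ 2)
    linarith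
  have t2 : c₀ * (n j * ε ^ 2) ≤ n j * 1 ^ 2 / 8 := by
    refine (mul_le_mul_of_nonneg_right
      ((min_le_right _ _).trans (min_le_left _ _) : c₀ ≤ 1 / 8) hx).trans ?_
    have : ε ^ 2 ≤ 1 := by nlinarith [hε.2]
    have := mul_le_mul_of_nonneg_left this hn0
    linarith
  have t3 : c₀ * (n j * ε ^ 2) ≤ m j * (ε * d') ^ 2 / 8 := by
    refine (mul_le_mul_of_nonneg_right
      ((min_le_right _ _).trans (min_le_right _ _) : c₀ ≤ c₂) hx).trans ?_
    rw [hc₂, div_mul_eq_mul_div, div_le_iff₀ (by positivity)]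
    have := mul_le_mul_of_nonneg_left hnm (by positivity : 0 ≤ d' ^ 2 * ε ^ 2)
    linarith
  have hexp : ∀ a, c₀ * (n j * ε ^ 2) ≤ a → ENNReal.ofReal (Real.exp (-a))
      ≤ ENNReal.ofReal (Real.exp (-(c₀ * (n j * ε ^ 2)))) := fun a ha =>
    ENNReal.ofReal_le_ofReal (Real.exp_le_exp.2 (neg_le_neg ha))
  refine (mul_le_mul_right (add_le_add (hexp _ t1) (add_le_add (hexp _ t2) (hexp _ t3))) 2).trans ?_
  have e6 : ∀ q : ℝ≥0∞, 2 * (q + (q + q)) = ENNReal.ofReal 6 * q := fun q => by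
    have : ENNReal.ofReal 6 = 6 := by simp
    rw [this]
    ring
  rw [e6]
  refine mul_ofReal_exp_le (by norm_num) ?_
  rw [div_le_iff₀ c₀pos] at hC
  linarith

theorem wigner_bound {α β : ℝ} (hα : α ∈ Ioo (0 : ℝ) 1) (hβ : β ∈ Ioo (0 : ℝ) 1)
    (hκ1 : spikedKappa α β 1 < 1) :
    ∃ c > (0 : ℝ), ∃ C > (0 : ℝ), ∀ n : ℕ, ∀ ε ∈ Ioo (0 : ℝ) 1, C ≤ (n : ℝ) * ε ^ 2 →
      wignerNull n {p | 1 + ε ≤ lambdaMax (wignerW α β (Matrix.of p.1) (Matrix.of p.2))}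
        ≤ ENNReal.ofReal (Real.exp (-(c * (n : ℝ) * ε ^ 2))) := by
  have hκ0 : 0 ≤ spikedKappa α β 1 := spikedKappa_nonneg (by nlinarith [hα.1, hα.2])
    (by nlinarith [hβ.1, hβ.2])
  have hlog : 0 < Real.log 20 := Real.log_pos (by norm_num)
  -- Half of the rate `1/512` pays for the prefactor `20`. Positivity of `C` also excludes `n = 0`.
  refine ⟨1 / 1024, by norm_num, 1024 * Real.log 20, by positivity, fun n ε hε hC => ?_⟩
  have hn : 0 < n := by
    rcases Nat.eq_zero_or_pos n with h0 | h0
    · subst h0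
      simp at hC
      linarith
    · exact h0
  refine (wigner_tail hn hα.1.le hβ.1.le hκ0 hκ1 hε).trans (mul_ofReal_exp_le (by norm_num) ?_)
  linarith

theorem wishart_bound {α β τ : ℝ} (hα : 0 < α) (hβ : 0 < β) (hτ : 0 < τ) (hα1 : α * √τ < 1)
    (hβ1 : β * √τ < 1) (hκ1 : spikedKappa α β τ < 1) :
    ∃ c > (0 : ℝ), ∀ n m : ℕ → ℕ, Tendsto n atTop atTop →
      Tendsto (fun j => (n j : ℝ) / (m j : ℝ)) atTop (𝓝 τ) →
      ∀ ε ∈ Ioo (0 : ℝ) 1, ∀ᶠ j in atTop, wishartNull (n j) (m j)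
          {p | 1 + ε ≤ lambdaMax (wishartW α β τ (Matrix.of p.1) (Matrix.of p.2))}
        ≤ ENNReal.ofReal (Real.exp (-(c * (n j : ℝ) * ε ^ 2))) := by
  have hsq : ∀ a, 0 < a → a * √τ < 1 → τ * a ^ 2 ≤ 1 := fun a ha h => by
    have h1 : (a * √τ) ^ 2 ≤ 1 := pow_le_one₀ (by positivity) h.le
    rw [mul_pow, Real.sq_sqrt hτ.le] at h1
    linarith
  have hκ0 := spikedKappa_nonneg (hsq α hα hα1) (hsq β hβ hβ1)
  -- With `η = ε/(16(α+β))`, this makes `εd ≤ η/(4τ)`, so that `n ≤ 2τm` bounds the fluctuation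
  -- `nεd` by `mη/2`.
  set d := min 1 (1 / (64 * τ * (α + β))) with hd
  have d0 : 0 < d := lt_min one_pos (by positivity)
  set c₀ := min (d ^ 2 / 8) (1 / (1024 * τ)) with hc₀
  have c₀pos : 0 < c₀ := lt_min (by positivity) (by positivity)
  refine ⟨c₀ / 2, by positivity, fun n m hn hnm ε hε => ?_⟩
  have hε0 := hε.1
  set η := ε / (16 * (α + β)) with hη
  have hη0 : 0 < η := by positivity
  have hbig : ∀ᶠ j in atTop, 2 * Real.log 28 / (c₀ * ε ^ 2) ≤ (n j : ℝ) :=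
    (tendsto_natCast_atTop_atTop.comp hn).eventually_ge_atTop _
  -- The other `η/2` covers the convergence of `n/m` to `τ`. This is where the starting point of the
  -- sequence depends on `ε`, and largeness of `n` then absorbs the prefactor `28 = 8 + 20`.
  filter_upwards [eventually_le_two_mul hτ hnm, hnm.eventually (gt_mem_nhds
    (by linarith : τ < τ + η / 2)), hbig] with j ⟨hmj, h2⟩ hlt hN
  have hm' : (0 : ℝ) < m j := by exact_mod_cast hmj
  have hn0 : (0 : ℝ) ≤ n j := Nat.cast_nonneg _
  rw [div_lt_iff₀ hm'] at hlt
  have hdη : ε * d ≤ η / (4 * τ) := by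
    have h : d ≤ 1 / (64 * τ * (α + β)) := min_le_right _ _
    refine (mul_le_mul_of_nonneg_left h hε0.le).trans (le_of_eq ?_)
    rw [hη]
    field_simp
    norm_num
  have hδ : n j * (1 + ε * d) ≤ m j * (τ + η) := by
    have h3 : n j * (ε * d) ≤ (2 * τ * m j) * (η / (4 * τ)) :=
      mul_le_mul h2 hdη (by positivity) (by positivity)
    have h4 : (2 * τ * m j) * (η / (4 * τ)) = m j * (η / 2) := by
      field_simp
      norm_num
    linarith
  refine (wishart_tail hmj hα hβ hκ0 hκ1 hε (by positivity)
    (mul_le_one₀ hε.2.le d0.le (min_le_left _ _)) hδ).trans ?_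
  have hx : 0 ≤ (n j : ℝ) * ε ^ 2 := by positivity
  have t1 : c₀ * (n j * ε ^ 2) ≤ n j * (ε * d) ^ 2 / 8 := by
    refine (mul_le_mul_of_nonneg_right (min_le_left _ _) hx).trans (le_of_eq ?_)
    ring
  have t2 : c₀ * (n j * ε ^ 2) ≤ m j * ε ^ 2 / 512 := by
    refine (mul_le_mul_of_nonneg_right (min_le_right _ _) hx).trans ?_
    rw [div_mul_eq_mul_div, div_le_iff₀ (by positivity)]
    have := mul_le_mul_of_nonneg_right h2 (sq_nonneg ε)
    linarith
  have hexp : ∀ a, c₀ * (n j * ε ^ 2) ≤ a → ENNReal.ofReal (Real.exp (-a))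
      ≤ ENNReal.ofReal (Real.exp (-(c₀ * (n j * ε ^ 2)))) := fun a ha =>
    ENNReal.ofReal_le_ofReal (Real.exp_le_exp.2 (neg_le_neg ha))
  refine (add_le_add (mul_le_mul_right (hexp _ t1) _) (mul_le_mul_right (hexp _ t2) _)).trans ?_
  rw [← add_mul, ← ENNReal.ofReal_add (by norm_num) (by norm_num)]
  refine mul_ofReal_exp_le (by norm_num) ?_
  rw [div_le_iff₀ (by positivity)] at hN
  norm_num
  linarith

theorem theorem3p2 :
    -- canonical correlation model
    (∀ τm τk : ℝ, 0 < τm → 0 < τk → ccaKappa τm τk < 1 →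
      ∃ c > (0 : ℝ), ∃ C > (0 : ℝ), ∀ n m k : ℕ → ℕ,
        Tendsto n atTop atTop →
        Tendsto (fun j => (n j : ℝ) / (m j : ℝ)) atTop (𝓝 τm) →
        Tendsto (fun j => (n j : ℝ) / (k j : ℝ)) atTop (𝓝 τk) →
        ∀ᶠ j in atTop, ∀ ε ∈ Ioo (0 : ℝ) 1, C ≤ (n j : ℝ) * ε ^ 2 →
          ccaNull (n j) (m j) (k j)
              {p | (1 - ccaKappa τm τk ^ 2) / ccaKappa τm τk + ε ≤
                lambdaMax (ccaW (ccaKappa τm τk) (Matrix.of p.1) (Matrix.of p.2))}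
            ≤ ENNReal.ofReal (Real.exp (-(c * (n j : ℝ) * ε ^ 2)))) ∧
    -- correlated spiked Wigner model
    (∀ α ∈ Ioo (0 : ℝ) 1, ∀ β ∈ Ioo (0 : ℝ) 1, spikedKappa α β 1 < 1 →
      ∃ c > (0 : ℝ), ∃ C > (0 : ℝ), ∀ n : ℕ, ∀ ε ∈ Ioo (0 : ℝ) 1, C ≤ (n : ℝ) * ε ^ 2 →
        wignerNull n
            {p | 1 + ε ≤ lambdaMax (wignerW α β (Matrix.of p.1) (Matrix.of p.2))}
          ≤ ENNReal.ofReal (Real.exp (-(c * (n : ℝ) * ε ^ 2)))) ∧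
    -- correlated spiked Wishart model
    (∀ α β τ : ℝ, 0 < α → 0 < β → 0 < τ → α * √τ < 1 → β * √τ < 1 → spikedKappa α β τ < 1 →
      ∃ c > (0 : ℝ), ∀ n m : ℕ → ℕ,
        Tendsto n atTop atTop →
        Tendsto (fun j => (n j : ℝ) / (m j : ℝ)) atTop (𝓝 τ) →
        ∀ ε ∈ Ioo (0 : ℝ) 1, ∀ᶠ j in atTop,
          wishartNull (n j) (m j)
              {p | 1 + ε ≤ lambdaMax (wishartW α β τ (Matrix.of p.1) (Matrix.of p.2))}
            ≤ ENNReal.ofReal (Real.exp (-(c * (n j : ℝ) * ε ^ 2)))) := by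
  refine ⟨fun τm τk hτm hτk hκ => ?_, fun α hα β hβ hκ => wigner_bound hα hβ hκ,
    fun α β τ hα hβ hτ hα1 hβ1 hκ => wishart_bound hα hβ hτ hα1 hβ1 hκ⟩
  obtain ⟨c, hc, C, hC, h⟩ := cca_bound hτm hτk hκ
  exact ⟨c, hc, C, hC, fun n m k _ hm hk => h n m k hm hk⟩
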